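/- An uncertain set $\mathcal P$ in the multipoint model in $\mathbb R^d$ consists of $m$ uncertain points; the $i$-th one has finitely many possible sites $p_{i,1},\dots,p_{i,n_i}\in\mathbb R^d$ with probabilities $\pi_{i,1},\dots,\pi_{i,n_i}\in(0,1]$ such that $\sum_{j}\pi_{i,j}\le 1$. Independently for every $i$, the $i$-th uncertain point is located at $p_{i,j}$ with probability $\pi_{i,j}$ and does not exist with probability $1-\sum_j\pi_{i,j}$. Let $n=\sum_{i=1}^m n_i$ be the total number of sites. The membership probability of a point $q\in\mathbb R^d$ is the probability that $q$ lies in the convex hull of the random set of points that exist. Say that the sites and $q$ are in general position if for every $2\le k\le d$ and every set of $k$ coordinates, no $k+1$ of these $n+1$ points lie, after projection to these $k$ coordinates, on a common hyperplane of $\mathbb R^k$. The model of computation is the real RAM: a unit-cost random access machine with exact arithmetic operations ($+,-,\times,/$) and comparisons on real numbers, addition, subtraction and comparison of natural numbers, and indirect addressing. The input lists the sites, each with its coordinates, its probability and the index $i$ of its uncertain point, together with $q$. **Theorem.** (a) For $d=2$ there is a real RAM program that, given any uncertain set $\mathcal P$ in the multipoint model in $\mathbb R^2$ with $n$ sites and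 any point $q\in\mathbb R^2$, computes the membership probability of $q$ in $O(n\log n)$ time. (b) For every fixed $d\ge 3$ there is a real RAM program that, given any uncertain set $\mathcal P$ in the multipoint model in $\mathbb R^d$ with $n$ sites and any point $q\in\mathbb R^d$ such that the sites and $q$ are in general position, computes the membership probability of $q$ in $O(n^d)$ time (the constant may depend on $d$). -/

import Mathlib

/-! ### Uncertain points in the multipoint model -/

/-- An uncertain set of `m` points in `ℝᵈ` in the multipoint model with `n` sites in total.
The sites are numbered by `Fin n`; site `s` belongs to the uncertain point `group s`, so the
possible sites of the `i`-th uncertain point are those `s` with `group s = i`.  The probabilities of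
the sites of one uncertain point sum to at most `1`; what is missing is the probability that this
point does not exist. -/
structure MultipointSet (d : ℕ) where
  m : ℕ
  n : ℕ
  group : Fin n → Fin m
  site : Fin n → (Fin d → ℝ)
  prob : Fin n → ℝ
  prob_mem : ∀ s, prob s ∈ Set.Ioc (0 : ℝ) 1
  sum_prob_le_one : ∀ i, ∑ s with group s = i, prob s ≤ 1

namespace MultipointSet

variable {d : ℕ}

/-- The probability that the `i`-th uncertain point is at the site `s` (zero if `s` is not one of
its sites), or, for `none`, that it does not exist. -/
def locationProb (P : MultipointSet d) (i : Fin P.m) : Option (Fin P.n) → ℝ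
  | some s => if P.group s = i then P.prob s else 0
  | none => 1 - ∑ s with P.group s = i, P.prob s

/-- The probability of the outcome in which, for every `i`, the `i`-th uncertain point has the
location `ω i`; different uncertain points are independent. -/
def outcomeProb (P : MultipointSet d) (ω : Fin P.m → Option (Fin P.n)) : ℝ :=
  ∏ i, P.locationProb i (ω i)

/-- The set of points of `ℝᵈ` that are present in the outcome `ω`. -/
def outcomeSites (P : MultipointSet d) (ω : Fin P.m → Option (Fin P.n)) : Set (Fin d → ℝ) :=
  {x | ∃ i s, ω i = some s ∧ P.site s = x}

open Classical in
/-- The membership probability of `q`: the probability that `q` lies in the convex hull of the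
outcome of the experiment. -/
noncomputable def membershipProb (P : MultipointSet d) (q : Fin d → ℝ) : ℝ :=
  ∑ ω : Fin P.m → Option (Fin P.n) with q ∈ convexHull ℝ (P.outcomeSites ω), P.outcomeProb ω

/-- The sites together with the query point, which has the index `none`. -/
def pointOf (P : MultipointSet d) (q : Fin d → ℝ) : Option (Fin P.n) → (Fin d → ℝ)
  | some s => P.site s
  | none => q

/-- General position of the sites and the query point: for `2 ≤ k ≤ d`, no `k + 1` of the points
lie on a common hyperplane of `ℝᵏ` when they are projected to a set `J` of `k` coordinates. -/
def GeneralPosition (P : MultipointSet d) (q : Fin d → ℝ) : Prop :=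
  ∀ (k : ℕ) (J : Finset (Fin d)) (S : Finset (Option (Fin P.n))),
    2 ≤ k → k ≤ d → J.card = k → S.card = k + 1 →
      ¬ ∃ (a : Fin d → ℝ) (b : ℝ), (∃ c ∈ J, a c ≠ 0) ∧
        ∀ x ∈ S, ∑ c ∈ J, a c * P.pointOf q x c = b

end MultipointSet

/-! ### The real RAM

A unit-cost random access machine with exact real arithmetic.  It has finitely many arrays of
natural numbers and finitely many arrays of reals (those that occur in the program), with indirect
addressing.  Natural numbers can be added, subtracted (truncated at `0`) and compared, reals can be
added, subtracted, multiplied, divided and compared; a program can contain only integer constants,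
and there is no conversion from reals to natural numbers.  Programs are written with the usual
control structures in place of jumps. -/

namespace RealRAM

/-- `nat a i` and `real a i` are the contents of the `i`-th cell of the `a`-th array. -/
structure Memory where
  nat : ℕ → ℕ → ℕ
  real : ℕ → ℕ → ℝ

/-- Expressions of natural number type; `get a e` reads the cell with index `e` of array `a`. -/
inductive NatExpr where
  | lit (k : ℕ)
  | get (a : ℕ) (e : NatExpr)
  | add (e f : NatExpr)
  | sub (e f : NatExpr)

/-- Expressions of real type. -/
inductive RealExpr where
  | lit (z : ℤ)
  | get (a : ℕ) (e : NatExpr)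
  | add (e f : RealExpr)
  | sub (e f : RealExpr)
  | mul (e f : RealExpr)
  | div (e f : RealExpr)

/-- Tests. -/
inductive Test where
  | natLt (e f : NatExpr)
  | realLt (e f : RealExpr)
  | not (b : Test)
  | and (b c : Test)

/-- Programs; `setNat a e f` stores the value of `f` in the cell with index `e` of array `a`. -/
inductive Program where
  | skip
  | setNat (a : ℕ) (e f : NatExpr)
  | setReal (a : ℕ) (e : NatExpr) (f : RealExpr)
  | seq (p r : Program)
  | ite (b : Test) (p r : Program)
  | while (b : Test) (p : Program)

def NatExpr.eval (M : Memory) : NatExpr → ℕ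
  | lit k => k
  | get a e => M.nat a (e.eval M)
  | add e f => e.eval M + f.eval M
  | sub e f => e.eval M - f.eval M

/-- The number of constants, memory accesses and arithmetic operations in an expression. -/
def NatExpr.cost : NatExpr → ℕ
  | lit _ => 1
  | get _ e => e.cost + 1
  | add e f => e.cost + f.cost + 1
  | sub e f => e.cost + f.cost + 1

/-- A division by zero yields zero. -/
noncomputable def RealExpr.eval (M : Memory) : RealExpr → ℝ
  | lit z => z
  | get a e => M.real a (e.eval M)
  | add e f => e.eval M + f.eval M
  | sub e f => e.eval M - f.eval M
  | mul e f => e.eval M * f.eval M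
  | div e f => e.eval M / f.eval M

def RealExpr.cost : RealExpr → ℕ
  | lit _ => 1
  | get _ e => e.cost + 1
  | add e f => e.cost + f.cost + 1
  | sub e f => e.cost + f.cost + 1
  | mul e f => e.cost + f.cost + 1
  | div e f => e.cost + f.cost + 1

def Test.Holds (M : Memory) : Test → Prop
  | natLt e f => e.eval M < f.eval M
  | realLt e f => e.eval M < f.eval M
  | not b => ¬ b.Holds M
  | and b c => b.Holds M ∧ c.Holds M

def Test.cost : Test → ℕ
  | natLt e f => e.cost + f.cost + 1
  | realLt e f => e.cost + f.cost + 1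
  | not b => b.cost + 1
  | and b c => b.cost + c.cost + 1

def Memory.storeNat (M : Memory) (a i v : ℕ) : Memory where
  nat := Function.update M.nat a (Function.update (M.nat a) i v)
  real := M.real

noncomputable def Memory.storeReal (M : Memory) (a i : ℕ) (v : ℝ) : Memory where
  nat := M.nat
  real := Function.update M.real a (Function.update (M.real a) i v)

/-- `Run p M t M'`: started in the memory `M`, the program `p` halts after exactly `t` steps, and
the memory is then `M'`. -/
inductive Run : Program → Memory → ℕ → Memory → Prop
  | skip (M : Memory) : Run .skip M 1 M
  | setNat (a : ℕ) (e f : NatExpr) (M : Memory) :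
      Run (.setNat a e f) M (e.cost + f.cost + 1) (M.storeNat a (e.eval M) (f.eval M))
  | setReal (a : ℕ) (e : NatExpr) (f : RealExpr) (M : Memory) :
      Run (.setReal a e f) M (e.cost + f.cost + 1) (M.storeReal a (e.eval M) (f.eval M))
  | seq {p r : Program} {M M' M'' : Memory} {t u : ℕ} :
      Run p M t M' → Run r M' u M'' → Run (.seq p r) M (t + u) M''
  | ite_true {b : Test} {p r : Program} {M M' : Memory} {t : ℕ} :
      b.Holds M → Run p M t M' → Run (.ite b p r) M (b.cost + t + 1) M'
  | ite_false {b : Test} {p r : Program} {M M' : Memory} {t : ℕ} :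
      ¬ b.Holds M → Run r M t M' → Run (.ite b p r) M (b.cost + t + 1) M'
  | while_true {b : Test} {p : Program} {M M' M'' : Memory} {t u : ℕ} :
      b.Holds M → Run p M t M' → Run (.while b p) M' u M'' →
        Run (.while b p) M (b.cost + t + u + 1) M''
  | while_false {b : Test} {p : Program} {M : Memory} :
      ¬ b.Holds M → Run (.while b p) M (b.cost + 1) M

/-- The memory that holds the input.  Natural numbers: array `0` holds the number `n` of sites in
cell `0`, and array `1` holds the number of the uncertain point of site `s` in cell `s`.  Reals:
array `0` holds the coordinates of the query point, array `1` the probabilities of the sites, and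
array `2 + c` the `c`-th coordinates of the sites.  All other cells are zero. -/
noncomputable def inputMemory {d : ℕ} (P : MultipointSet d) (q : Fin d → ℝ) : Memory where
  nat a i :=
    if a = 0 ∧ i = 0 then P.n
    else if h : a = 1 ∧ i < P.n then (P.group ⟨i, h.2⟩ : ℕ)
    else 0
  real a i :=
    if h : a = 0 ∧ i < d then q ⟨i, h.2⟩
    else if h : a = 1 ∧ i < P.n then P.prob ⟨i, h.2⟩
    else if h : (2 ≤ a ∧ a - 2 < d) ∧ i < P.n then P.site ⟨i, h.2⟩ ⟨a - 2, h.1.2⟩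
    else 0

/-- On the input `P`, `q`, the program halts after at most `t` steps, with the membership
probability of `q` in cell `0` of the real array `0`. -/
def ComputesMembershipWithin {d : ℕ} (prog : Program) (P : MultipointSet d) (q : Fin d → ℝ)
    (t : ℕ) : Prop :=
  ∃ (u : ℕ) (M : Memory),
    Run prog (inputMemory P q) u M ∧ u ≤ t ∧ M.real 0 0 = P.membershipProb q

end RealRAM

/-! The hull of the set `B` of occupied sites misses `q` exactly when some linear functional is
positive on all vectors from `q` to `B` (`notMem_convexHull_iff`). For both parts the indicator of
this event becomes a signed sum of indicators of elementary events of the form "these few sites are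
occupied and none of those is". Different uncertain points are independent, so an elementary event
has a product as its probability: the probabilities of the prescribed sites times one factor for
each remaining uncertain point (`expect_tupleEvent`).

For `d ≥ 3` the last coordinate of the normal vector is normalised to `1` or `-1`. In general
position a half-space in `e + 1` coordinates exists iff one of the two normalised systems is
solvable, and both are solvable iff a half-space exists already in the first `e` coordinates.
Inclusion and exclusion (`openSide_succ_indicator`) lowers the dimension until it is one, where
everything is explicit (`openSide_one_indicator`). The solutions of a normalised system form a
polyhedron in `ℝᵉ`. It is nonempty iff it has a point of least norm, and general position makes the
set of constraints with positive multipliers at that point unique and of size at most `e`. That a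
given tuple is this set is an elementary event, provided that the tuple passes a sign test on
determinants: its sites are occupied, and no occupied site violates its constraint at the point
given by the tuple (`sum_tupleEvent`). As `e ≤ d - 1`, there are `O(n ^ (d - 1))` tuples, each
handled in linear time.

For `d = 2` all vectors are turned into the upper half-plane, and it is recorded which ones were
turned. The hull misses `q` iff no vector is zero and the lines of one kind strictly precede those
of the other kind (`openSide_two_iff`). The nonempty sets of this sort are classified by the kind
with the larger angles and by its first occupied site in the angular order (`sum_sweep`). Along this
order only one factor of the product changes per step. Vanishing factors are counted separately, so
that a factor can always be divided out; each step takes constant time, and merge sort dominates. -/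

namespace RealRAM

/-! ### Reasoning about programs -/

/-- Started in `M`, the program `p` halts within `t` steps in a memory that satisfies `Q`. -/
def Ends (p : Program) (M : Memory) (t : ℕ) (Q : Memory → Prop) : Prop :=
  ∃ (u : ℕ) (M' : Memory), Run p M u M' ∧ u ≤ t ∧ Q M'

namespace Program

/-- `p` contains an assignment to the array `a` of natural numbers. -/
def WritesNat : Program → ℕ → Prop
  | skip, _ => False
  | setNat b _ _, a => a = b
  | setReal _ _ _, _ => False
  | seq p r, a => p.WritesNat a ∨ r.WritesNat a
  | ite _ p r, a => p.WritesNat a ∨ r.WritesNat a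
  | .while _ p, a => p.WritesNat a

/-- `p` contains an assignment to the array `a` of reals. -/
def WritesReal : Program → ℕ → Prop
  | skip, _ => False
  | setNat _ _ _, _ => False
  | setReal b _ _, a => a = b
  | seq p r, a => p.WritesReal a ∨ r.WritesReal a
  | ite _ p r, a => p.WritesReal a ∨ r.WritesReal a
  | .while _ p, a => p.WritesReal a

/-- `p` contains no loop. -/
def LoopFree : Program → Prop
  | seq p r => p.LoopFree ∧ r.LoopFree
  | ite _ p r => p.LoopFree ∧ r.LoopFree
  | .while _ _ => False
  | _ => True

/-- An upper bound for the running time of a loop-free program. -/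
def cost : Program → ℕ
  | skip => 1
  | setNat _ e f => e.cost + f.cost + 1
  | setReal _ e f => e.cost + f.cost + 1
  | seq p r => p.cost + r.cost
  | ite b p r => b.cost + (p.cost + r.cost) + 1
  | .while _ _ => 0

open Classical in
/-- The effect of a loop-free program. -/
noncomputable def exec : Program → Memory → Memory
  | skip, M => M
  | setNat a e f, M => M.storeNat a (e.eval M) (f.eval M)
  | setReal a e f, M => M.storeReal a (e.eval M) (f.eval M)
  | seq p r, M => r.exec (p.exec M)
  | ite b p r, M => if b.Holds M then p.exec M else r.exec M
  | .while _ _, M => M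

end Program

theorem Memory.storeNat_nat (M : Memory) (a i v b : ℕ) :
    (M.storeNat a i v).nat b = if b = a then Function.update (M.nat a) i v else M.nat b := by
  simp only [Memory.storeNat, Function.update_apply]

@[simp] theorem Memory.storeNat_real (M : Memory) (a i v : ℕ) :
    (M.storeNat a i v).real = M.real := rfl

theorem Memory.storeReal_real (M : Memory) (a i : ℕ) (v : ℝ) (b : ℕ) :
    (M.storeReal a i v).real b = if b = a then Function.update (M.real a) i v else M.real b := by
  simp only [Memory.storeReal, Function.update_apply]

@[simp] theorem Memory.storeReal_nat (M : Memory) (a i : ℕ) (v : ℝ) :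
    (M.storeReal a i v).nat = M.nat := rfl

/-- `M'` agrees with `M` on all arrays to which `p` contains no assignment. -/
def Frame (p : Program) (M M' : Memory) : Prop :=
  (∀ a, ¬ p.WritesNat a → M'.nat a = M.nat a) ∧ ∀ a, ¬ p.WritesReal a → M'.real a = M.real a

theorem Frame.rfl {p : Program} {M : Memory} : Frame p M M := ⟨fun _ _ => .refl _, fun _ _ => .refl _⟩

/-- Only assignments change the memory, so preservation can be read off from the syntax.
Postconditions can then be restricted to the arrays of interest; the rest is recovered from `Frame`.
-/
theorem Run.frame {p : Program} {M M' : Memory} {t : ℕ} (h : Run p M t M') : Frame p M M' := by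
  induction h with
  | skip M => exact Frame.rfl
  | setNat a e f M =>
    refine ⟨fun b hb => ?_, fun b _ => rfl⟩
    exact (Memory.storeNat_nat M a _ _ b).trans (if_neg hb)
  | setReal a e f M =>
    refine ⟨fun b _ => rfl, fun b hb => ?_⟩
    exact (Memory.storeReal_real M a _ _ b).trans (if_neg hb)
  | seq _ _ h₁ h₂ =>
    exact ⟨fun a ha => (h₂.1 a fun h => ha (.inr h)).trans (h₁.1 a fun h => ha (.inl h)),
      fun a ha => (h₂.2 a fun h => ha (.inr h)).trans (h₁.2 a fun h => ha (.inl h))⟩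
  | ite_true _ _ h =>
    exact ⟨fun a ha => h.1 a fun h => ha (.inl h), fun a ha => h.2 a fun h => ha (.inl h)⟩
  | ite_false _ _ h =>
    exact ⟨fun a ha => h.1 a fun h => ha (.inr h), fun a ha => h.2 a fun h => ha (.inr h)⟩
  | while_true _ _ _ h₁ h₂ =>
    exact ⟨fun a ha => (h₂.1 a ha).trans (h₁.1 a ha), fun a ha => (h₂.2 a ha).trans (h₁.2 a ha)⟩
  | while_false _ => exact Frame.rfl

theorem Ends.mono {p : Program} {M : Memory} {t t' : ℕ} {Q Q' : Memory → Prop}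
    (h : Ends p M t Q) (ht : t ≤ t') (hQ : ∀ M', Frame p M M' → Q M' → Q' M') :
    Ends p M t' Q' := by
  obtain ⟨u, M', hr, hu, hq⟩ := h
  exact ⟨u, M', hr, hu.trans ht, hQ M' hr.frame hq⟩

theorem Ends.imp {p : Program} {M : Memory} {t : ℕ} {Q Q' : Memory → Prop}
    (h : Ends p M t Q) (hQ : ∀ M', Frame p M M' → Q M' → Q' M') : Ends p M t Q' :=
  h.mono le_rfl hQ

theorem Ends.seq {p r : Program} {M : Memory} {t u : ℕ} {Q R : Memory → Prop}
    (hp : Ends p M t R) (hr : ∀ M', Frame p M M' → R M' → Ends r M' u Q) :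
    Ends (.seq p r) M (t + u) Q := by
  obtain ⟨a, M₁, h₁, ha, hR⟩ := hp
  obtain ⟨b, M₂, h₂, hb, hQ⟩ := hr M₁ h₁.frame hR
  exact ⟨a + b, M₂, .seq h₁ h₂, by omega, hQ⟩

theorem Ends.ite {b : Test} {p r : Program} {M : Memory} {t : ℕ} {Q : Memory → Prop}
    (hp : b.Holds M → Ends p M t Q) (hr : ¬ b.Holds M → Ends r M t Q) :
    Ends (.ite b p r) M (b.cost + t + 1) Q := by
  by_cases hb : b.Holds M
  · obtain ⟨u, M', h, hu, hQ⟩ := hp hb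
    exact ⟨_, M', .ite_true hb h, by omega, hQ⟩
  · obtain ⟨u, M', h, hu, hQ⟩ := hr hb
    exact ⟨_, M', .ite_false hb h, by omega, hQ⟩

/-- Without loops a run follows the function `exec`, so straight-line code is verified by
simplification. The bound charges both branches of a conditional, which is harmless up to constants.
-/
theorem Ends.of_loopFree {p : Program} (hp : p.LoopFree) {M : Memory} {Q : Memory → Prop}
    (hQ : Q (p.exec M)) : Ends p M p.cost Q := by
  suffices h : ∃ u, Run p M u (p.exec M) ∧ u ≤ p.cost by
    obtain ⟨u, hr, hu⟩ := h
    exact ⟨u, _, hr, hu, hQ⟩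
  clear hQ
  induction p generalizing M with
  | skip => exact ⟨_, .skip M, le_rfl⟩
  | setNat a e f => exact ⟨_, .setNat a e f M, le_rfl⟩
  | setReal a e f => exact ⟨_, .setReal a e f M, le_rfl⟩
  | seq p r ihp ihr =>
    obtain ⟨u, h₁, hu⟩ := ihp hp.1 (M := M)
    obtain ⟨v, h₂, hv⟩ := ihr hp.2 (M := p.exec M)
    exact ⟨_, .seq h₁ h₂, add_le_add hu hv⟩
  | ite b p r ihp ihr =>
    by_cases hb : b.Holds M
    · obtain ⟨u, h₁, hu⟩ := ihp hp.1 (M := M)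
      refine ⟨_, by rw [Program.exec, if_pos hb]; exact .ite_true hb h₁, ?_⟩
      simp only [Program.cost]; omega
    · obtain ⟨u, h₁, hu⟩ := ihr hp.2 (M := M)
      refine ⟨_, by rw [Program.exec, if_neg hb]; exact .ite_false hb h₁, ?_⟩
      simp only [Program.cost]; omega
  | _ b p => exact hp.elim

/-- The rule for loops; `I t` is an invariant from which the loop ends within `t` steps. -/
theorem Ends.while {b : Test} {p : Program} {Q : Memory → Prop} (I : ℕ → Memory → Prop)
    (h : ∀ t M, I t M → (¬ b.Holds M ∧ b.cost + 1 ≤ t ∧ Q M) ∨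
      (b.Holds M ∧ ∃ u v, b.cost + u + v + 1 ≤ t ∧ Ends p M u (I v)))
    {t : ℕ} {M : Memory} (hI : I t M) : Ends (.while b p) M t Q := by
  induction t using Nat.strong_induction_on generalizing M with
  | _ t ih =>
    rcases h t M hI with ⟨hb, ht, hQ⟩ | ⟨hb, u, v, ht, u', M', hr, hu, hI'⟩
    · exact ⟨_, M, .while_false hb, ht, hQ⟩
    · obtain ⟨w, M'', hr', hw, hQ⟩ := ih v (by omega) hI'
      exact ⟨_, M'', .while_true hb hr hr', by omega, hQ⟩

/-- The content of cell `0` of an array, which serves as a register. -/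
abbrev NatExpr.reg (a : ℕ) : NatExpr := .get a (.lit 0)

/-- The content of cell `0` of an array, which serves as a register. -/
abbrev RealExpr.reg (a : ℕ) : RealExpr := .get a (.lit 0)

/-- Executes `p` for all values of the register `i` from `0` to `n - 1`, where `n` is the number of
sites. -/
def forSites (i : ℕ) (p : Program) : Program :=
  .seq (.setNat i (.lit 0) (.lit 0))
    (.while (.natLt (.reg i) (.reg 0)) (.seq p (.setNat i (.lit 0) (.add (.reg i) (.lit 1)))))

@[simp] theorem forSites_writesNat (i : ℕ) (p : Program) (a : ℕ) :
    (forSites i p).WritesNat a ↔ a = i ∨ p.WritesNat a := by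
  simp only [forSites, Program.WritesNat]; tauto

@[simp] theorem forSites_writesReal (i : ℕ) (p : Program) (a : ℕ) :
    (forSites i p).WritesReal a ↔ p.WritesReal a := by
  simp only [forSites, Program.WritesReal]; tauto

/-- The rule for loops over all sites. -/
theorem Ends.forSites {i n c : ℕ} {p : Program} {M₀ : Memory} (I : ℕ → Memory → Prop)
    (hi : i ≠ 0) (hpi : ¬ p.WritesNat i) (hp0 : ¬ p.WritesNat 0) (hn : M₀.nat 0 0 = n)
    (hI : ∀ k M v, I k M → I k (M.storeNat i 0 v)) (h0 : I 0 M₀)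
    (hstep : ∀ k < n, ∀ M, Frame (forSites i p) M₀ M → M.nat i 0 = k → I k M →
      Ends p M c (I (k + 1))) :
    Ends (forSites i p) M₀ (n * (c + 12) + 9) (I n) := by
  have hstart : Ends (.setNat i (.lit 0) (.lit 0)) M₀ 3
      (fun M => M.nat i 0 = 0 ∧ I 0 M ∧ Frame (RealRAM.forSites i p) M₀ M) := by
    refine ⟨_, _, .setNat .., le_rfl, ?_, hI _ _ _ h0, ?_, fun _ _ => rfl⟩
    · simp [Memory.storeNat_nat, NatExpr.eval]
    · intro a ha
      rw [Memory.storeNat_nat, if_neg]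
      rintro rfl; simp at ha
  refine Ends.mono (t := 3 + (n * (c + 12) + 6)) (Ends.seq hstart ?_) (by omega)
    (fun M' _ h => h)
  rintro M _ ⟨hM, hIM, hF⟩
  -- A round costs `c` for the body and 12 for test, loop and increment; the final test costs 6, the
  -- initialisation 3.
  refine Ends.while (I := fun t M => ∃ k ≤ n, t = (n - k) * (c + 12) + 6 ∧ M.nat i 0 = k ∧ I k M ∧
    Frame (RealRAM.forSites i p) M₀ M) ?_ ⟨0, by omega, by simp, hM, hIM, hF⟩
  rintro t M ⟨k, hk, rfl, hM, hIM, hF⟩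
  have hM0 : M.nat 0 0 = n := by
    rw [hF.1 0 (by simp [hi.symm, hp0]), hn]
  rcases hk.eq_or_lt with rfl | hk
  · left
    refine ⟨?_, ?_, hIM⟩
    · simp [Test.Holds, NatExpr.eval, hM, hM0]
    · simp [Test.cost, NatExpr.cost]
  · right
    refine ⟨?_, c + 6, (n - (k + 1)) * (c + 12) + 6, ?_, ?_⟩
    · simp [Test.Holds, NatExpr.eval, hM, hM0, hk]
    · obtain ⟨r, rfl⟩ : ∃ r, n = k + 1 + r := ⟨n - (k + 1), by omega⟩
      have h1 : k + 1 + r - k = r + 1 := by omega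
      have h2 : k + 1 + r - (k + 1) = r := by omega
      rw [h1, h2]
      simp only [Test.cost, NatExpr.cost]
      ring_nf; omega
    · refine Ends.seq (hstep k hk M hF hM hIM) fun M' hF' hI' => ?_
      refine ⟨_, _, .setNat .., by simp [NatExpr.cost], k + 1, hk, rfl, ?_, hI _ _ _ hI', ?_⟩
      · simp [Memory.storeNat_nat, NatExpr.eval, hF'.1 i hpi, hM]
      · refine ⟨fun a ha => ?_, fun a ha => ?_⟩
        · rw [forSites_writesNat, not_or] at ha
          rw [Memory.storeNat_nat, if_neg ha.1, hF'.1 a ha.2, hF.1 a (by simp [ha])]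
        · rw [Memory.storeNat_real, hF'.2 a (by simpa using ha), hF.2 a ha]

end RealRAM

/-! ### Probabilities of elementary events -/

namespace MultipointSet

variable {d : ℕ}

/-- The sites that are occupied in the outcome `ω`. -/
def present (P : MultipointSet d) (ω : Fin P.m → Option (Fin P.n)) : Finset (Fin P.n) :=
  {s | ω (P.group s) = some s}

/-- The expected value of a function of the set of occupied sites. -/
noncomputable def expect (P : MultipointSet d) (f : Finset (Fin P.n) → ℝ) : ℝ :=
  ∑ ω, P.outcomeProb ω * f (P.present ω)

theorem sum_locationProb (P : MultipointSet d) (i : Fin P.m) : ∑ o, P.locationProb i o = 1 := by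
  simp [Fintype.sum_option, locationProb, Finset.sum_ite]

theorem sum_outcomeProb (P : MultipointSet d) : ∑ ω, P.outcomeProb ω = 1 := by
  have h := Finset.prod_univ_sum (fun _ : Fin P.m => (Finset.univ : Finset (Option (Fin P.n))))
    (fun i o => P.locationProb i o)
  simp only [sum_locationProb, Finset.prod_const_one, Fintype.piFinset_univ] at h
  exact h.symm

theorem expect_add (P : MultipointSet d) (f g : Finset (Fin P.n) → ℝ) :
    P.expect (fun B => f B + g B) = P.expect f + P.expect g := by
  simp [expect, mul_add, Finset.sum_add_distrib]

theorem expect_sub (P : MultipointSet d) (f g : Finset (Fin P.n) → ℝ) :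
    P.expect (fun B => f B - g B) = P.expect f - P.expect g := by
  simp [expect, mul_sub, Finset.sum_sub_distrib]

theorem expect_sum (P : MultipointSet d) {ι : Type*} (s : Finset ι)
    (f : ι → Finset (Fin P.n) → ℝ) :
    P.expect (fun B => ∑ i ∈ s, f i B) = ∑ i ∈ s, P.expect (f i) := by
  simp only [expect, Finset.mul_sum]
  exact Finset.sum_comm

/-- An outcome may formally send an uncertain point to a site of another group, but then a factor of
its probability vanishes. -/
theorem outcomeSites_eq (P : MultipointSet d) {ω : Fin P.m → Option (Fin P.n)}
    (h : P.outcomeProb ω ≠ 0) : P.outcomeSites ω = P.site '' (P.present ω : Set (Fin P.n)) := by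
  ext x
  simp only [outcomeSites, present, Set.mem_ofPred_eq, Set.mem_image, Finset.coe_filter,
    Finset.mem_univ, true_and]
  constructor
  · rintro ⟨i, s, hs, rfl⟩
    refine ⟨s, ?_, rfl⟩
    have hi := Finset.prod_ne_zero_iff.1 h i (Finset.mem_univ _)
    rw [hs] at hi
    by_cases hg : P.group s = i
    · rw [hg, hs]
    · simp [locationProb, hg] at hi
  · rintro ⟨s, hs, rfl⟩
    exact ⟨_, s, hs, rfl⟩

open Classical in
theorem membershipProb_eq (P : MultipointSet d) (q : Fin d → ℝ) :
    P.membershipProb q =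
      1 - P.expect fun B => if q ∉ convexHull ℝ (P.site '' (B : Set (Fin P.n))) then 1 else 0 := by
  rw [eq_sub_iff_add_eq]
  refine Eq.trans ?_ P.sum_outcomeProb
  rw [membershipProb, expect, Finset.sum_filter, ← Finset.sum_add_distrib]
  refine Finset.sum_congr rfl fun ω _ => ?_
  by_cases h : P.outcomeProb ω = 0
  · simp [h]
  · rw [P.outcomeSites_eq h]
    by_cases hq : q ∈ convexHull ℝ (P.site '' (P.present ω : Set (Fin P.n))) <;> simp [hq]

open Classical in
/-- The indicator of the event that all sites `t l` are occupied and no site of `F` is. -/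
noncomputable def tupleEvent {n j : ℕ} (t : Fin j → Fin n) (F : Fin n → Prop)
    (B : Finset (Fin n)) : ℝ :=
  if (∀ l, t l ∈ B) ∧ ∀ s ∈ B, ¬ F s then 1 else 0

open Classical in
/-- The probability that all sites `t l` are occupied and no site of `F` is. -/
noncomputable def tupleProb (P : MultipointSet d) {j : ℕ} (t : Fin j → Fin P.n)
    (F : Fin P.n → Prop) : ℝ :=
  (∏ l, P.prob (t l)) * ∏ i, if ∃ l, P.group (t l) = i then 1 else
    1 - ∑ s with F s ∧ P.group s = i, P.prob s

/-- The event restricts the location of each uncertain point separately, so it is a product set of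
outcomes and its probability factorises. -/
theorem expect_tupleEvent (P : MultipointSet d) {j : ℕ} {t : Fin j → Fin P.n}
    {F : Fin P.n → Prop} (ht : Function.Injective fun l => P.group (t l)) (hF : ∀ l, ¬ F (t l)) :
    P.expect (tupleEvent t F) = P.tupleProb t F := by
  classical
  let A : Fin P.m → Finset (Option (Fin P.n)) := fun i =>
    {o | (∀ l, P.group (t l) = i → o = some (t l)) ∧ ∀ s, o = some s → P.group s = i → ¬ F s}
  have hA : ∀ ω, ((∀ l, t l ∈ P.present ω) ∧ ∀ s ∈ P.present ω, ¬ F s) ↔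
      ω ∈ Fintype.piFinset A := by
    intro ω
    simp only [present, Finset.mem_filter, Finset.mem_univ, true_and, Fintype.mem_piFinset, A]
    constructor
    · rintro ⟨h₁, h₂⟩ i
      exact ⟨fun l hl => hl ▸ h₁ l, fun s hs hi => h₂ s (hi ▸ hs)⟩
    · intro h
      exact ⟨fun l => (h _).1 l rfl, fun s hs => (h _).2 s hs rfl⟩
  have h1 : P.expect (tupleEvent t F) = ∑ ω ∈ Fintype.piFinset A, P.outcomeProb ω := by
    rw [expect, ← Finset.sum_filter_add_sum_filter_not Finset.univ (· ∈ Fintype.piFinset A)]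
    rw [Finset.sum_eq_zero (s := Finset.univ.filter fun ω => ω ∉ Fintype.piFinset A), add_zero]
    · refine Finset.sum_congr (by ext; simp) fun ω hω => ?_
      rw [tupleEvent, if_pos ((hA ω).2 hω), mul_one]
    · intro ω hω
      rw [tupleEvent, if_neg, mul_zero]
      rw [hA]; simpa using hω
  -- An uncertain point with a site in the tuple has one location left; any other only loses its
  -- forbidden sites. The last product files each `P.prob (t l)` under its group, and
  -- `Finset.prod_fiberwise` undoes this at the end.
  have h2 : ∀ i, ∑ o ∈ A i, P.locationProb i o =
      (if ∃ l, P.group (t l) = i then 1 else 1 - ∑ s with F s ∧ P.group s = i, P.prob s) *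
        ∏ l with P.group (t l) = i, P.prob (t l) := by
    intro i
    split_ifs with hi
    · obtain ⟨l, rfl⟩ := hi
      have hs : A (P.group (t l)) = {some (t l)} := by
        ext o
        simp only [A, Finset.mem_filter, Finset.mem_univ, true_and, Finset.mem_singleton]
        refine ⟨fun h => h.1 l rfl, ?_⟩
        rintro rfl
        refine ⟨fun l' hl' => ?_, ?_⟩
        · rw [ht hl']
        · rintro s hs -
          obtain rfl := Option.some.inj hs
          exact hF l
      have hl : (Finset.univ.filter fun l' => P.group (t l') = P.group (t l)) = {l} := by
        ext l'
        simp only [Finset.mem_filter, Finset.mem_univ, true_and, Finset.mem_singleton]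
        exact ⟨fun h => ht h, fun h => h ▸ rfl⟩
      rw [hs, hl]
      simp [locationProb]
    · have hl : (Finset.univ.filter fun l' => P.group (t l') = i) = ∅ := by
        ext l'
        simpa using fun h => hi ⟨l', h⟩
      rw [hl, Finset.prod_empty, mul_one, eq_sub_iff_add_eq]
      have hAi : A i = Finset.univ.filter fun o => ∀ s, o = some s → P.group s = i → ¬ F s := by
        ext o
        simp only [A, Finset.mem_filter, Finset.mem_univ, true_and, and_iff_right_iff_imp]
        exact fun _ l h => (hi ⟨l, h⟩).elim
      rw [hAi, ← P.sum_locationProb i, Finset.sum_filter, Fintype.sum_option, Fintype.sum_option,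
        add_assoc, Finset.sum_filter, ← Finset.sum_add_distrib]
      congr 1
      · simp
      · refine Finset.sum_congr rfl fun s _ => ?_
        by_cases hg : P.group s = i <;> by_cases hFs : F s <;> simp [locationProb, hg, hFs]
  rw [h1]
  simp only [outcomeProb]
  rw [← Finset.prod_univ_sum, Finset.prod_congr rfl fun i _ => h2 i, Finset.prod_mul_distrib,
    tupleProb, mul_comm, Finset.prod_fiberwise]

/-- An uncertain point is never at two different sites at once. -/
theorem expect_tupleEvent_eq_zero (P : MultipointSet d) {j : ℕ} {t : Fin j → Fin P.n}
    {F : Fin P.n → Prop} (ht : Function.Injective t)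
    (hg : ¬ Function.Injective fun l => P.group (t l)) : P.expect (tupleEvent t F) = 0 := by
  refine Finset.sum_eq_zero fun ω _ => ?_
  rw [tupleEvent, if_neg, mul_zero]
  rintro ⟨h, -⟩
  refine hg fun l l' hl => ht ?_
  have h₁ := h l
  have h₂ := h l'
  simp only [present, Finset.mem_filter, Finset.mem_univ, true_and] at h₁ h₂ hl
  rw [hl, h₂] at h₁
  exact (Option.some.inj h₁).symm

end MultipointSet

namespace RealRAM

/-! ### The probability of an elementary event in linear time -/

variable {d : ℕ}

/-- The input arrays of the memory hold `P` and `q`. -/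
structure HoldsInput (P : MultipointSet d) (q : Fin d → ℝ) (M : Memory) : Prop where
  n_eq : M.nat 0 0 = P.n
  group_eq : ∀ s : Fin P.n, M.nat 1 s = P.group s
  query_eq : ∀ c : Fin d, M.real 0 c = q c
  prob_eq : ∀ s : Fin P.n, M.real 1 s = P.prob s
  site_eq : ∀ (c : Fin d) (s : Fin P.n), M.real (2 + c) s = P.site s c

theorem holdsInput_inputMemory (P : MultipointSet d) (q : Fin d → ℝ) :
    HoldsInput P q (inputMemory P q) := by
  constructor <;> intros <;> simp [inputMemory]
  omega

theorem HoldsInput.congr {P : MultipointSet d} {q : Fin d → ℝ} {M M' : Memory}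
    (h : HoldsInput P q M) (h0 : M'.nat 0 = M.nat 0) (h1 : M'.nat 1 = M.nat 1)
    (hr : ∀ a < d + 2, M'.real a = M.real a) : HoldsInput P q M' := by
  constructor
  · rw [h0, h.n_eq]
  · intro s; rw [h1, h.group_eq]
  · intro c; rw [hr _ (by omega), h.query_eq]
  · intro s; rw [hr _ (by omega), h.prob_eq]
  · intro c s; rw [hr _ (by omega), h.site_eq]

theorem HoldsInput.storeNat {P : MultipointSet d} {q : Fin d → ℝ} {M : Memory}
    (h : HoldsInput P q M) {a : ℕ} (ha : 2 ≤ a) (i v : ℕ) : HoldsInput P q (M.storeNat a i v) := by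
  refine h.congr ?_ ?_ fun _ _ => rfl <;> rw [Memory.storeNat_nat, if_neg (by omega)]

theorem HoldsInput.frame {P : MultipointSet d} {q : Fin d → ℝ} {M M' : Memory} {p : Program}
    (h : HoldsInput P q M) (hf : Frame p M M') (h0 : ¬ p.WritesNat 0) (h1 : ¬ p.WritesNat 1)
    (hr : ∀ a < d + 2, ¬ p.WritesReal a) : HoldsInput P q M' :=
  h.congr (hf.1 0 h0) (hf.1 1 h1) fun a ha => hf.2 a (hr a ha)

/-- Adds the probabilities of the sites that satisfy `F` to the cells of their groups. -/
def addForbidden (d : ℕ) (F : Test) : Program :=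
  forSites 2 (.ite F (.setReal (d + 2) (.get 1 (.reg 2))
    (.add (.get (d + 2) (.get 1 (.reg 2))) (.get 1 (.reg 2)))) .skip)

/-- Multiplies the probabilities of the sites of the tuple and clears the cells of their groups. -/
def takeTuple (d : ℕ) : ℕ → Program
  | 0 => .skip
  | j + 1 => .seq (takeTuple d j)
      (.seq (.setReal (d + 3) (.lit 0) (.mul (.reg (d + 3)) (.get 1 (.reg (3 + j)))))
        (.setReal (d + 2) (.get 1 (.reg (3 + j))) (.lit 0)))

/-- Multiplies the product by the factors of all groups, and clears their cells. -/
def mulFactors (d : ℕ) : Program :=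
  forSites 2 (.seq (.setReal (d + 3) (.lit 0)
    (.mul (.reg (d + 3)) (.sub (.lit 1) (.get (d + 2) (.get 1 (.reg 2))))))
    (.setReal (d + 2) (.get 1 (.reg 2)) (.lit 0)))

/-- Adds `z` times the probability that the sites of the tuple are occupied, and no site that
satisfies `F`, to the result. -/
def addTupleProb (d j : ℕ) (z : ℤ) (F : Test) : Program :=
  .seq (addForbidden d F) (.seq (.setReal (d + 3) (.lit 0) (.lit 1)) (.seq (takeTuple d j)
    (.seq (mulFactors d) (.setReal (d + 4) (.lit 0)
      (.add (.reg (d + 4)) (.mul (.lit z) (.reg (d + 3))))))))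

theorem takeTuple_loopFree (d j : ℕ) : (takeTuple d j).LoopFree := by
  induction j with
  | zero => trivial
  | succ j ih => exact ⟨ih, trivial, trivial⟩

@[simp] theorem takeTuple_writesNat (d j a : ℕ) : ¬ (takeTuple d j).WritesNat a := by
  induction j with
  | zero => simp [takeTuple, Program.WritesNat]
  | succ j ih => simp [takeTuple, Program.WritesNat, ih]

theorem takeTuple_writesReal {d j a : ℕ} (h : (takeTuple d j).WritesReal a) :
    a = d + 2 ∨ a = d + 3 := by
  induction j with
  | zero => simp [takeTuple, Program.WritesReal] at h
  | succ j ih => simp only [takeTuple, Program.WritesReal] at h; tauto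

theorem addTupleProb_writesNat {d j : ℕ} {z : ℤ} {F : Test} {a : ℕ}
    (h : (addTupleProb d j z F).WritesNat a) : a = 2 := by
  simpa [addTupleProb, addForbidden, mulFactors, Program.WritesNat] using h

/-- These arrays lie just above the input: `d + 2` collects forbidden probabilities by group, `d +
3` holds the running product, `d + 4` the result. -/
theorem addTupleProb_writesReal {d j : ℕ} {z : ℤ} {F : Test} {a : ℕ}
    (h : (addTupleProb d j z F).WritesReal a) : a = d + 2 ∨ a = d + 3 ∨ a = d + 4 := by
  simp only [addTupleProb, addForbidden, mulFactors, Program.WritesReal, forSites_writesReal] at h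
  rcases h with h | h | h | h | h
  · tauto
  · tauto
  · have := takeTuple_writesReal h; tauto
  · tauto
  · tauto

theorem sum_filter_lt_succ {n : ℕ} (p : Fin n → Prop) [DecidablePred p] (f : Fin n → ℝ) {k : ℕ}
    (hk : k < n) : ∑ s : Fin n with s.val < k + 1 ∧ p s, f s =
      (∑ s : Fin n with s.val < k ∧ p s, f s) + if p ⟨k, hk⟩ then f ⟨k, hk⟩ else 0 := by
  have h : (Finset.univ.filter fun s : Fin n => s.val < k + 1 ∧ p s) =
      (Finset.univ.filter fun s : Fin n => s.val < k ∧ p s) ∪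
        (Finset.univ.filter fun s => s = ⟨k, hk⟩ ∧ p s) := by
    ext s
    simp only [Finset.mem_filter, Finset.mem_univ, true_and, Finset.mem_union, Fin.ext_iff]
    constructor
    · rintro ⟨h₁, h₂⟩
      rcases Nat.lt_succ_iff_lt_or_eq.1 h₁ with h | h <;> tauto
    · rintro (h | h) <;> refine ⟨by omega, h.2⟩
  rw [h, Finset.sum_union]
  · congr 1
    rw [Finset.sum_filter]
    simp only [ite_and]
    rw [Finset.sum_ite_eq']
    simp
  · rw [Finset.disjoint_left]
    intro s
    simp only [Finset.mem_filter, Finset.mem_univ, true_and, Fin.ext_iff]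
    omega

/-- The memory holds the input and the tuple `t`. -/
def HoldsTuple (P : MultipointSet d) (q : Fin d → ℝ) {j : ℕ} (t : Fin j → Fin P.n)
    (M : Memory) : Prop :=
  HoldsInput P q M ∧ ∀ l : Fin j, M.nat (3 + l) 0 = t l

theorem HoldsTuple.frame {P : MultipointSet d} {q : Fin d → ℝ} {j : ℕ} {t : Fin j → Fin P.n}
    {M M' : Memory} {p : Program} (h : HoldsTuple P q t M) (hf : Frame p M M')
    (hn : ∀ a, p.WritesNat a → a = 2) (hr : ∀ a < d + 2, ¬ p.WritesReal a) :
    HoldsTuple P q t M' :=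
  ⟨h.1.frame hf (fun h => by simpa using hn _ h) (fun h => by simpa using hn _ h) hr,
    fun l => by rw [hf.1 _ fun h => by have := hn _ h; omega, h.2]⟩

open Classical in
theorem ends_addForbidden {P : MultipointSet d} {q : Fin d → ℝ} {j : ℕ} {t : Fin j → Fin P.n}
    {F : Test} {p : Fin P.n → Prop} {M : Memory} (hM : HoldsTuple P q t M)
    (hF : ∀ (s : Fin P.n) M, HoldsTuple P q t M → M.nat 2 0 = s → (F.Holds M ↔ p s))
    (h0 : ∀ i, M.real (d + 2) i = 0) :
    Ends (addForbidden d F) M (P.n * (F.cost + 26) + 9) fun M' =>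
      ∀ i, M'.real (d + 2) i = ∑ s with p s ∧ (P.group s : ℕ) = i, P.prob s := by
  refine (Ends.forSites (n := P.n) (c := F.cost + 14) (I := fun k M' => ∀ i, M'.real (d + 2) i =
    ∑ s : Fin P.n with s.val < k ∧ p s ∧ (P.group s : ℕ) = i, P.prob s) (by simp)
    (by simp [Program.WritesNat]) (by simp [Program.WritesNat]) hM.1.n_eq
    (fun k M v h => h) (by simp [h0]) ?_).mono le_rfl ?_
  · intro k hk M' hf hx hI
    have hT : HoldsTuple P q t M' := hM.frame hf (by simp [Program.WritesNat])
      (by simp [Program.WritesReal]; omega)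
    have hp := hF ⟨k, hk⟩ M' hT hx
    refine (Ends.of_loopFree (by simp [Program.LoopFree]) ?_).mono (t := _)
      (by simp [Program.cost, NatExpr.cost, RealExpr.cost]) (fun _ _ h => h)
    intro i
    rw [sum_filter_lt_succ _ _ hk]
    simp only [Program.exec]
    split_ifs with h1 h2 h3
    · have hi : M'.nat 1 k = i := by rw [← h2.2]; exact hT.1.group_eq ⟨k, hk⟩
      have hpr : M'.real 1 k = P.prob ⟨k, hk⟩ := hT.1.prob_eq ⟨k, hk⟩
      simp [Memory.storeReal_real, NatExpr.eval, RealExpr.eval, hx, hi, hI, hpr]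
    · have hi : i ≠ M'.nat 1 k := by
        rintro rfl
        exact h2 ⟨hp.1 h1, (hT.1.group_eq ⟨k, hk⟩).symm⟩
      simp [Memory.storeReal_real, NatExpr.eval, RealExpr.eval, hx, hI,
        Function.update_of_ne hi]
    · exact (h1 (hp.2 h3.1)).elim
    · rw [hI, add_zero]
  · intro M' _ h i
    rw [h]
    simp

open Classical in
-- A group that contains a site of the tuple must contribute the factor `1`, whatever is forbidden
-- in it. Factors are one minus a cell, so clearing the cell achieves this.
theorem exec_takeTuple {P : MultipointSet d} {q : Fin d → ℝ} {j : ℕ} {t : Fin j → Fin P.n}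
    {M : Memory} (hM : HoldsTuple P q t M) :
    ((takeTuple d j).exec M).real (d + 3) 0 = M.real (d + 3) 0 * ∏ l, P.prob (t l) ∧
      ∀ i, ((takeTuple d j).exec M).real (d + 2) i =
        if ∃ l, (P.group (t l) : ℕ) = i then 0 else M.real (d + 2) i := by
  induction j with
  | zero => simp [takeTuple, Program.exec]
  | succ j ih =>
    have hj : HoldsTuple P q (fun l : Fin j => t l.castSucc) M := ⟨hM.1, fun l => hM.2 l.castSucc⟩
    obtain ⟨h₁, h₂⟩ := ih hj
    obtain ⟨u, M', hr, -, rfl⟩ := Ends.of_loopFree (Q := (· = (takeTuple d j).exec M))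
      (takeTuple_loopFree d j) rfl
    have hf := hr.frame
    have hT := hM.frame hf (by simp) (fun a ha h => by
      have := takeTuple_writesReal h; omega)
    have hl : ((takeTuple d j).exec M).nat (3 + j) 0 = t (Fin.last j) := hT.2 (Fin.last j)
    constructor
    · simp [takeTuple, Program.exec, Memory.storeReal_real, NatExpr.eval, RealExpr.eval, hl, h₁,
        hT.1.prob_eq, Fin.prod_univ_castSucc, mul_assoc]
    · intro i
      have hg := hT.1.group_eq (t (Fin.last j))
      by_cases hi : (P.group (t (Fin.last j)) : ℕ) = i
      · rw [if_pos ⟨_, hi⟩]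
        simp [takeTuple, Program.exec, Memory.storeReal_real, NatExpr.eval, RealExpr.eval, hl, hg,
          hi]
      · have : (∃ l, (P.group (t l) : ℕ) = i) ↔ ∃ l : Fin j, (P.group (t l.castSucc) : ℕ) = i := by
          rw [Fin.exists_fin_succ']
          simp [hi]
        simp only [this, ← h₂]
        simp [takeTuple, Program.exec, Memory.storeReal_real, NatExpr.eval, RealExpr.eval, hl, hg,
          Function.update_of_ne (Ne.symm hi)]

/-- The number of uncertain points is not part of the input, so the product over the groups is taken
in a loop over the sites. Groups without sites have clear cells and hence the factor `1`, so nothing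
is missed. -/
theorem ends_mulFactors {P : MultipointSet d} {q : Fin d → ℝ} {M : Memory}
    (hM : HoldsInput P q M) (h0 : ∀ i, (∀ s, (P.group s : ℕ) ≠ i) → M.real (d + 2) i = 0) :
    Ends (mulFactors d) M (P.n * 28 + 9) fun M' =>
      M'.real (d + 3) 0 = M.real (d + 3) 0 * ∏ i : Fin P.m, (1 - M.real (d + 2) i) ∧
        ∀ i, M'.real (d + 2) i = 0 := by
  classical
  -- The groups met among the first `k` sites. A group that is met again has a clear cell and
  -- contributes `1`.
  let G : ℕ → Finset ℕ := fun k =>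
    (Finset.univ.filter fun s : Fin P.n => s.val < k).image fun s => (P.group s : ℕ)
  have hG : ∀ k (hk : k < P.n), G (k + 1) = insert (P.group ⟨k, hk⟩ : ℕ) (G k) := by
    intro k hk
    ext i
    simp only [G, Finset.mem_image, Finset.mem_filter, Finset.mem_univ, true_and,
      Finset.mem_insert]
    constructor
    · rintro ⟨s, hs, rfl⟩
      rcases Nat.lt_succ_iff_lt_or_eq.1 hs with h | h
      · exact .inr ⟨s, h, rfl⟩
      · left; congr 2; exact Fin.ext h
    · rintro (rfl | ⟨s, hs, rfl⟩)
      · exact ⟨_, Nat.lt_succ_self k, rfl⟩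
      · exact ⟨s, by omega, rfl⟩
  refine (Ends.forSites (n := P.n) (c := 16) (I := fun k M' =>
    M'.real (d + 3) 0 = M.real (d + 3) 0 * ∏ i ∈ G k, (1 - M.real (d + 2) i) ∧
      ∀ i, M'.real (d + 2) i = if i ∈ G k then 0 else M.real (d + 2) i) (by simp)
    (by simp [Program.WritesNat]) (by simp [Program.WritesNat]) hM.n_eq
    (fun k M v h => h) (by simp [G]) ?_).mono le_rfl ?_
  · rintro k hk M' hf hx ⟨hI₁, hI₂⟩
    have hT : HoldsInput P q M' := hM.frame hf (by simp [Program.WritesNat])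
      (by simp [Program.WritesNat]) (by simp [Program.WritesReal]; omega)
    have hg : M'.nat 1 k = P.group ⟨k, hk⟩ := hT.group_eq ⟨k, hk⟩
    refine (Ends.of_loopFree (by simp [Program.LoopFree]) ?_).mono (t := _)
      (by simp [Program.cost, NatExpr.cost, RealExpr.cost]) (fun _ _ h => h)
    rw [hG k hk]
    constructor
    · simp only [Program.exec, Memory.storeReal_real, NatExpr.eval, RealExpr.eval, hx, hg,
        Memory.storeReal_nat, hI₁, hI₂]
      by_cases hi : (P.group ⟨k, hk⟩ : ℕ) ∈ G k
      · simp [hi]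
      · simp [hi, Finset.prod_insert hi]; ring
    · intro i
      simp only [Program.exec, Memory.storeReal_real, NatExpr.eval, RealExpr.eval, hx, hg,
        Memory.storeReal_nat, Finset.mem_insert]
      by_cases hi : i = P.group ⟨k, hk⟩
      · simp [hi]
      · simp [hI₂, hi]
  · rintro M' _ ⟨h₁, h₂⟩
    have hGn : ∀ i, i ∈ G P.n ↔ ∃ s, (P.group s : ℕ) = i := by
      intro i; simp [G]
    constructor
    · rw [h₁]
      congr 1
      rw [← Finset.prod_image (s := Finset.univ) (g := fun i : Fin P.m => (i : ℕ))
        (f := fun i => 1 - M.real (d + 2) i) (fun a _ b _ h => Fin.ext h)]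
      refine Finset.prod_subset (fun i hi => ?_) fun i _ hi => ?_
      · obtain ⟨s, rfl⟩ := (hGn i).1 hi
        simp
      · rw [h0 i fun s hs => hi ((hGn i).2 ⟨s, hs⟩), sub_zero]
    · intro i
      rw [h₂]
      split_ifs with hi
      · rfl
      · exact h0 i fun s hs => hi ((hGn i).2 ⟨s, hs⟩)

theorem ends_addTupleProb {P : MultipointSet d} {q : Fin d → ℝ} {j : ℕ} {t : Fin j → Fin P.n}
    {F : Test} {p : Fin P.n → Prop} {M : Memory} (z : ℤ) (hM : HoldsTuple P q t M)
    (hF : ∀ (s : Fin P.n) M, HoldsTuple P q t M → M.nat 2 0 = s → (F.Holds M ↔ p s))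
    (h0 : ∀ i, M.real (d + 2) i = 0) :
    Ends (addTupleProb d j z F) M
      ((P.n + 1) * (F.cost + (takeTuple d j).cost + 60)) fun M' =>
      (∀ i, M'.real (d + 2) i = 0) ∧
        M'.real (d + 4) 0 = M.real (d + 4) 0 + z * P.tupleProb t p := by
  classical
  refine (Ends.seq (ends_addForbidden hM hF h0) (u := 3 + ((takeTuple d j).cost +
    ((P.n * 28 + 9) + 9))) ?_).mono (by ring_nf; omega) (fun _ _ h => h)
  intro M₁ hf₁ hA₁
  have hT₁ : HoldsTuple P q t M₁ := hM.frame hf₁ (by simp [addForbidden, Program.WritesNat])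
    (by simp [addForbidden, Program.WritesReal]; omega)
  have h4₁ : M₁.real (d + 4) = M.real (d + 4) :=
    hf₁.2 _ (by simp [addForbidden, Program.WritesReal])
  refine (Ends.of_loopFree (p := .setReal (d + 3) (.lit 0) (.lit 1))
    (Q := (· = M₁.storeReal (d + 3) 0 1)) trivial (by simp [Program.exec, NatExpr.eval, RealExpr.eval])).seq
    fun M₂ hf₂ hM₂ => ?_
  have hT₂ : HoldsTuple P q t M₂ := hT₁.frame hf₂ (by simp [Program.WritesNat])
    (by simp [Program.WritesReal]; omega)
  have h4₂ : M₂.real (d + 4) = M.real (d + 4) := by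
    rw [hM₂, ← h4₁]; simp [Memory.storeReal_real]
  have h3₂ : M₂.real (d + 3) 0 = 1 := by
    rw [hM₂]; simp [Memory.storeReal_real]
  have h2₂ : M₂.real (d + 2) = M₁.real (d + 2) := by
    rw [hM₂]; simp [Memory.storeReal_real]
  refine (Ends.of_loopFree (Q := fun M₃ => M₃.real (d + 3) 0 = M₂.real (d + 3) 0 * ∏ l, P.prob (t l) ∧
    ∀ i, M₃.real (d + 2) i = if ∃ l, (P.group (t l) : ℕ) = i then 0 else M₂.real (d + 2) i)
    (takeTuple_loopFree d j) (exec_takeTuple hT₂)).seq ?_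
  rintro M₃ hf₃ ⟨h3₃, h2₃⟩
  have hT₃ : HoldsTuple P q t M₃ := hT₂.frame hf₃ (by simp) (fun a ha h => by
    have := takeTuple_writesReal h; omega)
  have h4₃ : M₃.real (d + 4) = M.real (d + 4) := by
    rw [← h4₂]; exact hf₃.2 _ (fun h => by have := takeTuple_writesReal h; omega)
  refine (ends_mulFactors hT₃.1 ?_).seq ?_
  · intro i hi
    rw [h2₃, h2₂, hA₁]
    split_ifs
    · rfl
    · refine Finset.sum_eq_zero fun s hs => ?_
      simp only [Finset.mem_filter] at hs
      exact (hi s hs.2.2).elim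
  · rintro M₄ hf₄ ⟨h3₄, h2₄⟩
    have h4₄ : M₄.real (d + 4) = M.real (d + 4) := by
      rw [← h4₃]; exact hf₄.2 _ (by simp [mulFactors, Program.WritesReal])
    refine (Ends.of_loopFree (p := .setReal _ _ _) trivial ?_).mono (t := _)
      (by simp [Program.cost, NatExpr.cost, RealExpr.cost]) (fun _ _ h => h)
    constructor
    · simpa [Program.exec, Memory.storeReal_real] using h2₄
    · simp only [Program.exec, Memory.storeReal_real, NatExpr.eval, RealExpr.eval, if_true,
        Function.update_self, h4₄, h3₄, h3₃, h3₂, h2₃, h2₂, hA₁, one_mul,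
        MultipointSet.tupleProb]
      congr 3
      refine Finset.prod_congr rfl fun i _ => ?_
      simp only [Fin.val_inj]
      split_ifs <;> simp

/-- Executes `p` for all tuples of `j` sites. -/
def forTuples : ℕ → Program → Program
  | 0, p => p
  | j + 1, p => forSites (3 + j) (forTuples j p)

theorem forTuples_writesNat {j : ℕ} {p : Program} {a : ℕ} :
    (forTuples j p).WritesNat a ↔ (3 ≤ a ∧ a < 3 + j) ∨ p.WritesNat a := by
  induction j with
  | zero => simp [forTuples]
  | succ j ih =>
    rw [forTuples, forSites_writesNat, ih]
    constructor
    · rintro (rfl | h | h) <;> first | tauto | (left; omega)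
    · rintro (h | h)
      · by_cases h' : a = 3 + j
        · tauto
        · right; left; omega
      · tauto

/-- Induction on the number of nested loops with `Pre` generalised: inside the outermost loop it is
strengthened by the value of that loop's register, so that the body finally knows the whole tuple.
-/
theorem ends_forTuples {n c j : ℕ} {p : Program} (hc : 12 ≤ c) (hp : ∀ a, p.WritesNat a → a = 2)
    (r : ℕ) (Pre : Memory → Prop) (hn : ∀ M, Pre M → M.nat 0 0 = n)
    (hPre : ∀ M l v, l < j → Pre M → Pre (M.storeNat (3 + l) 0 v)) (f : (Fin j → Fin n) → ℝ)
    (h : ∀ (t : Fin j → Fin n) M, Pre M → (∀ l : Fin j, M.nat (3 + l) 0 = t l) →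
      Ends p M c fun M' => Pre M' ∧ M'.real r 0 = M.real r 0 + f t)
    {M : Memory} (hM : Pre M) :
    Ends (forTuples j p) M ((n + 1) ^ j * (2 ^ j * c)) fun M' =>
      Pre M' ∧ M'.real r 0 = M.real r 0 + ∑ t, f t := by
  induction j generalizing Pre M with
  | zero =>
    refine (h Fin.elim0 M hM fun l => l.elim0).mono (by simp) fun M' _ hM' => ⟨hM'.1, ?_⟩
    rw [hM'.2, Fintype.sum_unique]
    congr 2
  | succ j ih =>
    have hw : ∀ a, (forTuples j p).WritesNat a → 2 ≤ a ∧ a < 3 + j := by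
      intro a ha
      rcases forTuples_writesNat.1 ha with h | h
      · omega
      · rw [hp a h]; omega
    -- The conjunct `True` in the invariant gives the sum the shape of `sum_filter_lt_succ`.
    refine (Ends.forSites (c := (n + 1) ^ j * (2 ^ j * c)) (I := fun k M' => Pre M' ∧
      M'.real r 0 = M.real r 0 + ∑ s : Fin n with s.val < k ∧ True,
        ∑ t : Fin j → Fin n, f (Fin.snoc t s)) (by omega) (fun h => by have := hw _ h; omega)
      (fun h => by have := hw _ h; omega) (hn M hM)
      (fun k M' v hI => ⟨hPre _ _ _ (Nat.lt_succ_self j) hI.1, hI.2⟩) ⟨hM, by simp⟩ ?_).mono ?_ ?_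
    · rintro k hk M' hf hx ⟨hP, hI⟩
      refine (ih (fun M'' => Pre M'' ∧ M''.nat (3 + j) 0 = k) (fun M'' h => hn _ h.1) ?_
        (fun t => f (Fin.snoc t ⟨k, hk⟩)) ?_ ⟨hP, hx⟩).imp ?_
      · rintro M'' l v hl ⟨h₁, h₂⟩
        refine ⟨hPre _ _ _ (by omega) h₁, ?_⟩
        rw [Memory.storeNat_nat, if_neg (by omega), h₂]
      · rintro t M'' ⟨h₁, h₂⟩ hl
        refine (h (Fin.snoc t ⟨k, hk⟩) M'' h₁ fun l => ?_).imp fun M₃ hf₃ hM₃ =>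
          ⟨⟨hM₃.1, ?_⟩, hM₃.2⟩
        · refine Fin.lastCases ?_ (fun l => ?_) l
          · simp [h₂]
          · simp [hl]
        · rw [hf₃.1 _ fun h => by have := hp _ h; omega, h₂]
      · rintro M'' - ⟨⟨h₁, -⟩, h₂⟩
        refine ⟨h₁, ?_⟩
        rw [h₂, hI, sum_filter_lt_succ _ _ hk, if_pos trivial, add_assoc]
    -- Since the body is allowed at least 12 steps, the overhead `12 * n + 9` of a loop at most
    -- doubles the bound; this is the factor `2` per level.
    · have h1 : 1 ≤ (n + 1) ^ j * 2 ^ j := Nat.one_le_iff_ne_zero.2 (by positivity)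
      have : 12 ≤ (n + 1) ^ j * (2 ^ j * c) := by nlinarith
      rw [pow_succ, pow_succ]
      nlinarith
    · rintro M' - ⟨h₁, h₂⟩
      refine ⟨h₁, ?_⟩
      -- The outermost register is the last entry of the tuple.
      rw [h₂, ← (Fin.snocEquiv fun _ : Fin (j + 1) => Fin n).sum_comp, Fintype.sum_prod_type]
      simp [Fin.snocEquiv]

end RealRAM

/-! ### The point of least norm in a polyhedron -/

section LeastNorm

open scoped RealInnerProductSpace

variable {ι E : Type*} [NormedAddCommGroup E] [InnerProductSpace ℝ E]

/-- The Gram matrix of independent vectors is invertible, so a suitable combination of these vectors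
solves the system. -/
theorem exists_inner_eq {S : Finset ι} {a : ι → E} (h : LinearIndepOn ℝ a (S : Set ι)) (g : ι → ℝ) :
    ∃ u : E, ∀ b ∈ S, ⟪u, a b⟫ = g b := by
  classical
  let G := Matrix.gram ℝ fun b : (S : Set ι) => a b
  have hG : G.det ≠ 0 := Matrix.det_gram_ne_zero_iff_linearIndependent.2 h
  let x := G⁻¹.mulVec fun b => g b
  have hx : G.mulVec x = fun b : (S : Set ι) => g b := by
    rw [Matrix.mulVec_mulVec, Matrix.mul_nonsing_inv _ (isUnit_iff_ne_zero.2 hG), Matrix.one_mulVec]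
  refine ⟨∑ b, x b • a b, fun b hb => ?_⟩
  have := congrFun hx ⟨b, hb⟩
  simp only [Matrix.mulVec, dotProduct, G, Matrix.gram_apply] at this
  rw [← this, sum_inner]
  refine Finset.sum_congr rfl fun b' _ => ?_
  rw [real_inner_smul_left, real_inner_comm, mul_comm]

/-- Finitely many strict inequalities survive a small perturbation. All tilting arguments below rest
on this. -/
theorem exists_pos_forall_pos {B : Finset ι} {f g : ι → ℝ} (hf : ∀ b ∈ B, 0 < f b) :
    ∃ δ : ℝ, 0 < δ ∧ ∀ b ∈ B, 0 < f b + δ * g b := by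
  have h : ∀ᶠ δ in nhdsWithin (0 : ℝ) (Set.Ioi 0), ∀ b ∈ B, 0 < f b + δ * g b := by
    rw [Filter.eventually_all_finset]
    intro b hb
    have : Filter.Tendsto (fun δ : ℝ => f b + δ * g b) (nhds 0) (nhds (f b + 0 * g b)) :=
      Continuous.tendsto (by fun_prop) 0
    rw [zero_mul, add_zero] at this
    exact (this.mono_left nhdsWithin_le_nhds).eventually_const_lt (hf b hb)
  obtain ⟨δ, hδ, h0⟩ := (h.and self_mem_nhdsWithin).exists
  exact ⟨δ, h0, hδ⟩

/-- The optimality conditions for the least norm of a point `h` with `0 ≤ ⟪h, a b⟫ + c b` for all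
`b ∈ B`, where `I` is the set of the constraints with non-zero multipliers. -/
structure LeastNorm (a : ι → E) (c : ι → ℝ) (B I : Finset ι) (m : ι → ℝ) (h : E) : Prop where
  subset : I ⊆ B
  pos : ∀ b ∈ I, 0 < m b
  eq : h = ∑ b ∈ I, m b • a b
  tight : ∀ b ∈ I, ⟪h, a b⟫ + c b = 0
  feasible : ∀ b ∈ B, 0 ≤ ⟪h, a b⟫ + c b

variable {a : ι → E} {c : ι → ℝ} {B : Finset ι}

/-- The variational inequality of the least norm: as the constraints in `I` are tight at `h`, the
inner product is the sum of the slacks of `h'` weighted with positive multipliers. -/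
theorem LeastNorm.inner_nonneg {I : Finset ι} {m : ι → ℝ} {h h' : E}
    (H : LeastNorm a c B I m h) (hh' : ∀ b ∈ B, 0 ≤ ⟪h', a b⟫ + c b) : 0 ≤ ⟪h, h' - h⟫ := by
  have : ⟪h, h' - h⟫ = ⟪∑ b ∈ I, m b • a b, h' - h⟫ := by rw [← H.eq]
  rw [this, sum_inner]
  refine Finset.sum_nonneg fun b hb => ?_
  rw [real_inner_smul_left, inner_sub_right, real_inner_comm, real_inner_comm h]
  have h₁ := H.tight b hb
  have h₂ := hh' b (H.subset hb)
  exact mul_nonneg (H.pos b hb).le (by linarith)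

/-- Adding the two variational inequalities gives `h = h'`. All constraints of `I ∪ I'` are then
tight at one point, hence independent by `hB`, so the two representations of `h` have the same
coefficients and thus the same support. -/
theorem LeastNorm.unique (hB : ∀ h : E, ∀ S ⊆ B, (∀ b ∈ S, ⟪h, a b⟫ + c b = 0) →
      LinearIndepOn ℝ a (S : Set ι)) {I I' : Finset ι} {m m' : ι → ℝ} {h h' : E}
    (H : LeastNorm a c B I m h) (H' : LeastNorm a c B I' m' h') : I = I' := by
  classical
  have h₁ := H.inner_nonneg H'.feasible
  have h₂ := H'.inner_nonneg H.feasible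
  have h₃ : h = h' := by
    have : ⟪h' - h, h' - h⟫ ≤ 0 := by
      rw [inner_sub_left]
      have : ⟪h', h' - h⟫ = - ⟪h', h - h'⟫ := by rw [← inner_neg_right, neg_sub]
      linarith
    exact (sub_eq_zero.1 (real_inner_self_nonpos.1 this)).symm
  subst h₃
  have hli := hB h (I ∪ I') (Finset.union_subset H.subset H'.subset) (by
    intro b hb
    rcases Finset.mem_union.1 hb with hb | hb
    · exact H.tight b hb
    · exact H'.tight b hb)
  rw [linearIndepOn_finset_iff] at hli
  have key := hli (fun b => (if b ∈ I then m b else 0) - if b ∈ I' then m' b else 0) (by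
    simp only [sub_smul, Finset.sum_sub_distrib, ite_smul, zero_smul]
    rw [← Finset.sum_filter, ← Finset.sum_filter, Finset.filter_mem_eq_inter,
      Finset.filter_mem_eq_inter, Finset.union_inter_cancel_left, Finset.union_inter_cancel_right,
      ← H.eq, ← H'.eq, sub_self])
  ext b
  constructor
  · intro hb
    by_contra hb'
    have := key b (Finset.mem_union_left _ hb)
    rw [if_pos hb, if_neg hb'] at this
    have := H.pos b hb
    linarith
  · intro hb
    by_contra hb'
    have := key b (Finset.mem_union_right _ hb)
    rw [if_pos hb, if_neg hb'] at this
    have := H'.pos b hb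
    linarith

/-- The nearest point to the origin exists because the polyhedron is closed and convex. Independence
of the active constraints makes the multipliers available by linear algebra, without Farkas' lemma.
-/
theorem exists_leastNorm [FiniteDimensional ℝ E] (hB : ∀ h : E, ∀ S ⊆ B, (∀ b ∈ S, ⟪h, a b⟫ + c b = 0) →
      LinearIndepOn ℝ a (S : Set ι)) (hne : ∃ h : E, ∀ b ∈ B, 0 ≤ ⟪h, a b⟫ + c b) :
    ∃ I m h, LeastNorm a c B I m h := by
  classical
  let K : Set E := {h | ∀ b ∈ B, 0 ≤ ⟪h, a b⟫ + c b}
  have hKeq : K = ⋂ b ∈ B, {h | 0 ≤ ⟪h, a b⟫ + c b} := by ext; simp [K]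
  have hclosed : IsClosed K := by
    rw [hKeq]
    exact isClosed_biInter fun b _ => isClosed_le continuous_const (by fun_prop)
  have hconv : Convex ℝ K := by
    intro x hx y hy r s hr hs hrs b hb
    rw [inner_add_left, real_inner_smul_left, real_inner_smul_left]
    have h₁ := mul_nonneg hr (hx b hb)
    have h₂ := mul_nonneg hs (hy b hb)
    have : c b = r * c b + s * c b := by rw [← add_mul, hrs, one_mul]
    linarith
  have := FiniteDimensional.complete ℝ E
  obtain ⟨h, hK, hmin⟩ := exists_norm_eq_iInf_of_complete_convex (K := K) hne hclosed.isComplete hconv 0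
  rw [norm_eq_iInf_iff_real_inner_le_zero hconv hK] at hmin
  let S := B.filter fun b => ⟪h, a b⟫ + c b = 0
  have hS : ∀ b, b ∈ S ↔ b ∈ B ∧ ⟪h, a b⟫ + c b = 0 := by simp [S]
  have hli := hB h S (Finset.filter_subset _ _) fun b hb => ((hS b).1 hb).2
  -- A direction that respects the active constraints stays feasible for a short while, so the norm
  -- cannot decrease to first order.
  have hdir : ∀ u : E, (∀ b ∈ S, 0 ≤ ⟪u, a b⟫) → 0 ≤ ⟪h, u⟫ := by
    intro u hu
    obtain ⟨δ, hδ, hpos⟩ := exists_pos_forall_pos (B := B \ S)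
      (f := fun b => ⟪h, a b⟫ + c b) (g := fun b => ⟪u, a b⟫) (by
        intro b hb
        rw [Finset.mem_sdiff, hS] at hb
        exact lt_of_le_of_ne (hK b hb.1) fun h0 => hb.2 ⟨hb.1, h0.symm⟩)
    have := hmin (h + δ • u) (by
      intro b hb
      rw [inner_add_left, real_inner_smul_left]
      by_cases hbS : b ∈ S
      · have h₁ := ((hS b).1 hbS).2
        have h₂ := mul_nonneg hδ.le (hu b hbS)
        linarith
      · have := hpos b (Finset.mem_sdiff.2 ⟨hb, hbS⟩)
        linarith)
    rw [zero_sub, add_sub_cancel_left, inner_neg_left, inner_smul_right] at this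
    exact nonneg_of_mul_nonneg_right (by linarith) hδ
  -- Moving against the component of `h` orthogonal to the active vectors is such a direction, so
  -- this component is zero.
  have hspan : h ∈ Submodule.span ℝ (a '' (S : Set ι)) := by
    let W := Submodule.span ℝ (a '' (S : Set ι))
    have horth : ∀ w ∈ W, ⟪w, h - W.starProjection h⟫ = 0 := fun w hw =>
      Submodule.inner_right_of_mem_orthogonal hw (Submodule.sub_starProjection_mem_orthogonal h)
    have h₁ := hdir (-(h - W.starProjection h)) (fun b hb => by
      rw [inner_neg_left, real_inner_comm,
        horth _ (Submodule.subset_span (Set.mem_image_of_mem _ hb)), neg_zero])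
    have h₂ := horth _ (Submodule.starProjection_apply_mem W h)
    have h₃ : ⟪h - W.starProjection h, h - W.starProjection h⟫ ≤ 0 := by
      rw [inner_neg_right] at h₁
      rw [inner_sub_left]
      linarith
    have h₄ := sub_eq_zero.1 (real_inner_self_nonpos.1 h₃)
    change h ∈ W
    rw [h₄]
    exact Submodule.starProjection_apply_mem W h
  obtain ⟨m, hm⟩ := (Submodule.mem_span_image_finset_iff_exists_fun' ℝ).1 hspan
  have hnonneg : ∀ b ∈ S, 0 ≤ m b := by
    intro b hb
    -- The dual vector of `a b` is an admissible direction and singles out `m b`.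
    obtain ⟨u, hu⟩ := exists_inner_eq hli fun b' => if b' = b then 1 else 0
    have := hdir u fun b' hb' => by rw [hu b' hb']; split_ifs <;> norm_num
    rw [← hm, sum_inner, Finset.sum_congr rfl (g := fun b' => if b' = b then m b' else 0)] at this
    · simpa [hb] using this
    · intro b' hb'
      rw [real_inner_smul_left, real_inner_comm, hu b' hb']
      simp
  refine ⟨S.filter fun b => m b ≠ 0, m, h, ⟨?_, ?_, ?_, ?_, hK⟩⟩
  · exact (Finset.filter_subset _ _).trans (Finset.filter_subset _ _)
  · intro b hb
    rw [Finset.mem_filter] at hb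
    exact lt_of_le_of_ne (hnonneg b hb.1) hb.2.symm
  · rw [← hm]
    refine (Finset.sum_subset (Finset.filter_subset _ _) fun b hb hb' => ?_).symm
    have : m b = 0 := by
      by_contra h0
      exact hb' (Finset.mem_filter.2 ⟨hb, h0⟩)
    rw [this, zero_smul]
  · intro b hb
    exact ((hS b).1 (Finset.mem_filter.1 hb).1).2

/-- The multipliers of the constraints `t l`, up to a common factor. -/
noncomputable def tupleMultiplier (a : ι → E) (c : ι → ℝ) {j : ℕ} (t : Fin j → ι) : Fin j → ℝ :=
  (Matrix.gram ℝ fun l => a (t l)).cramer fun l => -c (t l)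

/-- The constraints `t l` are independent, and their multipliers are positive. -/
def TupleValid (a : ι → E) (c : ι → ℝ) {j : ℕ} (t : Fin j → ι) : Prop :=
  0 < (Matrix.gram ℝ fun l => a (t l)).det ∧ ∀ l, 0 < tupleMultiplier a c t l

/-- The point at which the constraints `t l` are tight violates the constraint `b`. -/
def TupleViolates (a : ι → E) (c : ι → ℝ) {j : ℕ} (t : Fin j → ι) (b : ι) : Prop :=
  (Matrix.gram ℝ fun l => a (t l)).det * c b + ∑ l, tupleMultiplier a c t l * ⟪a (t l), a b⟫ < 0

/-- Cramer's rule, kept free of divisions by carrying the Gram determinant along. -/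
theorem sum_tupleMultiplier (a : ι → E) (c : ι → ℝ) {j : ℕ} (t : Fin j → ι) (k : Fin j) :
    ∑ l, tupleMultiplier a c t l * ⟪a (t l), a (t k)⟫ =
      (Matrix.gram ℝ fun l => a (t l)).det * -c (t k) := by
  have h := congrFun (Matrix.mulVec_cramer (Matrix.gram ℝ fun l => a (t l)) fun l => -c (t l)) k
  simp only [Matrix.mulVec, dotProduct, Pi.smul_apply, smul_eq_mul] at h
  rw [← h]
  refine Finset.sum_congr rfl fun l _ => ?_
  rw [Matrix.gram_apply, real_inner_comm, mul_comm, tupleMultiplier]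

theorem not_tupleViolates_self (a : ι → E) (c : ι → ℝ) {j : ℕ} (t : Fin j → ι) (k : Fin j) :
    ¬ TupleViolates a c t (t k) := by
  rw [TupleViolates, sum_tupleMultiplier]
  simp

theorem leastNorm_of_tuple [DecidableEq ι] {j : ℕ} {t : Fin j → ι} (ht : Function.Injective t)
    (hv : TupleValid a c t) (hB : ∀ l, t l ∈ B) (hF : ∀ b ∈ B, ¬ TupleViolates a c t b) :
    ∃ m h, LeastNorm a c B (Finset.univ.image t) m h := by
  obtain ⟨hD, hm⟩ := hv
  set D := (Matrix.gram ℝ fun l => a (t l)).det with hDdef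
  let h : E := ∑ l, (tupleMultiplier a c t l / D) • a (t l)
  have hin : ∀ b, ⟪h, a b⟫ = (∑ l, tupleMultiplier a c t l * ⟪a (t l), a b⟫) / D := by
    intro b
    rw [sum_inner, Finset.sum_div]
    refine Finset.sum_congr rfl fun l _ => ?_
    rw [real_inner_smul_left]; ring
  -- Multipliers are indexed by constraints, not by positions; outside the range of `t` the default
  -- `0` is never used.
  refine ⟨Function.extend t (fun l => tupleMultiplier a c t l / D) 0, h, ?_, ?_, ?_, ?_, ?_⟩
  · intro b hb
    obtain ⟨l, -, rfl⟩ := Finset.mem_image.1 hb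
    exact hB l
  · intro b hb
    obtain ⟨l, -, rfl⟩ := Finset.mem_image.1 hb
    rw [ht.extend_apply]
    exact div_pos (hm l) hD
  · rw [Finset.sum_image fun x _ y _ hxy => ht hxy]
    simp only [ht.extend_apply, h]
  · intro b hb
    obtain ⟨l, -, rfl⟩ := Finset.mem_image.1 hb
    rw [hin, sum_tupleMultiplier, ← hDdef]
    field_simp
    ring
  · intro b hb
    have := hF b hb
    rw [TupleViolates, not_lt, ← hDdef] at this
    rw [hin, div_add' _ _ _ hD.ne']
    exact div_nonneg (by linarith) hD.le

/-- Tightness is a linear system with the invertible Gram matrix, so the true multipliers are its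
only solution and Cramer's rule returns them times the positive determinant. -/
theorem LeastNorm.tuple [DecidableEq ι] {j : ℕ} {t : Fin j → ι} (ht : Function.Injective t)
    {m : ι → ℝ} {h : E} (H : LeastNorm a c B (Finset.univ.image t) m h)
    (hli : LinearIndepOn ℝ a ((Finset.univ.image t : Finset ι) : Set ι)) :
    TupleValid a c t ∧ ∀ b ∈ B, ¬ TupleViolates a c t b := by
  have hli' : LinearIndependent ℝ fun l => a (t l) := by
    rw [Finset.coe_image, Finset.coe_univ, Set.image_univ] at hli
    exact (linearIndepOn_range_iff ht a).1 hli
  have hD := (Matrix.posDef_gram_of_linearIndependent hli').det_pos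
  have hh : h = ∑ l, m (t l) • a (t l) := by
    rw [H.eq, Finset.sum_image fun x _ y _ hxy => ht hxy]
  have hmul : tupleMultiplier a c t =
      (Matrix.gram ℝ fun l => a (t l)).det • fun l => m (t l) := by
    have hinj := Matrix.mulVec_injective_iff_isUnit.2
      ((Matrix.isUnit_iff_isUnit_det _).2 (isUnit_iff_ne_zero.2 hD.ne'))
    apply hinj
    rw [tupleMultiplier, Matrix.mulVec_cramer, Matrix.mulVec_smul]
    congr 1
    ext k
    have := H.tight (t k) (Finset.mem_image_of_mem _ (Finset.mem_univ k))
    rw [neg_eq_of_add_eq_zero_left this, hh, sum_inner]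
    simp only [Matrix.mulVec, dotProduct]
    refine Finset.sum_congr rfl fun l _ => ?_
    rw [Matrix.gram_apply, real_inner_smul_left, real_inner_comm, mul_comm]
  refine ⟨⟨hD, fun l => ?_⟩, fun b hb => ?_⟩
  · rw [hmul]
    exact mul_pos hD (H.pos _ (Finset.mem_image_of_mem _ (Finset.mem_univ l)))
  · have h₁ := H.feasible b hb
    rw [TupleViolates, not_lt, hmul]
    rw [hh, sum_inner] at h₁
    have := mul_nonneg hD.le h₁
    rw [mul_add, Finset.mul_sum] at this
    rw [add_comm]
    refine this.trans_eq ?_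
    congr 1
    refine Finset.sum_congr rfl fun l _ => ?_
    rw [real_inner_smul_left]
    simp only [Pi.smul_apply, smul_eq_mul]
    ring

open Classical MultipointSet in
/-- The feasible polyhedron has a point of least norm if and only if it is not empty, and this point
is determined by a unique tuple of constraints. -/
theorem sum_tupleEvent [FiniteDimensional ℝ E] {n : ℕ} {a : Fin n → E} {c : Fin n → ℝ}
    {B : Finset (Fin n)} (hB : ∀ h : E, ∀ S ⊆ B, (∀ b ∈ S, ⟪h, a b⟫ + c b = 0) →
      LinearIndepOn ℝ a (S : Set (Fin n))) {e : ℕ} (he : Module.finrank ℝ E = e) :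
    ∑ j ∈ Finset.range (e + 1), ∑ t : Fin j → Fin n,
      (if StrictMono t ∧ TupleValid a c t then tupleEvent t (TupleViolates a c t) B else 0) =
        if ∃ h : E, ∀ b ∈ B, 0 ≤ ⟪h, a b⟫ + c b then 1 else 0 := by
  have hterm : ∀ j (t : Fin j → Fin n), (if StrictMono t ∧ TupleValid a c t then
      tupleEvent t (TupleViolates a c t) B else 0) ≠ 0 → StrictMono t ∧
        ∃ m h, LeastNorm a c B (Finset.univ.image t) m h := by
    intro j t h0
    split_ifs at h0 with h₁
    · rw [tupleEvent] at h0
      split_ifs at h0 with h₂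
      · exact ⟨h₁.1, leastNorm_of_tuple h₁.1.injective h₁.2 h₂.1 h₂.2⟩
      · exact (h0 rfl).elim
    · exact (h0 rfl).elim
  split_ifs with hne
  · obtain ⟨I, m, h, H⟩ := exists_leastNorm hB hne
    have hli := hB h I H.subset H.tight
    -- Independent vectors number at most `e`, so the range of `j` is long enough.
    have hI : I.card < e + 1 := by
      have := hli.fintype_card_le_finrank
      rw [he] at this
      simpa using Nat.lt_succ_of_le this
    have huniq : ∀ j (t : Fin j → Fin n), (if StrictMono t ∧ TupleValid a c t then
        tupleEvent t (TupleViolates a c t) B else 0) ≠ 0 → Finset.univ.image t = I := by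
      intro j t h0
      obtain ⟨-, m', h', H'⟩ := hterm j t h0
      exact H'.unique hB H
    -- The only increasing enumeration of `I`; it gives the single term equal to `1`.
    let t₀ := I.orderEmbOfFin rfl
    have himg : Finset.univ.image t₀ = I := Finset.image_orderEmbOfFin_univ I rfl
    rw [Finset.sum_eq_single I.card, Finset.sum_eq_single (t₀ : Fin I.card → Fin n)]
    · rw [← himg] at H hli
      obtain ⟨h₁, h₂⟩ := H.tuple t₀.injective hli
      have h₃ : ∀ l, t₀ l ∈ B := fun l =>
        H.subset (Finset.mem_image_of_mem _ (Finset.mem_univ l))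
      rw [if_pos ⟨t₀.strictMono, h₁⟩, tupleEvent, if_pos ⟨h₃, h₂⟩]
    · intro t _ ht
      by_contra h0
      apply ht
      refine Finset.orderEmbOfFin_unique rfl (fun l => ?_) (hterm _ t h0).1
      rw [← huniq _ t h0]
      exact Finset.mem_image_of_mem _ (Finset.mem_univ l)
    · simp
    · intro j _ hj
      refine Finset.sum_eq_zero fun t _ => ?_
      by_contra h0
      apply hj
      rw [← huniq j t h0, Finset.card_image_of_injective _ (hterm j t h0).1.injective]
      simp
    · intro h0
      exact (h0 (Finset.mem_range.2 hI)).elim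
  · refine Finset.sum_eq_zero fun j _ => Finset.sum_eq_zero fun t _ => ?_
    by_contra h0
    obtain ⟨-, m, h, H⟩ := hterm j t h0
    exact hne ⟨h, H.feasible⟩

end LeastNorm

/-! ### Half-spaces through the query point -/

section Halfspaces

variable {n : ℕ}

/-- The points with indices in `B` lie in an open half-space, with respect to the first `k`
coordinates. -/
def OpenSide (v : Fin n → ℕ → ℝ) (k : ℕ) (B : Finset (Fin n)) : Prop :=
  ∃ h : ℕ → ℝ, ∀ b ∈ B, 0 < ∑ c ∈ Finset.range k, h c * v b c

/-- The points with indices in `B` lie in a closed half-space whose normal vector has its last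
coordinate, which has the index `e`, equal to `ε`. -/
def ClosedSide (v : Fin n → ℕ → ℝ) (e : ℕ) (ε : ℝ) (B : Finset (Fin n)) : Prop :=
  ∃ h : ℕ → ℝ, ∀ b ∈ B, 0 ≤ (∑ c ∈ Finset.range e, h c * v b c) + ε * v b e

/-- Any `k` of the vectors are linearly independent with respect to the first `k` coordinates. -/
def Generic (v : Fin n → ℕ → ℝ) (k : ℕ) : Prop :=
  ∀ S : Finset (Fin n), S.card ≤ k →
    LinearIndepOn ℝ (fun s => WithLp.toLp 2 fun c : Fin k => v s c) (S : Set (Fin n))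

open scoped RealInnerProductSpace

theorem inner_toLp {k : ℕ} (x y : Fin k → ℝ) :
    ⟪(WithLp.toLp 2 x : EuclideanSpace ℝ (Fin k)), WithLp.toLp 2 y⟫ = ∑ c, x c * y c := by
  simp [PiLp.inner_apply, mul_comm]

/-- A nonzero normal vector orthogonal to `k` of the vectors would be in the kernel of an invertible
matrix. -/
theorem Generic.card_lt {v : Fin n → ℕ → ℝ} {k : ℕ} (hv : Generic v k) {h : ℕ → ℝ}
    (h0 : ∃ c < k, h c ≠ 0) {S : Finset (Fin n)}
    (hS : ∀ s ∈ S, ∑ c ∈ Finset.range k, h c * v s c = 0) : S.card < k := by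
  by_contra hk
  obtain ⟨T, hTS, hT⟩ := Finset.exists_subset_card_eq (not_lt.1 hk)
  obtain ⟨c, hc, hhc⟩ := h0
  let g := T.orderEmbOfFin hT
  let A : Matrix (Fin k) (Fin k) ℝ := fun i c => v (g i) c
  have hli : LinearIndependent ℝ A := by
    have h₁ := hv T hT.le
    have h₂ := LinearIndependent.comp h₁ (fun i : Fin k => ⟨g i, T.orderEmbOfFin_mem hT i⟩)
      (fun i j hij => g.injective (congrArg Subtype.val hij))
    exact h₂.map' (WithLp.linearEquiv 2 ℝ (Fin k → ℝ)).toLinearMap (LinearEquiv.ker _)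
  have hdet : A.det ≠ 0 := isUnit_iff_ne_zero.1
    ((Matrix.isUnit_iff_isUnit_det A).1 (Matrix.linearIndependent_rows_iff_isUnit.1 hli))
  have := Matrix.eq_zero_of_mulVec_eq_zero hdet (v := fun c : Fin k => h c) (by
    ext i
    have := hS (g i) (hTS (T.orderEmbOfFin_mem hT i))
    rw [Finset.sum_range] at this
    simp only [Matrix.mulVec, dotProduct, Pi.zero_apply]
    rw [← this]
    exact Finset.sum_congr rfl fun c _ => mul_comm _ _)
  exact hhc (congrFun this ⟨c, hc⟩)

/-- At most `e` vectors lie on the bounding hyperplane, and they are independent, so a small tilt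
moves all of them strictly inside without losing the others. Conversely, an open half-space whose
normal has a last coordinate of the sign of `ε` can be rescaled. -/
theorem closedSide_iff {v : Fin n → ℕ → ℝ} {e : ℕ} (hv : Generic v (e + 1)) {ε : ℝ} (hε : ε ≠ 0)
    {B : Finset (Fin n)} : ClosedSide v e ε B ↔
      ∃ h : ℕ → ℝ, 0 < ε * h e ∧ ∀ b ∈ B, 0 < ∑ c ∈ Finset.range (e + 1), h c * v b c := by
  classical
  constructor
  · rintro ⟨h, hh⟩
    let h' : ℕ → ℝ := fun c => if c = e then ε else h c
    have hsum : ∀ b, ∑ c ∈ Finset.range (e + 1), h' c * v b c =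
        (∑ c ∈ Finset.range e, h c * v b c) + ε * v b e := by
      intro b
      rw [Finset.sum_range_succ]
      congr 1
      · refine Finset.sum_congr rfl fun c hc => ?_
        rw [Finset.mem_range] at hc
        simp [h', hc.ne]
      · simp [h']
    let S := B.filter fun b => ∑ c ∈ Finset.range (e + 1), h' c * v b c = 0
    have hcard := hv.card_lt (h := h') (S := S) ⟨e, Nat.lt_succ_self e, by simpa [h'] using hε⟩
      (fun s hs => (Finset.mem_filter.1 hs).2)
    obtain ⟨u, hu⟩ := exists_inner_eq (hv S hcard.le) fun _ => 1
    let u' : ℕ → ℝ := fun c => if hc : c < e + 1 then u ⟨c, hc⟩ else 0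
    have hu' : ∀ b ∈ S, ∑ c ∈ Finset.range (e + 1), u' c * v b c = 1 := by
      intro b hb
      rw [← hu b hb, Finset.sum_range]
      rw [PiLp.inner_apply]
      refine Finset.sum_congr rfl fun c _ => ?_
      simp only [u', Fin.is_lt, dite_true, Fin.eta]
      simp [mul_comm]
    obtain ⟨δ, hδ, hpos⟩ := exists_pos_forall_pos
      -- The index `none` stands for one more strict inequality: the last coordinate of the normal
      -- keeps the sign of `ε`.
      (B := insert none ((B \ S).map Function.Embedding.some))
      (f := fun o : Option (Fin n) => o.elim (ε * ε)
        fun b => ∑ c ∈ Finset.range (e + 1), h' c * v b c)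
      (g := fun o => o.elim (ε * u' e) fun b => ∑ c ∈ Finset.range (e + 1), u' c * v b c) (by
        intro o ho
        rw [Finset.mem_insert] at ho
        rcases ho with rfl | ho
        · simpa using mul_self_pos.2 hε
        · obtain ⟨b, hb, rfl⟩ := Finset.mem_map.1 ho
          rw [Finset.mem_sdiff] at hb
          have h₁ := hh b hb.1
          rw [← hsum] at h₁
          exact lt_of_le_of_ne h₁ fun h0 => hb.2 (Finset.mem_filter.2 ⟨hb.1, h0.symm⟩))
    have hadd : ∀ b, ∑ c ∈ Finset.range (e + 1), (h' c + δ * u' c) * v b c =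
        ∑ c ∈ Finset.range (e + 1), h' c * v b c +
          δ * ∑ c ∈ Finset.range (e + 1), u' c * v b c := by
      intro b
      rw [Finset.mul_sum, ← Finset.sum_add_distrib]
      exact Finset.sum_congr rfl fun c _ => by ring
    refine ⟨fun c => h' c + δ * u' c, ?_, fun b hb => ?_⟩
    · have := hpos none (Finset.mem_insert_self _ _)
      simp only [Option.elim] at this
      simp only [h', if_true]
      linarith
    · rw [hadd]
      by_cases hbS : b ∈ S
      · rw [hu' b hbS, (Finset.mem_filter.1 hbS).2]
        linarith
      · exact hpos (some b) (Finset.mem_insert_of_mem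
          (Finset.mem_map_of_mem _ (Finset.mem_sdiff.2 ⟨hb, hbS⟩)))
  · rintro ⟨h, h0, hh⟩
    -- The scaling factor is `ε / h e`, written so that its positivity is visible.
    refine ⟨fun c => ε * ε / (ε * h e) * h c, fun b hb => ?_⟩
    have h₁ := hh b hb
    rw [Finset.sum_range_succ] at h₁
    have h₂ : (∑ c ∈ Finset.range e, ε * ε / (ε * h e) * h c * v b c) + ε * v b e =
        ε * ε / (ε * h e) * ((∑ c ∈ Finset.range e, h c * v b c) + h e * v b e) := by
      have he : h e ≠ 0 := by rintro he; simp [he] at h0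
      rw [mul_add, Finset.mul_sum]
      congr 1
      · exact Finset.sum_congr rfl fun c _ => by ring
      · field_simp
    rw [h₂]
    exact mul_nonneg (div_nonneg (mul_self_nonneg ε) h0.le) h₁.le

/-- A half-space in fewer coordinates leaves room for a small last coordinate of either sign in the
normal. -/
theorem OpenSide.closedSide {v : Fin n → ℕ → ℝ} {e : ℕ} {B : Finset (Fin n)} {ε : ℝ}
    (hv : Generic v (e + 1)) (hε : ε ≠ 0) (h : OpenSide v e B) : ClosedSide v e ε B := by
  obtain ⟨h, hh⟩ := h
  obtain ⟨δ, hδ, hpos⟩ := exists_pos_forall_pos (g := fun b => ε * v b e) hh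
  rw [closedSide_iff hv hε]
  refine ⟨fun c => if c = e then δ * ε else h c, ?_, fun b hb => ?_⟩
  · have := mul_self_pos.2 hε
    simp only [if_true]
    nlinarith
  · have := hpos b hb
    rw [Finset.sum_range_succ, Finset.sum_congr rfl (g := fun c => h c * v b c)]
    · simp only [if_true]
      linarith
    · intro c hc
      rw [Finset.mem_range] at hc
      simp only [if_neg hc.ne]

/-- The sign of the last coordinate of the normal decides the side; if it is zero, either side can
be reached by a tilt. -/
theorem openSide_succ_iff {v : Fin n → ℕ → ℝ} {e : ℕ} {B : Finset (Fin n)}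
    (hv : Generic v (e + 1)) :
    OpenSide v (e + 1) B ↔ ClosedSide v e 1 B ∨ ClosedSide v e (-1) B := by
  constructor
  · rintro ⟨h, hh⟩
    rcases lt_trichotomy (h e) 0 with h0 | h0 | h0
    · exact .inr ((closedSide_iff hv (by norm_num)).2 ⟨h, by linarith, hh⟩)
    · refine .inl (OpenSide.closedSide hv one_ne_zero ⟨h, fun b hb => ?_⟩)
      have := hh b hb
      rwa [Finset.sum_range_succ, h0, zero_mul, add_zero] at this
    · exact .inl ((closedSide_iff hv (by norm_num)).2 ⟨h, by linarith, hh⟩)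
  · rintro (h | h)
    · obtain ⟨h, -, hh⟩ := (closedSide_iff hv (by norm_num)).1 h
      exact ⟨h, hh⟩
    · obtain ⟨h, -, hh⟩ := (closedSide_iff hv (by norm_num)).1 h
      exact ⟨h, hh⟩

theorem openSide_iff_and {v : Fin n → ℕ → ℝ} {e : ℕ} {B : Finset (Fin n)}
    (hv : Generic v (e + 1)) :
    OpenSide v e B ↔ ClosedSide v e 1 B ∧ ClosedSide v e (-1) B := by
  constructor
  · exact fun h => ⟨h.closedSide hv (by norm_num), h.closedSide hv (by norm_num)⟩
  · rintro ⟨h₁, h₂⟩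
    obtain ⟨h, h0, hh⟩ := (closedSide_iff hv (by norm_num)).1 h₁
    obtain ⟨h', h0', hh'⟩ := (closedSide_iff hv (by norm_num)).1 h₂
    -- The last coordinates of the two normals have opposite signs, so this positive combination
    -- cancels them.
    refine ⟨fun c => -h' e * h c + h e * h' c, fun b hb => ?_⟩
    have h₃ := hh b hb
    have h₄ := hh' b hb
    rw [Finset.sum_range_succ] at h₃ h₄
    have : ∑ c ∈ Finset.range e, (-h' e * h c + h e * h' c) * v b c =
        -h' e * ∑ c ∈ Finset.range e, h c * v b c + h e * ∑ c ∈ Finset.range e, h' c * v b c := by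
      rw [Finset.mul_sum, Finset.mul_sum, ← Finset.sum_add_distrib]
      exact Finset.sum_congr rfl fun c _ => by ring
    rw [this]
    have h₅ : 0 < -h' e := by linarith
    have h₆ : 0 < h e := by linarith
    have h₇ := mul_pos h₅ h₃
    have h₈ := mul_pos h₆ h₄
    linarith

open Classical in
theorem openSide_succ_indicator {v : Fin n → ℕ → ℝ} {e : ℕ} (hv : Generic v (e + 1))
    (B : Finset (Fin n)) : (if OpenSide v (e + 1) B then 1 else 0 : ℝ) =
      (if ClosedSide v e 1 B then 1 else 0) + (if ClosedSide v e (-1) B then 1 else 0) -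
        if OpenSide v e B then 1 else 0 := by
  rw [if_congr (openSide_succ_iff hv) rfl rfl, if_congr (openSide_iff_and hv) rfl rfl]
  by_cases h₁ : ClosedSide v e 1 B <;> by_cases h₂ : ClosedSide v e (-1) B <;> simp [h₁, h₂]

open Classical in
-- On a line the normal only has a sign. The two cases overlap exactly for the empty set.
theorem openSide_one_indicator (v : Fin n → ℕ → ℝ) (B : Finset (Fin n)) :
    (if OpenSide v 1 B then 1 else 0 : ℝ) =
      (if ∀ b ∈ B, 0 < v b 0 then 1 else 0) + (if ∀ b ∈ B, v b 0 < 0 then 1 else 0) -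
        if B = ∅ then 1 else 0 := by
  rcases B.eq_empty_or_nonempty with rfl | ⟨b₀, hb₀⟩
  · simp [OpenSide]
  · have hB : B ≠ ∅ := Finset.ne_empty_of_mem hb₀
    have h : OpenSide v 1 B ↔ (∀ b ∈ B, 0 < v b 0) ∨ ∀ b ∈ B, v b 0 < 0 := by
      constructor
      · rintro ⟨h, hh⟩
        simp only [Finset.range_one, Finset.sum_singleton] at hh
        rcases lt_trichotomy (h 0) 0 with h0 | h0 | h0
        · right
          intro b hb
          have := hh b hb
          nlinarith
        · have := hh b₀ hb₀
          simp [h0] at this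
        · left
          intro b hb
          exact (mul_pos_iff_of_pos_left h0).1 (hh b hb)
      · rintro (h | h)
        · exact ⟨fun _ => 1, by simpa using h⟩
        · exact ⟨fun _ => -1, by simpa using h⟩
    rw [if_neg hB, sub_zero, if_congr h rfl rfl]
    by_cases h₁ : ∀ b ∈ B, 0 < v b 0
    · have h₂ : ¬ ∀ b ∈ B, v b 0 < 0 := fun h₂ => lt_asymm (h₁ b₀ hb₀) (h₂ b₀ hb₀)
      rw [if_pos (Or.inl h₁), if_pos h₁, if_neg h₂, add_zero]
    · rw [if_neg h₁, zero_add]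
      simp [h₁]

/-- The constraint vectors of the closed half-spaces whose normal vectors end with `ε`. -/
noncomputable def sideVector (v : Fin n → ℕ → ℝ) (e : ℕ) (s : Fin n) : EuclideanSpace ℝ (Fin e) :=
  WithLp.toLp 2 fun c => v s c

theorem inner_sideVector (v : Fin n → ℕ → ℝ) (e : ℕ) (s t : Fin n) :
    ⟪sideVector v e s, sideVector v e t⟫ = ∑ c ∈ Finset.range e, v s c * v t c := by
  rw [sideVector, sideVector, inner_toLp, Finset.sum_range]

open Classical MultipointSet in
-- The nondegeneracy needed for `sum_tupleEvent` follows from genericity in one more coordinate.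
-- Constraints tight at `h` belong to vectors on the hyperplane with normal `(h, ε)`; there the last
-- coordinate is a linear function of the others, so independence survives dropping it.
theorem closedSide_indicator {v : Fin n → ℕ → ℝ} {e : ℕ} (hv : Generic v (e + 1)) {ε : ℝ}
    (hε : ε ≠ 0) (B : Finset (Fin n)) : (if ClosedSide v e ε B then 1 else 0 : ℝ) =
      ∑ j ∈ Finset.range (e + 1), ∑ t : Fin j → Fin n,
        if StrictMono t ∧ TupleValid (sideVector v e) (fun s => ε * v s e) t then
          tupleEvent t (TupleViolates (sideVector v e) (fun s => ε * v s e) t) B else 0 := by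
  have hin : ∀ (h : EuclideanSpace ℝ (Fin e)) b, ⟪h, sideVector v e b⟫ = ∑ c, h c * v b c := by
    intro h b
    simp [PiLp.inner_apply, sideVector, mul_comm]
  rw [sum_tupleEvent _ (by simp)]
  · refine if_congr ⟨?_, ?_⟩ rfl rfl
    · rintro ⟨h, hh⟩
      refine ⟨WithLp.toLp 2 fun c => h c, fun b hb => ?_⟩
      rw [hin]
      simpa [Finset.sum_range] using hh b hb
    · rintro ⟨h, hh⟩
      refine ⟨fun c => if hc : c < e then h ⟨c, hc⟩ else 0, fun b hb => ?_⟩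
      have := hh b hb
      rw [hin] at this
      simpa [Finset.sum_range] using this
  · intro h S hSB hS
    let h' : ℕ → ℝ := fun c => if hc : c < e then h ⟨c, hc⟩ else ε
    have hsum : ∀ b, ∑ c ∈ Finset.range (e + 1), h' c * v b c =
        ⟪h, sideVector v e b⟫ + ε * v b e := by
      intro b
      rw [hin, Finset.sum_range_succ, Finset.sum_range]
      simp [h']
    have hcard := hv.card_lt (h := h') (S := S) ⟨e, Nat.lt_succ_self e, by simpa [h'] using hε⟩
      (fun s hs => by rw [hsum, hS s hs])
    have hli := hv S hcard.le
    rw [linearIndepOn_finset_iff] at hli ⊢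
    intro f hf b hb
    refine hli f ?_ b hb
    have hlow : ∀ c : Fin e, ∑ s ∈ S, f s * v s c = 0 := by
      intro c
      have := congrArg (fun x : EuclideanSpace ℝ (Fin e) => x c) hf
      simpa [sideVector] using this
    -- Tightness expresses `ε * v s e` through the first `e` coordinates, so a relation among those
    -- extends to the last one.
    have hlast : ∑ s ∈ S, f s * v s e = 0 := by
      have h₁ : ∑ s ∈ S, f s * (⟪h, sideVector v e s⟫ + ε * v s e) = 0 :=
        Finset.sum_eq_zero fun s hs => by rw [hS s hs, mul_zero]
      have h₂ : ∑ s ∈ S, f s * ⟪h, sideVector v e s⟫ = 0 := by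
        have := congrArg (fun x => ⟪h, x⟫) hf
        simpa [inner_sum, inner_smul_right] using this
      simp only [mul_add, Finset.sum_add_distrib, h₂, zero_add] at h₁
      have h₃ : ε * ∑ s ∈ S, f s * v s e = 0 := by
        rw [Finset.mul_sum, ← h₁]
        exact Finset.sum_congr rfl fun s _ => by ring
      exact (mul_eq_zero.1 h₃).resolve_left hε
    ext c
    simp only [WithLp.ofLp_sum, WithLp.ofLp_smul, Finset.sum_apply, Pi.smul_apply, smul_eq_mul,
      PiLp.zero_apply]
    refine Fin.lastCases ?_ (fun c => ?_) c
    · simpa using hlast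
    · simpa using hlow c

end Halfspaces

/-! ### Convex hulls and general position in terms of half-spaces through the query point. -/

namespace MultipointSet

variable {d : ℕ}

/-- The vector from the query point to a site. -/
def offset (P : MultipointSet d) (q : Fin d → ℝ) (s : Fin P.n) (c : ℕ) : ℝ :=
  if hc : c < d then P.site s ⟨c, hc⟩ - q ⟨c, hc⟩ else 0

/-- The hull of finitely many points is compact, so Hahn–Banach separates `q` from it strictly;
conversely an open half-space is convex. -/
theorem notMem_convexHull_iff (P : MultipointSet d) (q : Fin d → ℝ) (B : Finset (Fin P.n)) :
    q ∉ convexHull ℝ (P.site '' (B : Set (Fin P.n))) ↔ OpenSide (P.offset q) d B := by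
  constructor
  · intro hq
    have hfin : (P.site '' (B : Set (Fin P.n))).Finite := B.finite_toSet.image _
    obtain ⟨f, u, hu, hf⟩ := geometric_hahn_banach_point_closed (convex_convexHull ℝ _)
      (hfin.isCompact_convexHull (𝕜 := ℝ)).isClosed hq
    refine ⟨fun c => if hc : c < d then f (Pi.single ⟨c, hc⟩ 1) else 0, fun b hb => ?_⟩
    have h₁ := hf _ (subset_convexHull ℝ _ (Set.mem_image_of_mem P.site hb))
    have h₂ : f (P.site b - q) = ∑ c : Fin d, f (Pi.single c 1) * (P.site b c - q c) := by
      have : P.site b - q = ∑ c, (P.site b c - q c) • (Pi.single c 1 : Fin d → ℝ) := by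
        ext c'
        simp [Finset.sum_apply, Pi.single_apply]
      rw [this, map_sum]
      refine Finset.sum_congr rfl fun c _ => ?_
      rw [map_smul, smul_eq_mul, mul_comm]
    rw [map_sub] at h₂
    rw [Finset.sum_range]
    simp only [offset, Fin.is_lt, dite_true, Fin.eta]
    linarith
  · rintro ⟨h, hh⟩ hq
    have hconv : Convex ℝ {x : Fin d → ℝ | ∑ c : Fin d, h c * q c < ∑ c : Fin d, h c * x c} :=
      convex_halfSpace_gt (𝕜 := ℝ) (f := fun x : Fin d → ℝ => ∑ c : Fin d, h c * x c)
        ⟨fun x y => by simp [mul_add, Finset.sum_add_distrib],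
          fun r x => by
            simp only [Pi.smul_apply, smul_eq_mul, Finset.mul_sum]
            exact Finset.sum_congr rfl fun c _ => by ring⟩ _
    have := convexHull_min (t := {x : Fin d → ℝ | ∑ c : Fin d, h c * q c < ∑ c : Fin d, h c * x c})
      (by
        rintro _ ⟨b, hb, rfl⟩
        have := hh b hb
        rw [Finset.sum_range] at this
        simp only [offset, Fin.is_lt, dite_true, Fin.eta, mul_sub, Finset.sum_sub_distrib] at this
        exact sub_pos.1 this) hconv hq
    exact lt_irrefl (∑ c : Fin d, h c * q c) this

/-- A singular minor in the first `k'` coordinates yields a hyperplane through `q` and `k'` sites,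
that is, through `k' + 1` of the points. -/
theorem GeneralPosition.generic {P : MultipointSet d} {q : Fin d → ℝ} (hP : P.GeneralPosition q)
    (hn : 2 ≤ P.n) {k : ℕ} (hk : 2 ≤ k) (hkd : k ≤ d) : Generic (P.offset q) k := by
  classical
  intro S hS
  -- General position says nothing about projections to a single coordinate, so smaller sets are
  -- padded to two sites; this is what `hn` is for.
  obtain ⟨S', hSS', hS'⟩ := Finset.exists_superset_card_eq (s := S) (n := max 2 S.card)
    (le_max_right _ _) (by
      rw [Fintype.card_fin]
      exact max_le hn (by simpa using Finset.card_le_univ S))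
  refine LinearIndepOn.mono ?_ (Finset.coe_subset.2 hSS')
  set k' := max 2 S.card with hk'
  have hk'k : k' ≤ k := max_le hk hS
  let g := S'.orderEmbOfFin hS'
  let A : Matrix (Fin k') (Fin k') ℝ := fun i c => P.offset q (g i) c
  have hdet : A.det ≠ 0 := by
    intro h0
    obtain ⟨x, hx, hAx⟩ := Matrix.exists_mulVec_eq_zero_iff.2 h0
    obtain ⟨c₀, hc₀⟩ := Function.ne_iff.1 hx
    let J : Finset (Fin d) := Finset.univ.filter fun c => (c : ℕ) < k'
    let y : Fin d → ℝ := fun c => if hc : (c : ℕ) < k' then x ⟨c, hc⟩ else 0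
    have hJsum : ∀ f : Fin d → ℝ, ∑ c ∈ J, f c =
        ∑ c : Fin k', f (Fin.castLE (hk'k.trans hkd) c) := by
      intro f
      refine Eq.trans ?_ (Finset.sum_map Finset.univ (Fin.castLEEmb (hk'k.trans hkd)) f)
      refine Finset.sum_congr ?_ fun _ _ => rfl
      ext c
      simp only [J, Finset.mem_filter, Finset.mem_univ, true_and, Finset.mem_map]
      constructor
      · intro hc
        exact ⟨⟨c, hc⟩, rfl⟩
      · rintro ⟨c', rfl⟩
        exact c'.2
    have hJ : J.card = k' := by
      have := hJsum fun _ => 1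
      simp only [Finset.sum_const, nsmul_eq_mul, mul_one, Finset.card_univ, Fintype.card_fin] at this
      exact_mod_cast this
    refine hP k' J (Finset.insertNone S') (le_max_left _ _) (hk'k.trans hkd) hJ
      (by rw [Finset.card_insertNone, hS']) ⟨y, ∑ c ∈ J, y c * q c, ?_, ?_⟩
    · refine ⟨Fin.castLE (hk'k.trans hkd) c₀, by simp [J], ?_⟩
      simpa [y] using hc₀
    · intro o ho
      rcases o with - | s
      · rfl
      · have hs : s ∈ S' := by simpa using ho
        obtain ⟨i, rfl⟩ : ∃ i, g i = s := by
          have : s ∈ Set.range g := by rw [Finset.range_orderEmbOfFin]; exact hs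
          exact this
        have h₁ := congrFun hAx i
        simp only [Matrix.mulVec, dotProduct, Pi.zero_apply, A] at h₁
        rw [← sub_eq_zero, ← Finset.sum_sub_distrib, hJsum, ← h₁]
        refine Finset.sum_congr rfl fun c _ => ?_
        have : (c : ℕ) < d := by omega
        simp only [y, offset, Fin.val_castLE, Fin.is_lt, dite_true, Fin.eta, pointOf, this]
        rw [← mul_sub, mul_comm]
        rfl
  have hrows : LinearIndependent ℝ A :=
    Matrix.linearIndependent_rows_iff_isUnit.2
      ((Matrix.isUnit_iff_isUnit_det _).2 (isUnit_iff_ne_zero.2 hdet))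
  rw [linearIndepOn_finset_iff]
  intro f hf
  rw [Fintype.linearIndependent_iff] at hrows
  have h₁ := hrows (fun i => f (g i)) (by
    ext c
    have h₂ := congrArg (fun x : EuclideanSpace ℝ (Fin k) => x (Fin.castLE hk'k c)) hf
    simp only [WithLp.ofLp_sum, WithLp.ofLp_smul, Finset.sum_apply, Pi.smul_apply, smul_eq_mul,
      PiLp.zero_apply, Fin.val_castLE] at h₂
    simp only [Finset.sum_apply, Pi.smul_apply, smul_eq_mul, Pi.zero_apply]
    rw [← h₂, ← Finset.image_orderEmbOfFin_univ S' hS',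
      Finset.sum_image fun x _ y _ hxy => g.injective hxy])
  intro s hs
  obtain ⟨i, rfl⟩ : ∃ i, g i = s := by
    have : s ∈ Set.range g := by rw [Finset.range_orderEmbOfFin]; exact hs
    exact this
  exact h₁ i

end MultipointSet

namespace RealRAM

/-! ### Sums over tuples of sites -/

variable {d : ℕ}

/-- The sum of finitely many expressions. -/
def RealExpr.sum : (k : ℕ) → (Fin k → RealExpr) → RealExpr
  | 0, _ => .lit 0
  | k + 1, f => .add (RealExpr.sum k fun i => f i.castSucc) (f (Fin.last k))

theorem RealExpr.eval_sum (M : Memory) {k : ℕ} (f : Fin k → RealExpr) :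
    (RealExpr.sum k f).eval M = ∑ i, (f i).eval M := by
  induction k with
  | zero => simp [RealExpr.sum, RealExpr.eval]
  | succ k ih => rw [RealExpr.sum, RealExpr.eval, ih, Fin.sum_univ_castSucc]

/-- The determinant of a matrix of expressions. -/
def RealExpr.det : (j : ℕ) → (Fin j → Fin j → RealExpr) → RealExpr
  | 0, _ => .lit 1
  | j + 1, A => RealExpr.sum (j + 1) fun i => .mul (.mul (.lit ((-1) ^ (i : ℕ))) (A 0 i))
      (RealExpr.det j fun r c => A r.succ (i.succAbove c))

/-- Laplace expansion along the first row. Its length depends on `j` and the entries only, hence it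
costs constant time in a fixed dimension. -/
theorem RealExpr.eval_det (M : Memory) {j : ℕ} (A : Fin j → Fin j → RealExpr) :
    (RealExpr.det j A).eval M = Matrix.det (Matrix.of fun r c => (A r c).eval M) := by
  induction j with
  | zero => simp [RealExpr.det, RealExpr.eval]
  | succ j ih =>
    rw [RealExpr.det, RealExpr.eval_sum, Matrix.det_succ_row_zero]
    refine Finset.sum_congr rfl fun i _ => ?_
    simp only [RealExpr.eval, ih, Int.cast_pow, Int.cast_neg, Int.cast_one]
    rfl

/-- A test that always succeeds. -/
def Test.true : Test := .natLt (.lit 0) (.lit 1)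

theorem Test.holds_true (M : Memory) : Test.true.Holds M := by
  simp [Test.true, Test.Holds, NatExpr.eval]

/-- The equality of natural numbers. -/
def Test.natEq (e f : NatExpr) : Test := .and (.not (.natLt e f)) (.not (.natLt f e))

theorem Test.holds_natEq (M : Memory) (e f : NatExpr) :
    (Test.natEq e f).Holds M ↔ e.eval M = f.eval M := by
  simp only [Test.natEq, Test.Holds]
  omega

/-- The equality of real numbers. -/
def Test.realEq (e f : RealExpr) : Test := .and (.not (.realLt e f)) (.not (.realLt f e))

theorem Test.holds_realEq (M : Memory) (e f : RealExpr) :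
    (Test.realEq e f).Holds M ↔ e.eval M = f.eval M := by
  simp only [Test.realEq, Test.Holds, not_lt]
  exact ⟨fun h => le_antisymm h.2 h.1, fun h => ⟨h.ge, h.le⟩⟩

/-- The conjunction of finitely many tests. -/
def Test.all : (k : ℕ) → (Fin k → Test) → Test
  | 0, _ => .true
  | k + 1, f => .and (Test.all k fun i => f i.castSucc) (f (Fin.last k))

theorem Test.holds_all (M : Memory) {k : ℕ} (f : Fin k → Test) :
    (Test.all k f).Holds M ↔ ∀ i, (f i).Holds M := by
  induction k with
  | zero => simp [Test.all, Test.holds_true]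
  | succ k ih => rw [Test.all, Test.Holds, ih, Fin.forall_fin_succ']

/-- The `c`-th coordinate of the vector from the query point to a site. -/
def coordExpr (x : NatExpr) (c : ℕ) : RealExpr := .sub (.get (2 + c) x) (.get 0 (.lit c))

/-- The inner product of the first `e` coordinates of two such vectors. -/
def dotExpr (e : ℕ) (x y : NatExpr) : RealExpr :=
  RealExpr.sum e fun c => .mul (coordExpr x c) (coordExpr y c)

theorem HoldsInput.eval_coordExpr {P : MultipointSet d} {q : Fin d → ℝ} {M : Memory}
    (hM : HoldsInput P q M) {x : NatExpr} {s : Fin P.n} (hx : x.eval M = s) {c : ℕ} (hc : c < d) :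
    (coordExpr x c).eval M = P.offset q s c := by
  have h₁ : M.real (2 + c) s = P.site s ⟨c, hc⟩ := hM.site_eq ⟨c, hc⟩ s
  have h₂ : M.real 0 c = q ⟨c, hc⟩ := hM.query_eq ⟨c, hc⟩
  simp [coordExpr, RealExpr.eval, NatExpr.eval, MultipointSet.offset, hx, hc, h₁, h₂]

theorem HoldsInput.eval_dotExpr {P : MultipointSet d} {q : Fin d → ℝ} {M : Memory}
    (hM : HoldsInput P q M) {x y : NatExpr} {s t : Fin P.n} (hx : x.eval M = s) (hy : y.eval M = t)
    {e : ℕ} (he : e ≤ d) : (dotExpr e x y).eval M =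
      inner ℝ (sideVector (P.offset q) e s) (sideVector (P.offset q) e t) := by
  rw [dotExpr, RealExpr.eval_sum, inner_sideVector, Finset.sum_range]
  refine Finset.sum_congr rfl fun c _ => ?_
  rw [RealExpr.eval, hM.eval_coordExpr hx (by omega), hM.eval_coordExpr hy (by omega)]

/-- The constant term of the constraint of a site. -/
def constExpr (e : ℕ) (ε : ℤ) (x : NatExpr) : RealExpr := .mul (.lit ε) (coordExpr x e)

/-- The Gram determinant of the tuple. -/
def gramDetExpr (e j : ℕ) : RealExpr :=
  RealExpr.det j fun l m => dotExpr e (.reg (3 + l)) (.reg (3 + m))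

/-- The multipliers of the tuple. -/
def multiplierExpr (e : ℕ) (ε : ℤ) (j : ℕ) (i : Fin j) : RealExpr :=
  RealExpr.det j fun l m => if m = i then .sub (.lit 0) (constExpr e ε (.reg (3 + l))) else
    dotExpr e (.reg (3 + l)) (.reg (3 + m))

/-- The sites of the tuple are increasing and belong to different groups. -/
def properTest (j : ℕ) : Test :=
  Test.all j fun l => Test.all j fun m => if l < m then
    .and (.natLt (.reg (3 + l)) (.reg (3 + m)))
      (.not (.natEq (.get 1 (.reg (3 + l))) (.get 1 (.reg (3 + m))))) else .true

/-- The tuple is proper and satisfies the optimality conditions. -/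
def validTest (e : ℕ) (ε : ℤ) (j : ℕ) : Test :=
  .and (properTest j) (.and (.realLt (.lit 0) (gramDetExpr e j))
    (Test.all j fun l => .realLt (.lit 0) (multiplierExpr e ε j l)))

/-- A site violates its constraint at the point that is determined by the tuple. -/
def violatesTest (e : ℕ) (ε : ℤ) (j : ℕ) : Test :=
  .realLt (.add (.mul (gramDetExpr e j) (constExpr e ε (.reg 2)))
    (RealExpr.sum j fun l => .mul (multiplierExpr e ε j l) (dotExpr e (.reg (3 + l)) (.reg 2))))
    (.lit 0)

section Tuple

variable {P : MultipointSet d} {q : Fin d → ℝ} {M : Memory} {j : ℕ} {t : Fin j → Fin P.n}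

theorem HoldsTuple.eval_reg (hM : HoldsTuple P q t M) (l : Fin j) :
    (NatExpr.reg (3 + l)).eval M = t l := hM.2 l

theorem HoldsTuple.eval_constExpr (hM : HoldsTuple P q t M) {x : NatExpr} {s : Fin P.n} (hx : x.eval M = s) {e : ℕ}
    (he : e < d) (ε : ℤ) : (constExpr e ε x).eval M = ε * P.offset q s e := by
  rw [constExpr, RealExpr.eval, RealExpr.eval, hM.1.eval_coordExpr hx he]

theorem HoldsTuple.eval_gramDetExpr (hM : HoldsTuple P q t M) {e : ℕ} (he : e < d) :
    (gramDetExpr e j).eval M =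
    (Matrix.gram ℝ fun l => sideVector (P.offset q) e (t l)).det := by
  rw [gramDetExpr, RealExpr.eval_det]
  congr 1
  ext l m
  rw [Matrix.of_apply, Matrix.gram_apply, hM.1.eval_dotExpr (hM.eval_reg l) (hM.eval_reg m) he.le]

theorem HoldsTuple.eval_multiplierExpr (hM : HoldsTuple P q t M) {e : ℕ} (he : e < d) (ε : ℤ)
    (i : Fin j) :
    (multiplierExpr e ε j i).eval M =
      tupleMultiplier (sideVector (P.offset q) e) (fun s => ε * P.offset q s e) t i := by
  rw [multiplierExpr, RealExpr.eval_det, tupleMultiplier, Matrix.cramer_apply]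
  congr 1
  ext l m
  rw [Matrix.of_apply, Matrix.updateCol_apply]
  split_ifs
  · rw [RealExpr.eval, RealExpr.eval, hM.eval_constExpr (hM.eval_reg l) he]
    simp
  · rw [Matrix.gram_apply, hM.1.eval_dotExpr (hM.eval_reg l) (hM.eval_reg m) he.le]

theorem HoldsTuple.holds_properTest (hM : HoldsTuple P q t M) : (properTest j).Holds M ↔
    StrictMono t ∧ Function.Injective fun l => P.group (t l) := by
  have h : (properTest j).Holds M ↔
      ∀ l m, l < m → t l < t m ∧ P.group (t l) ≠ P.group (t m) := by
    simp only [properTest, Test.holds_all]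
    refine forall_congr' fun l => forall_congr' fun m => ?_
    split_ifs with hlm
    · simp only [Test.Holds, Test.holds_natEq, NatExpr.eval, hM.2, hM.1.group_eq, hlm,
        true_imp_iff, Fin.val_fin_lt, Fin.val_inj, ne_eq]
    · simp [Test.holds_true, hlm]
  rw [h]
  constructor
  · refine fun h => ⟨fun l m hlm => (h l m hlm).1, fun l m hlm => ?_⟩
    by_contra hne
    rcases lt_or_gt_of_ne hne with hlt | hlt
    · exact (h _ _ hlt).2 hlm
    · exact (h _ _ hlt).2 hlm.symm
  · exact fun h l m hlm => ⟨h.1 hlm, fun hg => hlm.ne (h.2 hg)⟩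

theorem HoldsTuple.holds_validTest (hM : HoldsTuple P q t M) {e : ℕ} (he : e < d) (ε : ℤ) :
    (validTest e ε j).Holds M ↔
    (StrictMono t ∧ Function.Injective fun l => P.group (t l)) ∧
      TupleValid (sideVector (P.offset q) e) (fun s => ε * P.offset q s e) t := by
  simp only [validTest, Test.Holds, Test.holds_all, hM.holds_properTest, hM.eval_gramDetExpr he,
    hM.eval_multiplierExpr he, RealExpr.eval, Int.cast_zero, TupleValid]

theorem HoldsTuple.holds_violatesTest (hM : HoldsTuple P q t M) {e : ℕ} (he : e < d) (ε : ℤ) {s : Fin P.n}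
    (hs : M.nat 2 0 = s) : (violatesTest e ε j).Holds M ↔
      TupleViolates (sideVector (P.offset q) e) (fun s => ε * P.offset q s e) t s := by
  simp only [violatesTest, Test.Holds, RealExpr.eval_sum, RealExpr.eval, Int.cast_zero,
    hM.eval_gramDetExpr he, hM.eval_multiplierExpr he, TupleViolates,
    hM.eval_constExpr (x := .reg 2) hs he]
  congr! 3 with l
  rw [hM.1.eval_dotExpr (y := .reg 2) (hM.eval_reg l) hs he.le]

end Tuple

/-- The memory holds the input, and the cells of the groups are clear. -/
def Ready (P : MultipointSet d) (q : Fin d → ℝ) (M : Memory) : Prop :=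
  HoldsInput P q M ∧ ∀ i, M.real (d + 2) i = 0

/-- Within `t` steps, the program adds `x` to the result. -/
def Adds (P : MultipointSet d) (q : Fin d → ℝ) (p : Program) (t : ℕ) (x : ℝ) : Prop :=
  ∀ M, Ready P q M → Ends p M t fun M' =>
    Ready P q M' ∧ M'.real (d + 4) 0 = M.real (d + 4) 0 + x

theorem Adds.seq {P : MultipointSet d} {q : Fin d → ℝ} {p r : Program} {t u : ℕ} {x y : ℝ}
    (hp : Adds P q p t x) (hr : Adds P q r u y) : Adds P q (.seq p r) (t + u) (x + y) := by
  intro M hM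
  refine (hp M hM).seq fun M' _ h => (hr M' h.1).imp fun M'' _ h' => ⟨h'.1, ?_⟩
  rw [h'.2, h.2, add_assoc]

theorem Adds.mono {P : MultipointSet d} {q : Fin d → ℝ} {p : Program} {t u : ℕ} {x y : ℝ}
    (hp : Adds P q p t x) (htu : t ≤ u) (hxy : x = y) : Adds P q p u y :=
  fun M hM => (hp M hM).mono htu fun _ _ h => ⟨h.1, hxy ▸ h.2⟩

theorem adds_skip (P : MultipointSet d) (q : Fin d → ℝ) : Adds P q .skip 1 0 := fun _ hM =>
  Ends.of_loopFree (p := .skip) trivial ⟨hM, (add_zero _).symm⟩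

theorem adds_addTupleProb {P : MultipointSet d} {q : Fin d → ℝ} (z : ℤ) {F : Test}
    {p : Fin P.n → Prop}
    (hF : ∀ (s : Fin P.n) (M : Memory), HoldsInput P q M → M.nat 2 0 = s → (F.Holds M ↔ p s)) :
    Adds P q (addTupleProb d 0 z F) ((P.n + 1) * (F.cost + 61))
      (z * P.expect (MultipointSet.tupleEvent (j := 0) Fin.elim0 p)) := by
  rintro M ⟨hM, h0⟩
  rw [P.expect_tupleEvent (fun l => l.elim0) fun l => l.elim0]
  refine (ends_addTupleProb z (t := Fin.elim0) ⟨hM, fun l => l.elim0⟩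
    (fun s M' hM' => hF s M' hM'.1) h0).mono ?_ fun M' hf h => ⟨⟨hM.frame hf ?_ ?_ ?_, h.1⟩, h.2⟩
  · rw [takeTuple]
    simp only [Program.cost]
    exact le_of_eq (by ring)
  · exact fun h => by simpa using addTupleProb_writesNat h
  · exact fun h => by simpa using addTupleProb_writesNat h
  · intro a ha h
    have := addTupleProb_writesReal h
    omega

/-- Sums over the tuples of length `j`. -/
def sideTerm (d e : ℕ) (ε z : ℤ) (j : ℕ) : Program :=
  forTuples j (.ite (validTest e ε j) (addTupleProb d j z (violatesTest e ε j)) .skip)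

/-- Sums over the tuples of length less than `k`. -/
def sideTerms (d e : ℕ) (ε z : ℤ) : ℕ → Program
  | 0 => .skip
  | k + 1 => .seq (sideTerms d e ε z k) (sideTerm d e ε z k)

open Classical MultipointSet in
-- At most `(n + 1) ^ j` tuples with linear work each. The costs of the tests do not depend on the
-- input, so `C` can be chosen before `P` and `q`.
theorem adds_sideTerm {e : ℕ} (he : e < d) (ε z : ℤ) (j : ℕ) : ∃ C : ℕ,
    ∀ (P : MultipointSet d) (q : Fin d → ℝ), Adds P q (sideTerm d e ε z j)
      (C * (P.n + 1) ^ (j + 1)) (z * P.expect fun B => ∑ t : Fin j → Fin P.n,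
        if StrictMono t ∧ TupleValid (sideVector (P.offset q) e) (fun s => ε * P.offset q s e) t then
          tupleEvent t
            (TupleViolates (sideVector (P.offset q) e) (fun s => ε * P.offset q s e) t) B
        else 0) := by
  set K := (validTest e ε j).cost + ((violatesTest e ε j).cost + (takeTuple d j).cost + 60) + 1
    with hK
  refine ⟨2 ^ j * K, fun P q M hM => ?_⟩
  let f : (Fin j → Fin P.n) → ℝ := fun t => z * if StrictMono t ∧
    TupleValid (sideVector (P.offset q) e) (fun s => ε * P.offset q s e) t then
      P.expect (tupleEvent t
        (TupleViolates (sideVector (P.offset q) e) (fun s => ε * P.offset q s e) t)) else 0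
  have hw : ∀ a, (Program.ite (validTest e ε j) (addTupleProb d j z (violatesTest e ε j))
      .skip).WritesNat a → a = 2 := by
    rintro a (h | h)
    · exact addTupleProb_writesNat h
    · exact h.elim
  refine (ends_forTuples (n := P.n) (c := (P.n + 1) * K) (by nlinarith) hw (d + 4) (Ready P q)
    (fun M h => h.1.n_eq) (fun M l v _ h => ⟨h.1.storeNat (by omega) _ _, h.2⟩) f ?_ hM).mono
    (le_of_eq (by ring)) fun M' _ h => ⟨h.1, ?_⟩
  · intro t M hM ht
    have hT : HoldsTuple P q t M := ⟨hM.1, ht⟩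
    have hin : ∀ {M'}, Frame (addTupleProb d j z (violatesTest e ε j)) M M' → HoldsInput P q M' :=
      fun hf => hM.1.frame hf (fun h => by simpa using addTupleProb_writesNat h)
        (fun h => by simpa using addTupleProb_writesNat h)
        (fun a ha h => by have := addTupleProb_writesReal h; omega)
    refine (Ends.ite (t := (P.n + 1) * ((violatesTest e ε j).cost + (takeTuple d j).cost + 60))
      ?_ ?_).mono ?_ fun _ _ h => h
    · intro hv
      rw [hT.holds_validTest he] at hv
      refine (ends_addTupleProb z hT (fun s M' hM' hs => hM'.holds_violatesTest he ε hs)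
        hM.2).imp fun M' hf h => ⟨⟨hin hf, h.1⟩, ?_⟩
      simp only [f]
      rw [h.2, if_pos ⟨hv.1.1, hv.2⟩, P.expect_tupleEvent hv.1.2
        fun l => not_tupleViolates_self _ _ t l]
    · intro hv
      rw [hT.holds_validTest he] at hv
      refine (Ends.of_loopFree (p := .skip) (Q := fun M' => Ready P q M' ∧
        M'.real (d + 4) 0 = M.real (d + 4) 0 + f t) trivial ⟨hM, ?_⟩).mono ?_ fun _ _ h => h
      · simp only [f, Program.exec]
        split_ifs with h
        · rw [P.expect_tupleEvent_eq_zero h.1.injective fun hg => hv ⟨⟨h.1, hg⟩, h.2⟩]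
          simp
        · simp
      · simp only [Program.cost]
        nlinarith
    · rw [hK]
      nlinarith
  · rw [h.2, P.expect_sum, Finset.mul_sum]
    congr 1
    refine Finset.sum_congr rfl fun t _ => ?_
    simp only [f]
    split_ifs
    · rfl
    · simp [expect]

open Classical MultipointSet in
theorem adds_sideTerms {e : ℕ} (he : e < d) (ε z : ℤ) {k : ℕ} (hk : k ≤ d) : ∃ C : ℕ,
    ∀ (P : MultipointSet d) (q : Fin d → ℝ), Adds P q (sideTerms d e ε z k)
      (C * (P.n + 1) ^ d) (z * P.expect fun B => ∑ j ∈ Finset.range k, ∑ t : Fin j → Fin P.n,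
        if StrictMono t ∧ TupleValid (sideVector (P.offset q) e) (fun s => ε * P.offset q s e) t then
          tupleEvent t
            (TupleViolates (sideVector (P.offset q) e) (fun s => ε * P.offset q s e) t) B
        else 0) := by
  induction k with
  | zero =>
    refine ⟨1, fun P q => (adds_skip P q).mono ?_ (by simp [expect])⟩
    rw [one_mul]
    exact Nat.one_le_pow _ _ (by omega)
  | succ k ih =>
    obtain ⟨C₁, h₁⟩ := ih (by omega)
    obtain ⟨C₂, h₂⟩ := adds_sideTerm he ε z k
    refine ⟨C₁ + C₂, fun P q => ((h₁ P q).seq (h₂ P q)).mono ?_ ?_⟩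
    · rw [add_mul]
      gcongr
      omega
    · rw [← mul_add, ← P.expect_add]
      simp only [Finset.sum_range_succ]

open Classical in
theorem adds_side {e : ℕ} (he : e < d) {ε : ℤ} (hε : ε ≠ 0) (z : ℤ) : ∃ C : ℕ,
    ∀ (P : MultipointSet d) (q : Fin d → ℝ), Generic (P.offset q) (e + 1) →
      Adds P q (sideTerms d e ε z (e + 1)) (C * (P.n + 1) ^ d)
        (z * P.expect fun B => if ClosedSide (P.offset q) e ε B then 1 else 0) := by
  obtain ⟨C, hC⟩ := adds_sideTerms he ε z (k := e + 1) he
  refine ⟨C, fun P q hg => (hC P q).mono le_rfl ?_⟩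
  congr 2
  ext B
  rw [closedSide_indicator hg (by exact_mod_cast hε)]

/-- Adds `z` times the probability that the occupied sites are on one side of the query point in the
first coordinate. -/
def baseLevel (d : ℕ) (z : ℤ) : Program :=
  .seq (addTupleProb d 0 z (.not (.realLt (.lit 0) (coordExpr (.reg 2) 0))))
    (.seq (addTupleProb d 0 z (.not (.realLt (coordExpr (.reg 2) 0) (.lit 0))))
      (addTupleProb d 0 (-z) .true))

open Classical in
-- Each of the three events of `openSide_one_indicator` is elementary with the empty tuple; only the
-- forbidden sites differ.
theorem adds_baseLevel (hd : 0 < d) (z : ℤ) : ∃ C : ℕ,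
    ∀ (P : MultipointSet d) (q : Fin d → ℝ), Adds P q (baseLevel d z) (C * (P.n + 1) ^ d)
      (z * P.expect fun B => if OpenSide (P.offset q) 1 B then 1 else 0) := by
  refine ⟨_, fun P q => ((adds_addTupleProb z (p := fun s => ¬ 0 < P.offset q s 0) ?_).seq
    ((adds_addTupleProb z (p := fun s => ¬ P.offset q s 0 < 0) ?_).seq
      (adds_addTupleProb (-z) (p := fun _ => True) ?_))).mono
      (u := ((Test.not (.realLt (.lit 0) (coordExpr (.reg 2) 0))).cost + 61 +
        ((Test.not (.realLt (coordExpr (.reg 2) 0) (.lit 0))).cost + 61 + (Test.true.cost + 61))) *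
        (P.n + 1) ^ d) ?_ ?_⟩
  · intro s M hM hs
    simp only [Test.Holds, RealExpr.eval, hM.eval_coordExpr (x := .reg 2) hs hd, Int.cast_zero]
  · intro s M hM hs
    simp only [Test.Holds, RealExpr.eval, hM.eval_coordExpr (x := .reg 2) hs hd, Int.cast_zero]
  · exact fun s M _ _ => iff_true_intro (Test.holds_true M)
  · rw [← mul_add, ← mul_add, mul_comm]
    gcongr
    exact Nat.le_self_pow hd.ne' _
  · simp only [openSide_one_indicator, P.expect_add, P.expect_sub]
    have h : ∀ B : Finset (Fin P.n), (∀ s ∈ B, ¬ True) ↔ B = ∅ := fun B => by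
      simp [Finset.eq_empty_iff_forall_notMem]
    have h0 : ∀ p : Fin P.n → Prop, MultipointSet.tupleEvent Fin.elim0 p =
        fun B => if ∀ s ∈ B, ¬ p s then 1 else 0 := fun p => by
      funext B
      simp only [MultipointSet.tupleEvent, IsEmpty.forall_iff, true_and]
    simp only [h0, not_not, h]
    push_cast
    ring

/-- Adds `z` times the probability that the projections of the occupied sites to the first `k + 1`
coordinates lie in an open half-space. -/
def levels (d : ℕ) : ℕ → ℤ → Program
  | 0, z => baseLevel d z
  | k + 1, z => .seq (levels d k (-z))
      (.seq (sideTerms d (k + 1) 1 z (k + 2)) (sideTerms d (k + 1) (-1) z (k + 2)))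

open Classical in
-- Recursion along `openSide_succ_indicator`; the lower level enters with the opposite sign, hence
-- the alternating `z`.
theorem adds_levels {k : ℕ} (hk : k < d) (z : ℤ) : ∃ C : ℕ,
    ∀ (P : MultipointSet d) (q : Fin d → ℝ),
      (∀ i, 2 ≤ i → i ≤ k + 1 → Generic (P.offset q) i) →
      Adds P q (levels d k z) (C * (P.n + 1) ^ d)
        (z * P.expect fun B => if OpenSide (P.offset q) (k + 1) B then 1 else 0) := by
  induction k generalizing z with
  | zero =>
    obtain ⟨C, hC⟩ := adds_baseLevel hk z
    exact ⟨C, fun P q _ => hC P q⟩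
  | succ k ih =>
    obtain ⟨C₁, h₁⟩ := ih (by omega) (-z)
    obtain ⟨C₂, h₂⟩ := adds_side hk one_ne_zero z
    obtain ⟨C₃, h₃⟩ := adds_side hk (ε := -1) (by norm_num) z
    refine ⟨C₁ + (C₂ + C₃), fun P q hg => ?_⟩
    have hg' := hg (k + 2) (by omega) le_rfl
    refine ((h₁ P q fun i hi hik => hg i hi (by omega)).seq
      ((h₂ P q hg').seq (h₃ P q hg'))).mono (le_of_eq (by ring)) ?_
    simp only [openSide_succ_indicator hg', P.expect_add, P.expect_sub]
    push_cast
    ring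

/-! ### Dimension at least three -/

/-- The program for at most one site. -/
def smallProgram (d : ℕ) : Program :=
  .ite (Test.all d fun c => .realEq (coordExpr (.lit 0) c) (.lit 0))
    (.setReal 0 (.lit 0) (.get 1 (.lit 0))) (.setReal 0 (.lit 0) (.lit 0))

/-- The program for points in general position. -/
def genericProgram (d : ℕ) : Program :=
  .ite (.natLt (.reg 0) (.lit 2)) (smallProgram d)
    (.seq (levels d (d - 1) 1) (.setReal 0 (.lit 0) (.sub (.lit 1) (.reg (d + 4)))))

open Classical MultipointSet in
theorem membershipProb_of_small (P : MultipointSet d) (q : Fin d → ℝ) (hn : P.n < 2) :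
    P.membershipProb q = if ∀ c : Fin d, (inputMemory P q).real (2 + c) 0 = q c then
      (inputMemory P q).real 1 0 else 0 := by
  have hM := holdsInput_inputMemory P q
  have hone : P.expect (fun _ => 1) = 1 := by simp [expect, P.sum_outcomeProb]
  rw [P.membershipProb_eq]
  rcases Nat.eq_zero_or_pos P.n with h0 | h0
  -- Without sites the cell read as a probability is zero, so both branches return the right value.
  · have h1 : (inputMemory P q).real 1 0 = 0 := by simp [inputMemory, h0]
    rw [h1, ite_self, sub_eq_zero]
    conv_lhs => rw [← hone]
    congr 1
    ext B
    have : B = ∅ := by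
      ext s
      exact absurd s.2 (by omega)
    simp [this]
  · let s₀ : Fin P.n := ⟨0, h0⟩
    have hs : ∀ s : Fin P.n, s = s₀ := fun s => Fin.ext (by simp only [s₀]; omega)
    have h1 : (inputMemory P q).real 1 0 = P.prob s₀ := hM.prob_eq s₀
    have h2 : ∀ c : Fin d, (inputMemory P q).real (2 + c) 0 = P.site s₀ c := fun c =>
      hM.site_eq c s₀
    simp only [h1, h2, ← funext_iff]
    split_ifs with hq
    · have hB : ∀ B : Finset (Fin P.n),
          (if q ∉ convexHull ℝ (P.site '' (B : Set (Fin P.n))) then 1 else 0 : ℝ) =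
            1 - tupleEvent (fun _ : Fin 1 => s₀) (fun _ => False) B := by
        intro B
        by_cases hsB : s₀ ∈ B
        · have : q ∈ convexHull ℝ (P.site '' (B : Set (Fin P.n))) :=
            subset_convexHull ℝ _ ⟨s₀, hsB, hq⟩
          simp [this, tupleEvent, hsB]
        · have : B = ∅ := by
            ext s
            simp [hs s, hsB]
          simp [this, tupleEvent]
      simp only [hB]
      rw [P.expect_sub, hone, P.expect_tupleEvent (Function.injective_of_subsingleton _)
        fun _ => id]
      simp [tupleProb]
    · rw [sub_eq_zero]
      conv_lhs => rw [← hone]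
      congr 1
      ext B
      rw [if_pos]
      intro hmem
      have hsub : P.site '' (B : Set (Fin P.n)) ⊆ {P.site s₀} := by
        rintro _ ⟨s, -, rfl⟩
        rw [hs s]
        rfl
      have := convexHull_mono hsub hmem
      rw [convexHull_singleton] at this
      exact hq (Set.mem_singleton_iff.1 this).symm

/-- `GeneralPosition.generic` needs two sites, so inputs with fewer are answered directly. -/
theorem exists_computes_of_generalPosition (hd : 3 ≤ d) : ∃ C : ℕ,
    ∀ (P : MultipointSet d) (q : Fin d → ℝ), P.GeneralPosition q →
      ComputesMembershipWithin (genericProgram d) P q (C * (P.n + 1) ^ d) := by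
  classical
  obtain ⟨C, hC⟩ := adds_levels (d := d) (k := d - 1) (by omega) 1
  refine ⟨C + (smallProgram d).cost + 20, fun P q hP => ?_⟩
  have hM := holdsInput_inputMemory P q
  have h1 : 1 ≤ (P.n + 1) ^ d := Nat.one_le_pow _ _ (by omega)
  suffices h : Ends (genericProgram d) (inputMemory P q)
      ((Test.natLt (.reg 0) (.lit 2)).cost + (C * (P.n + 1) ^ d + (smallProgram d).cost + 6) + 1)
      fun M => M.real 0 0 = P.membershipProb q by
    refine h.mono ?_ fun _ _ h => h
    simp only [Test.cost, NatExpr.cost]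
    nlinarith
  refine Ends.ite (fun hn => ?_) (fun hn => ?_)
  · have hn' : P.n < 2 := by simpa [Test.Holds, NatExpr.eval, hM.n_eq] using hn
    refine (Ends.of_loopFree (by simp [smallProgram, Program.LoopFree]) ?_).mono (t := _)
      (Nat.le_trans (Nat.le_add_left _ _) (Nat.le_add_right _ _)) (fun _ _ h => h)
    rw [membershipProb_of_small P q hn']
    simp only [smallProgram, Program.exec, Test.holds_all, Test.holds_realEq, coordExpr,
      RealExpr.eval, NatExpr.eval, hM.query_eq, Int.cast_zero, sub_eq_zero]
    split_ifs <;> simp [Memory.storeReal_real]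
  · have hn' : 2 ≤ P.n := by
      simp only [Test.Holds, NatExpr.eval, hM.n_eq] at hn
      omega
    refine ((hC P q (fun i hi hid => hP.generic hn' hi (by omega)) _ ⟨hM, ?_⟩).seq
      (u := 6) fun M _ h => ?_).mono (by omega) (fun _ _ h => h)
    · intro i
      simp [inputMemory]
    · refine (Ends.of_loopFree (p := .setReal _ _ _) trivial ?_).mono (t := _)
        (by simp [Program.cost, NatExpr.cost, RealExpr.cost]) (fun _ _ h => h)
      have h0 : (inputMemory P q).real (d + 4) 0 = 0 := by
        simp [inputMemory]
      have hk : d - 1 + 1 = d := by omega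
      rw [P.membershipProb_eq]
      simp only [Program.exec, Memory.storeReal_real, NatExpr.eval, RealExpr.eval, if_true,
        Function.update_self, h.2, h0, hk, P.notMem_convexHull_iff]
      simp

end RealRAM

/-! ### Merge sort -/

/-- The values of `f` on the interval `[a, b)`. -/
def listSegment (f : ℕ → ℕ) (a b : ℕ) : List ℕ := (List.range' a (b - a)).map f

theorem listSegment_of_lt {f : ℕ → ℕ} {a b : ℕ} (h : a < b) :
    listSegment f a b = f a :: listSegment f (a + 1) b := by
  rw [listSegment, listSegment, show b - a = (b - (a + 1)) + 1 by omega, List.range'_succ, List.map_cons]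

theorem listSegment_of_le {f : ℕ → ℕ} {a b : ℕ} (h : b ≤ a) : listSegment f a b = [] := by
  rw [listSegment, Nat.sub_eq_zero_of_le h, List.range'_zero, List.map_nil]

theorem listSegment_succ {f : ℕ → ℕ} {a b : ℕ} (h : a ≤ b) :
    listSegment f a (b + 1) = listSegment f a b ++ [f b] := by
  rw [listSegment, listSegment, show b + 1 - a = (b - a) + 1 by omega, List.range'_concat, List.map_append,
    List.map_singleton]
  congr 3
  omega

theorem listSegment_congr {f g : ℕ → ℕ} {a b : ℕ} (h : ∀ k < b, f k = g k) :
    listSegment f a b = listSegment g a b := by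
  refine List.map_congr_left fun k hk => h k ?_
  rw [List.mem_range'_1] at hk
  omega

theorem length_listSegment (f : ℕ → ℕ) (a b : ℕ) : (listSegment f a b).length = b - a := by
  simp [listSegment]

theorem mem_listSegment {f : ℕ → ℕ} {a b x : ℕ} : x ∈ listSegment f a b ↔ ∃ k, a ≤ k ∧ k < b ∧ f k = x := by
  simp only [listSegment, List.mem_map, List.mem_range'_1]
  constructor
  · rintro ⟨k, hk, rfl⟩
    exact ⟨k, by omega, by omega, rfl⟩
  · rintro ⟨k, h₁, h₂, rfl⟩
    exact ⟨k, by omega, rfl⟩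

namespace RealRAM

open Classical in
/-- The comparison function for `List.merge` that belongs to a strict order. -/
noncomputable def notAfter (R : ℕ → ℕ → Prop) (a b : ℕ) : Bool := decide (¬ R b a)

/-- One of the two runs is not exhausted. -/
def mergeTest : Test :=
  .not (.and (.not (.natLt (.reg 14) (.reg 15))) (.not (.natLt (.reg 16) (.reg 17))))

/-- Moves the next element; `less` compares the first elements of the second and the first run. -/
def mergeStep (less : Test) : Program :=
  .seq (.ite (.and (.natLt (.reg 16) (.reg 17)) (.not (.and (.natLt (.reg 14) (.reg 15)) (.not less))))
    (.seq (.setNat 10 (.reg 18) (.get 10 (.reg 16))) (.setNat 16 (.lit 0) (.add (.reg 16) (.lit 1))))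
    (.seq (.setNat 10 (.reg 18) (.get 10 (.reg 14))) (.setNat 14 (.lit 0) (.add (.reg 14) (.lit 1)))))
    (.setNat 18 (.lit 0) (.add (.reg 18) (.lit 1)))

/-- Merges two runs. -/
def mergeLoop (less : Test) : Program := .while mergeTest (mergeStep less)

/-- In all memories that agree with `M` outside the arrays of the sorting program, the test `less`
compares by `R` the elements to which the two pointers refer. -/
def Compares (n : ℕ) (R : ℕ → ℕ → Prop) (less : Test) (M : Memory) : Prop :=
  ∀ M' : Memory, M'.real = M.real → (∀ a, a ≠ 2 → a < 10 ∨ 18 < a → M'.nat a = M.nat a) →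
    M'.nat 10 (M'.nat 16 0) < n → M'.nat 10 (M'.nat 14 0) < n →
      (less.Holds M' ↔ R (M'.nat 10 (M'.nat 16 0)) (M'.nat 10 (M'.nat 14 0)))

theorem Compares.frame {n : ℕ} {R : ℕ → ℕ → Prop} {less : Test} {M M' : Memory} {p : Program}
    (h : Compares n R less M) (hf : Frame p M M') (hr : ∀ a, ¬ p.WritesReal a)
    (hn : ∀ a, p.WritesNat a → a = 2 ∨ (10 ≤ a ∧ a ≤ 18)) : Compares n R less M' := by
  intro M'' h₁ h₂
  refine h M'' (h₁.trans (funext fun a => hf.2 a (hr a))) fun a h2 ha => ?_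
  rw [h₂ a h2 ha]
  exact hf.1 a fun hw => by have := hn a hw; omega

theorem mergeLoop_writesNat {less : Test} {a : ℕ} (h : (mergeLoop less).WritesNat a) :
    a = 10 ∨ a = 14 ∨ a = 16 ∨ a = 18 := by
  simp only [mergeLoop, mergeStep, Program.WritesNat] at h
  tauto

theorem mergeLoop_writesReal {less : Test} {a : ℕ} : ¬ (mergeLoop less).WritesReal a := by
  simp [mergeLoop, mergeStep, Program.WritesReal]

/-- The time in which one element is moved. -/
def mergeCost (less : Test) : ℕ := mergeTest.cost + (mergeStep less).cost + 1

/-- Output is written above both input runs, which therefore stay intact. The invariant is that the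
output so far followed by the merge of the two rests is the full merge; the time is counted by the
elements still to be moved. -/
theorem ends_mergeLoop {n : ℕ} {R : ℕ → ℕ → Prop} {less : Test} {M : Memory}
    (hless : Compares n R less M) {i ie j je top : ℕ} (hi : M.nat 14 0 = i) (hie : M.nat 15 0 = ie)
    (hj : M.nat 16 0 = j) (hje : M.nat 17 0 = je) (htop : M.nat 18 0 = top) (hile : i ≤ ie)
    (hjle : j ≤ je) (hietop : ie ≤ top) (hjetop : je ≤ top)
    (hin : ∀ k, i ≤ k → k < ie → M.nat 10 k < n) (hjn : ∀ k, j ≤ k → k < je → M.nat 10 k < n) :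
    Ends (mergeLoop less) M ((ie - i + (je - j)) * mergeCost less + (mergeTest.cost + 1)) fun M' =>
      M'.nat 18 0 = top + (ie - i) + (je - j) ∧ (∀ k < top, M'.nat 10 k = M.nat 10 k) ∧
        listSegment (M'.nat 10) top (M'.nat 18 0) =
          (listSegment (M.nat 10) i ie).merge (listSegment (M.nat 10) j je) (notAfter R) := by
  refine Ends.while (I := fun t M' => Frame (mergeLoop less) M M' ∧ ∃ i' j' top',
    M'.nat 14 0 = i' ∧ M'.nat 16 0 = j' ∧ M'.nat 18 0 = top' ∧ i ≤ i' ∧ i' ≤ ie ∧ j ≤ j' ∧ j' ≤ je ∧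
    top' + (ie - i') + (je - j') = top + (ie - i) + (je - j) ∧ top ≤ top' ∧
    t = (ie - i' + (je - j')) * mergeCost less + (mergeTest.cost + 1) ∧
    (∀ k < top, M'.nat 10 k = M.nat 10 k) ∧
    listSegment (M'.nat 10) top top' ++
      (listSegment (M.nat 10) i' ie).merge (listSegment (M.nat 10) j' je) (notAfter R) =
        (listSegment (M.nat 10) i ie).merge (listSegment (M.nat 10) j je) (notAfter R)) ?_
    ⟨Frame.rfl, i, j, top, hi, hj, htop, le_rfl, hile, le_rfl, hjle, rfl, le_rfl, rfl,
      fun _ _ => rfl, by rw [listSegment_of_le le_rfl, List.nil_append]⟩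
  rintro t M' ⟨hf, i', j', top', hi', hj', htop', hii', hi'e, hjj', hj'e, htt, htop'le, rfl, hold,
    hmerge⟩
  have hie' : M'.nat 15 0 = ie := by
    rw [hf.1 15 fun h => by have := mergeLoop_writesNat h; omega, hie]
  have hje' : M'.nat 17 0 = je := by
    rw [hf.1 17 fun h => by have := mergeLoop_writesNat h; omega, hje]
  by_cases hdone : i' = ie ∧ j' = je
  · obtain ⟨rfl, rfl⟩ := hdone
    refine .inl ⟨?_, ?_, ?_, hold, ?_⟩
    · simp [mergeTest, Test.Holds, NatExpr.eval, hi', hie', hj', hje']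
    · omega
    · rw [htop']; omega
    · rw [htop', ← hmerge, listSegment_of_le le_rfl, listSegment_of_le le_rfl, List.nil_merge,
        List.append_nil]
  · refine .inr ⟨?_, (mergeStep less).cost,
      (ie - i' + (je - j') - 1) * mergeCost less + (mergeTest.cost + 1), ?_, ?_⟩
    · simp only [mergeTest, Test.Holds, NatExpr.eval, hi', hie', hj', hje']
      omega
    · obtain ⟨r, hr⟩ : ∃ r, ie - i' + (je - j') = r + 1 := ⟨ie - i' + (je - j') - 1, by omega⟩
      rw [hr, Nat.add_sub_cancel, add_mul, one_mul, mergeCost]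
      omega
    · have hcmp : i' < ie → j' < je → (less.Holds M' ↔ R (M.nat 10 j') (M.nat 10 i')) := by
        intro h₁ h₂
        have e₁ := hold i' (by omega)
        have e₂ := hold j' (by omega)
        have := hless M' (funext fun a => hf.2 a mergeLoop_writesReal) (fun a _ ha =>
          hf.1 a fun h => by have := mergeLoop_writesNat h; omega)
        rw [hi', hj', e₁, e₂] at this
        exact this (hjn _ hjj' h₂) (hin _ hii' h₁)
      have htest : (Test.and (.natLt (.reg 16) (.reg 17)) (.not (.and (.natLt (.reg 14) (.reg 15))
          (.not less)))).Holds M' ↔ j' < je ∧ (i' < ie → R (M.nat 10 j') (M.nat 10 i')) := by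
        simp only [Test.Holds, NatExpr.eval, hi', hie', hj', hje', not_and, not_not]
        exact and_congr_right fun h₂ => forall_congr' fun h₁ => hcmp h₁ h₂
      have hframe : ∀ M'', Frame (mergeStep less) M' M'' → Frame (mergeLoop less) M M'' :=
        fun M'' hf' => ⟨fun a ha => (hf'.1 a ha).trans (hf.1 a ha),
          fun a ha => (hf'.2 a ha).trans (hf.2 a ha)⟩
      by_cases hright : j' < je ∧ (i' < ie → R (M.nat 10 j') (M.nat 10 i'))
      · refine (Ends.of_loopFree (Q := (· = (mergeStep less).exec M'))
          (by simp [mergeStep, Program.LoopFree]) rfl).imp ?_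
        rintro M'' hf' rfl
        have hx : (mergeStep less).exec M' = ((M'.storeNat 10 top' (M'.nat 10 j')).storeNat 16 0
            (j' + 1)).storeNat 18 0 (top' + 1) := by
          simp only [mergeStep, Program.exec]
          rw [if_pos (htest.2 hright)]
          simp [NatExpr.eval, Memory.storeNat_nat, htop', hj']
        have hval : M'.nat 10 j' = M.nat 10 j' := hold j' (by omega)
        refine ⟨hframe _ hf', i', j' + 1, top' + 1, ?_, ?_, ?_, hii', hi'e, by omega, hright.1,
          by omega, by omega, ?_, ?_, ?_⟩
        · simp [hx, Memory.storeNat_nat, hi']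
        · simp [hx, Memory.storeNat_nat]
        · simp [hx, Memory.storeNat_nat]
        · congr 2
          omega
        · intro k hk
          rw [hx]
          simp [Memory.storeNat_nat, Function.update_of_ne (show k ≠ top' by omega), hold k hk]
        · have h10 : ((mergeStep less).exec M').nat 10 =
              Function.update (M'.nat 10) top' (M.nat 10 j') := by
            rw [hx]; simp [Memory.storeNat_nat, hval]
          rw [← hmerge, h10, listSegment_succ htop'le, Function.update_self,
            listSegment_congr (g := M'.nat 10) fun k hk => Function.update_of_ne (by omega) _ _,
            List.append_assoc]
          congr 1
          rw [listSegment_of_lt (a := j') hright.1]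
          by_cases hii : i' < ie
          · rw [listSegment_of_lt hii, List.cons_merge_cons_neg]
            · rfl
            · simpa [notAfter] using hright.2 hii
          · rw [listSegment_of_le (not_lt.1 hii), List.nil_merge, List.nil_merge]
            rfl
      · have hii : i' < ie := by
          by_contra h
          exact hright ⟨by omega, fun h' => (h h').elim⟩
        refine (Ends.of_loopFree (Q := (· = (mergeStep less).exec M'))
          (by simp [mergeStep, Program.LoopFree]) rfl).imp ?_
        rintro M'' hf' rfl
        have hx : (mergeStep less).exec M' = ((M'.storeNat 10 top' (M'.nat 10 i')).storeNat 14 0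
            (i' + 1)).storeNat 18 0 (top' + 1) := by
          simp only [mergeStep, Program.exec]
          rw [if_neg fun h => hright (htest.1 h)]
          simp [NatExpr.eval, Memory.storeNat_nat, htop', hi']
        have hval : M'.nat 10 i' = M.nat 10 i' := hold i' (by omega)
        refine ⟨hframe _ hf', i' + 1, j', top' + 1, ?_, ?_, ?_, by omega, hii, hjj', hj'e,
          by omega, by omega, ?_, ?_, ?_⟩
        · simp [hx, Memory.storeNat_nat]
        · simp [hx, Memory.storeNat_nat, hj']
        · simp [hx, Memory.storeNat_nat]
        · congr 2
          omega
        · intro k hk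
          rw [hx]
          simp [Memory.storeNat_nat, Function.update_of_ne (show k ≠ top' by omega), hold k hk]
        · have h10 : ((mergeStep less).exec M').nat 10 =
              Function.update (M'.nat 10) top' (M.nat 10 i') := by
            rw [hx]; simp [Memory.storeNat_nat, hval]
          rw [← hmerge, h10, listSegment_succ htop'le, Function.update_self,
            listSegment_congr (g := M'.nat 10) fun k hk => Function.update_of_ne (by omega) _ _,
            List.append_assoc]
          congr 1
          rw [listSegment_of_lt (a := i') hii]
          by_cases hjj : j' < je
          · rw [listSegment_of_lt hjj, List.cons_merge_cons_pos]
            · rfl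
            · simp only [notAfter, decide_eq_true_eq]
              exact fun h => hright ⟨hjj, fun _ => h⟩
          · rw [listSegment_of_le (not_lt.1 hjj), List.merge_right, List.merge_right]
            rfl

/-- Sets up the leaves of the merge tree, which are the nodes from `n` to `2 * n - 1`. -/
def sortInit : Program :=
  .seq (forSites 2 (.seq (.setNat 10 (.reg 2) (.reg 2)) (.seq
    (.setNat 11 (.add (.reg 0) (.reg 2)) (.reg 2))
    (.setNat 12 (.add (.reg 0) (.reg 2)) (.add (.reg 2) (.lit 1))))))
    (.seq (.setNat 18 (.lit 0) (.reg 0)) (.setNat 13 (.lit 0) (.reg 0)))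

/-- Prepares the merging of the children of the next node. -/
def nodePrepare : Program :=
  .seq (.setNat 13 (.lit 0) (.sub (.reg 13) (.lit 1)))
    (.seq (.setNat 14 (.lit 0) (.get 11 (.add (.reg 13) (.reg 13))))
    (.seq (.setNat 15 (.lit 0) (.get 12 (.add (.reg 13) (.reg 13))))
    (.seq (.setNat 16 (.lit 0) (.get 11 (.add (.add (.reg 13) (.reg 13)) (.lit 1))))
    (.seq (.setNat 17 (.lit 0) (.get 12 (.add (.add (.reg 13) (.reg 13)) (.lit 1))))
    (.setNat 11 (.reg 13) (.reg 18))))))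

/-- Forms the run of the next node. -/
def nodeStep (less : Test) : Program :=
  .seq nodePrepare (.seq (mergeLoop less) (.setNat 12 (.reg 13) (.reg 18)))

/-- Sorts the sites. -/
def sortProgram (less : Test) : Program :=
  .seq sortInit (.while (.natLt (.lit 1) (.reg 13)) (nodeStep less))

theorem nodeStep_writesNat {less : Test} {a : ℕ} (h : (nodeStep less).WritesNat a) :
    10 ≤ a ∧ a ≤ 18 := by
  simp only [nodeStep, nodePrepare, Program.WritesNat] at h
  rcases h with h | h | h
  · omega
  · have := mergeLoop_writesNat h
    omega
  · omega

theorem nodeStep_writesReal {less : Test} {a : ℕ} : ¬ (nodeStep less).WritesReal a := by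
  simp [nodeStep, nodePrepare, Program.WritesReal, mergeLoop_writesReal]

/-- The run of the node `u` of the merge tree. -/
def runOf (M : Memory) (u : ℕ) : List ℕ := listSegment (M.nat 10) (M.nat 11 u) (M.nat 12 u)

/-- All nodes from `v` on have been processed. -/
structure SortState (n : ℕ) (R : ℕ → ℕ → Prop) (v : ℕ) (M : Memory) : Prop where
  node : M.nat 13 0 = v
  run_le : ∀ u, v ≤ u → u < 2 * v → M.nat 11 u ≤ M.nat 12 u
  le_top : ∀ u, v ≤ u → u < 2 * v → M.nat 12 u ≤ M.nat 18 0
  sorted : ∀ u, v ≤ u → u < 2 * v → (runOf M u).Pairwise fun a b => notAfter R a b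
  sum_eq : ∑ u ∈ Finset.Ico v (2 * v), (runOf M u : Multiset ℕ) = (List.range n : Multiset ℕ)

/-- The number of moves of elements that remain. -/
def movesLeft (v : ℕ) (M : Memory) : ℕ :=
  ∑ u ∈ Finset.Ico v (2 * v), (runOf M u).length * Nat.log 2 u

/-- The nodes from `v` to `2 * v - 1` form a cut of the merge tree. Passing from `v + 1` to `v`
replaces the children `2 * v` and `2 * v + 1` by their parent. -/
theorem sum_Ico_children {α : Type*} [AddCommMonoid α] (f : ℕ → α) {v : ℕ} (hv : 1 ≤ v) :
    ∑ u ∈ Finset.Ico (v + 1) (2 * (v + 1)), f u =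
      ∑ u ∈ Finset.Ico (v + 1) (2 * v), f u + (f (2 * v) + f (2 * v + 1)) := by
  rw [show 2 * (v + 1) = 2 * v + 1 + 1 by omega, Finset.sum_Ico_succ_top (by omega),
    Finset.sum_Ico_succ_top (by omega), add_assoc]

/-- The depth `Nat.log 2` drops by one for exactly the elements that are moved, so `movesLeft`
decreases by the number of moves and pays for the merge. -/
theorem SortState.ends_nodeStep {n : ℕ} {R : ℕ → ℕ → Prop} {less : Test} {M : Memory} {v : ℕ}
    (htrans : ∀ a b c, notAfter R a b → notAfter R b c → notAfter R a c)
    (htotal : ∀ a b, notAfter R a b || notAfter R b a)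
    (hless : Compares n R less M) (hv : 1 ≤ v) (h : SortState n R (v + 1) M) :
    ∃ k, Ends (nodeStep less) M (k * mergeCost less + (mergeTest.cost + 60)) fun M' =>
      SortState n R v M' ∧ movesLeft v M' + k = movesLeft (v + 1) M := by
  set i := M.nat 11 (2 * v) with hi
  set ie := M.nat 12 (2 * v) with hie
  set j := M.nat 11 (2 * v + 1) with hj
  set je := M.nat 12 (2 * v + 1) with hje
  set top := M.nat 18 0 with htop
  have hi1 := h.run_le (2 * v) (by omega) (by omega)
  have hi2 := h.le_top (2 * v) (by omega) (by omega)
  have hj1 := h.run_le (2 * v + 1) (by omega) (by omega)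
  have hj2 := h.le_top (2 * v + 1) (by omega) (by omega)
  rw [← hi, ← hie] at hi1
  rw [← hie, ← htop] at hi2
  rw [← hj, ← hje] at hj1
  rw [← hje, ← htop] at hj2
  have hlt : ∀ u, v + 1 ≤ u → u < 2 * (v + 1) → ∀ x ∈ runOf M u, x < n := by
    intro u h₁ h₂ x hx
    have : x ∈ ∑ u ∈ Finset.Ico (v + 1) (2 * (v + 1)), (runOf M u : Multiset ℕ) :=
      Multiset.mem_sum.2 ⟨u, Finset.mem_Ico.2 ⟨h₁, h₂⟩, hx⟩
    rw [h.sum_eq] at this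
    simpa using this
  refine ⟨ie - i + (je - j), ?_⟩
  refine (Ends.seq (p := nodePrepare) (t := nodePrepare.cost)
    (R := fun M₁ => M₁.nat 13 0 = v ∧ M₁.nat 14 0 = i ∧ M₁.nat 15 0 = ie ∧ M₁.nat 16 0 = j ∧
      M₁.nat 17 0 = je ∧ M₁.nat 11 = Function.update (M.nat 11) v top) (u := (ie - i + (je - j)) *
        mergeCost less + (mergeTest.cost + 1) + 5) ?_ ?_).mono ?_ (fun _ _ h => h)
  · refine Ends.of_loopFree (by simp [nodePrepare, Program.LoopFree]) ?_
    have e₁ : v + v = 2 * v := by omega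
    simp [nodePrepare, Program.exec, NatExpr.eval, Memory.storeNat_nat, h.node, hi, hie, hj, hje,
      htop, e₁]
  · rintro M₁ hf₁ ⟨h13, h14, h15, h16, h17, h11⟩
    have h10 : M₁.nat 10 = M.nat 10 := hf₁.1 10 (by simp [nodePrepare, Program.WritesNat])
    have h12 : M₁.nat 12 = M.nat 12 := hf₁.1 12 (by simp [nodePrepare, Program.WritesNat])
    have h18 : M₁.nat 18 0 = top := by
      rw [hf₁.1 18 (by simp [nodePrepare, Program.WritesNat])]
    have hless₁ : Compares n R less M₁ := hless.frame hf₁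
      (by simp [nodePrepare, Program.WritesReal])
      (fun a ha => by simp only [nodePrepare, Program.WritesNat] at ha; omega)
    refine Ends.seq (ends_mergeLoop hless₁ h14 h15 h16 h17 h18 hi1 hj1 hi2 hj2 ?_ ?_) ?_
    · intro k h₁ h₂
      exact hlt (2 * v) (by omega) (by omega) _ (mem_listSegment.2 ⟨k, h₁, h₂, by rw [h10]⟩)
    · intro k h₁ h₂
      exact hlt (2 * v + 1) (by omega) (by omega) _ (mem_listSegment.2 ⟨k, h₁, h₂, by rw [h10]⟩)
    · rintro M₂ hf₂ ⟨h18', hold, hmerge⟩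
      have h13' : M₂.nat 13 0 = v := by
        rw [hf₂.1 13 fun h => by have := mergeLoop_writesNat h; omega, h13]
      have h11' : M₂.nat 11 = Function.update (M.nat 11) v top := by
        rw [hf₂.1 11 fun h => by have := mergeLoop_writesNat h; omega, h11]
      have h12' : M₂.nat 12 = M.nat 12 := by
        rw [hf₂.1 12 fun h => by have := mergeLoop_writesNat h; omega, h12]
      refine (Ends.of_loopFree (p := .setNat 12 (.reg 13) (.reg 18)) trivial
        (Q := (· = M₂.storeNat 12 v (M₂.nat 18 0))) (by
          simp [Program.exec, NatExpr.eval, h13'])).mono (t := _)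
        (by simp [Program.cost, NatExpr.cost]) ?_
      rintro M₃ - rfl
      rw [h10] at hold hmerge
      have hrun_v : runOf (M₂.storeNat 12 v (M₂.nat 18 0)) v =
          (runOf M (2 * v)).merge (runOf M (2 * v + 1)) (notAfter R) := by
        simp [runOf, Memory.storeNat_nat, h11', hmerge, hi, hie, hj, hje]
      have hrun : ∀ u, v < u → u < 2 * v → runOf (M₂.storeNat 12 v (M₂.nat 18 0)) u = runOf M u := by
        intro u h₁ h₂
        have := h.le_top u (by omega) (by omega)
        have hne : u ≠ v := by omega
        simp only [runOf, Memory.storeNat_nat, h11', h12', if_true, Function.update_of_ne hne]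
        simp only [Nat.reduceEqDiff, if_false, Function.update_of_ne hne]
        exact listSegment_congr fun k hk => hold k (by omega)
      refine ⟨⟨?_, ?_, ?_, ?_, ?_⟩, ?_⟩
      · simp [Memory.storeNat_nat, h13']
      · intro u h₁ h₂
        rcases h₁.eq_or_lt with rfl | h₁
        · simp [Memory.storeNat_nat, h11', h18']
          omega
        · have := h.run_le u (by omega) (by omega)
          have hne : u ≠ v := by omega
          simpa [Memory.storeNat_nat, h11', h12', Function.update_of_ne hne] using this
      · intro u h₁ h₂
        rcases h₁.eq_or_lt with rfl | h₁
        · simp [Memory.storeNat_nat]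
        · have := h.le_top u (by omega) (by omega)
          have hne : u ≠ v := by omega
          simp only [Memory.storeNat_nat, h12', if_true, Function.update_of_ne hne, h18']
          simp
          omega
      · intro u h₁ h₂
        rcases h₁.eq_or_lt with rfl | h₁
        · rw [hrun_v]
          exact List.pairwise_merge htrans htotal _ _ (h.sorted _ (by omega) (by omega))
            (h.sorted _ (by omega) (by omega))
        · rw [hrun u h₁ h₂]
          exact h.sorted u (by omega) (by omega)
      · rw [← h.sum_eq, sum_Ico_children _ hv, Finset.sum_eq_sum_Ico_succ_bot (by omega), hrun_v,
          add_comm]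
        congr 1
        · refine Finset.sum_congr rfl fun u hu => ?_
          rw [Finset.mem_Ico] at hu
          rw [hrun u (by omega) hu.2]
        · rw [Multiset.coe_add]
          exact Multiset.coe_eq_coe.2 (List.merge_perm_append _)
      · rw [movesLeft, movesLeft, sum_Ico_children _ hv, Finset.sum_eq_sum_Ico_succ_bot (by omega),
          hrun_v, List.length_merge]
        have hlog₁ : Nat.log 2 (2 * v) = Nat.log 2 v + 1 := by
          rw [mul_comm, Nat.log_mul_base (by omega) (by omega)]
        have hlog₂ : Nat.log 2 (2 * v + 1) = Nat.log 2 v + 1 := by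
          rw [← Nat.log_div_mul_self 2 (2 * v + 1), show (2 * v + 1) / 2 = v by omega,
            Nat.log_mul_base (by omega) (by omega)]
        have hl₁ : (runOf M (2 * v)).length = ie - i := length_listSegment _ _ _
        have hl₂ : (runOf M (2 * v + 1)).length = je - j := length_listSegment _ _ _
        rw [hlog₁, hlog₂, hl₁, hl₂, Finset.sum_congr rfl (g := fun u =>
          (runOf M u).length * Nat.log 2 u)]
        · ring
        · intro u hu
          rw [Finset.mem_Ico] at hu
          rw [hrun u (by omega) hu.2]
  · simp only [nodePrepare, Program.cost, NatExpr.cost]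
    omega

/-- The leaves are numbered below `2 * n`, which bounds the depth and thereby the number of moves;
`n` need not be a power of two. -/
theorem ends_sortInit {n : ℕ} (R : ℕ → ℕ → Prop) {M : Memory} (hn : M.nat 0 0 = n) :
    Ends sortInit M (n * 35 + 17) fun M' =>
      SortState n R n M' ∧ movesLeft n M' ≤ n * Nat.log 2 (2 * n) := by
  refine (Ends.seq (Ends.forSites (n := n) (c := 23) (I := fun k M' => ∀ x < k, M'.nat 10 x = x ∧
    M'.nat 11 (n + x) = x ∧ M'.nat 12 (n + x) = x + 1) (by simp) (by simp [Program.WritesNat])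
    (by simp [Program.WritesNat]) hn ?_ (by simp) ?_) (u := 8) ?_).mono (by omega) fun _ _ h => h
  · intro k M' v h
    simpa [Memory.storeNat_nat] using h
  · intro k hk M' hf hx hI
    have hn' : M'.nat 0 0 = n := by
      rw [hf.1 0 (by simp [Program.WritesNat]), hn]
    refine Ends.of_loopFree (by simp [Program.LoopFree]) fun x hxk => ?_
    simp only [Program.exec, NatExpr.eval, Memory.storeNat_nat]
    rcases Nat.lt_succ_iff_lt_or_eq.1 hxk with h | rfl
    · have := hI x h
      simpa [hx, hn', Function.update_of_ne (show x ≠ k by omega),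
        Function.update_of_ne (show n + x ≠ n + k by omega)] using this
    · simp [hx, hn']
  · intro M₁ hf₁ hI
    have hn₁ : M₁.nat 0 0 = n := by
      rw [hf₁.1 0 (by simp [Program.WritesNat]), hn]
    refine (Ends.of_loopFree (p := .seq (.setNat 18 (.lit 0) (.reg 0)) (.setNat 13 (.lit 0) (.reg 0)))
      ⟨trivial, trivial⟩ (Q := (· = (M₁.storeNat 18 0 n).storeNat 13 0 n)) (by
        simp [Program.exec, NatExpr.eval, hn₁, Memory.storeNat_nat])).imp ?_
    rintro M₂ - rfl
    have h11 : ∀ x < n, ((M₁.storeNat 18 0 n).storeNat 13 0 n).nat 11 (n + x) = x := fun x hx => by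
      simpa [Memory.storeNat_nat] using (hI x hx).2.1
    have h12 : ∀ x < n, ((M₁.storeNat 18 0 n).storeNat 13 0 n).nat 12 (n + x) = x + 1 :=
      fun x hx => by simpa [Memory.storeNat_nat] using (hI x hx).2.2
    have hrun : ∀ x < n, runOf ((M₁.storeNat 18 0 n).storeNat 13 0 n) (n + x) = [x] := by
      intro x hx
      rw [runOf, h11 x hx, h12 x hx, listSegment_of_lt (Nat.lt_succ_self x),
        listSegment_of_le le_rfl]
      simpa [Memory.storeNat_nat] using (hI x hx).1
    have hu : ∀ u, n ≤ u → u < 2 * n → ∃ x < n, u = n + x := fun u h₁ h₂ =>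
      ⟨u - n, by omega, by omega⟩
    refine ⟨⟨?_, ?_, ?_, ?_, ?_⟩, ?_⟩
    · simp [Memory.storeNat_nat]
    · intro u h₁ h₂
      obtain ⟨x, hx, rfl⟩ := hu u h₁ h₂
      rw [h11 x hx, h12 x hx]
      omega
    · intro u h₁ h₂
      obtain ⟨x, hx, rfl⟩ := hu u h₁ h₂
      rw [h12 x hx]
      simpa [Memory.storeNat_nat] using hx
    · intro u h₁ h₂
      obtain ⟨x, hx, rfl⟩ := hu u h₁ h₂
      rw [hrun x hx]
      exact List.pairwise_singleton _ _
    · rw [Finset.sum_Ico_eq_sum_range, show 2 * n - n = n by omega,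
        Finset.sum_congr rfl (g := fun x => ({x} : Multiset ℕ))]
      · exact Finset.sum_multiset_singleton (Finset.range n)
      · intro x hx
        rw [hrun x (Finset.mem_range.1 hx)]
        rfl
    · rw [movesLeft]
      refine (Finset.sum_le_card_nsmul _ _ (Nat.log 2 (2 * n)) fun u hu' => ?_).trans ?_
      · rw [Finset.mem_Ico] at hu'
        obtain ⟨x, hx, rfl⟩ := hu u hu'.1 hu'.2
        rw [hrun x hx, List.length_singleton, one_mul]
        exact Nat.log_mono_right (by omega)
      · rw [Nat.card_Ico, smul_eq_mul, show 2 * n - n = n by omega]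

theorem sortProgram_writesNat {less : Test} {a : ℕ} (h : (sortProgram less).WritesNat a) :
    a = 2 ∨ (10 ≤ a ∧ a ≤ 18) := by
  simp only [sortProgram, sortInit, Program.WritesNat, forSites_writesNat] at h
  rcases h with h | h
  · omega
  · exact .inr (nodeStep_writesNat h)

theorem sortProgram_writesReal {less : Test} {a : ℕ} : ¬ (sortProgram less).WritesReal a := by
  simp [sortProgram, sortInit, Program.WritesReal, nodeStep_writesReal]

/-- The `k`-th site in the order that the sorting program has found. -/
def sortedSite (M : Memory) (k : ℕ) : ℕ := M.nat 10 (M.nat 11 1 + k)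

/-- An upper bound for the running time of the sorting program. -/
def sortTime (less : Test) (n : ℕ) : ℕ :=
  n * (Nat.log 2 (2 * n) * mergeCost less + (mergeTest.cost + 130)) + 30

theorem ends_sortProgram {n : ℕ} {R : ℕ → ℕ → Prop} {less : Test} {M : Memory}
    (htrans : ∀ a b c, notAfter R a b → notAfter R b c → notAfter R a c)
    (htotal : ∀ a b, notAfter R a b || notAfter R b a)
    (hless : Compares n R less M) (hn : M.nat 0 0 = n) :
    Ends (sortProgram less) M (sortTime less n) fun M' =>
      ((List.range n).map (sortedSite M')).Perm (List.range n) ∧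
        ∀ i j, i < j → j < n → ¬ R (sortedSite M' j) (sortedSite M' i) := by
  set c := mergeTest.cost + 60 + 5 with hc
  refine (Ends.seq (ends_sortInit R hn) (u := n * Nat.log 2 (2 * n) * mergeCost less + n * c + 5)
    ?_).mono ?_ fun _ _ h => h
  · rintro M₁ hf₁ ⟨hS, hmoves⟩
    have hless₁ : Compares n R less M₁ := hless.frame hf₁ (by simp [sortInit, Program.WritesReal])
      (fun a ha => by
        simp only [sortInit, Program.WritesNat, forSites_writesNat] at ha
        omega)
    -- The loop normally stops at the root `1`; node `0` occurs only if there are no sites at all.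
    -- Each node gets a fixed allowance `c` besides its moves.
    refine (Ends.while (I := fun t M' => ∃ v, SortState n R v M' ∧ Compares n R less M' ∧
      (v = 0 → n = 0) ∧ t = movesLeft v M' * mergeCost less + v * c + 5) ?_
      ⟨n, hS, hless₁, id, rfl⟩).mono (by gcongr) fun _ _ h => h
    rintro t M' ⟨v, hv, hcmp, hv0, rfl⟩
    by_cases h1 : 1 < v
    · refine .inr ⟨by simpa [Test.Holds, NatExpr.eval, hv.node] using h1, ?_⟩
      obtain ⟨w, rfl⟩ : ∃ w, v = w + 1 := ⟨v - 1, by omega⟩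
      obtain ⟨k, hk⟩ := hv.ends_nodeStep htrans htotal hcmp (by omega)
      refine ⟨k * mergeCost less + (mergeTest.cost + 60),
        (movesLeft (w + 1) M' - k) * mergeCost less + w * c + 5, ?_, hk.imp ?_⟩
      · have hkle : k ≤ movesLeft (w + 1) M' := by
          obtain ⟨_, _, _, _, _, h⟩ := hk
          omega
        obtain ⟨r, hr⟩ := Nat.exists_eq_add_of_le hkle
        rw [hr, Nat.add_sub_cancel_left]
        simp only [Test.cost, NatExpr.cost, hc]
        ring_nf
        omega
      · rintro M'' hf'' ⟨h₁, h₂⟩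
        exact ⟨w, h₁, hcmp.frame hf'' (fun _ => nodeStep_writesReal)
          (fun a ha => .inr (nodeStep_writesNat ha)), by omega, by rw [← h₂, Nat.add_sub_cancel]⟩
    · refine .inl ⟨by simpa [Test.Holds, NatExpr.eval, hv.node] using h1,
        by simp only [Test.cost, NatExpr.cost]; omega, ?_⟩
      rcases Nat.eq_zero_or_pos v with h0 | h0
      · obtain rfl := hv0 h0
        simp
      · obtain rfl : v = 1 := by omega
        have hperm : (runOf M' 1).Perm (List.range n) := by
          have := hv.sum_eq
          simpa using this
        have hlen := hperm.length_eq
        rw [List.length_range, runOf, length_listSegment] at hlen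
        have hmap : (List.range n).map (sortedSite M') = runOf M' 1 := by
          rw [runOf, listSegment, hlen, List.range'_eq_map_range, List.map_map]
          rfl
        refine ⟨hmap ▸ hperm, fun i j hij hj => ?_⟩
        have hsort := hv.sorted 1 le_rfl (by omega)
        rw [← hmap, List.pairwise_iff_getElem] at hsort
        have := hsort i j (by simp; omega) (by simpa using hj) hij
        simpa [notAfter] using this
  · rw [sortTime, hc]
    ring_nf
    omega

end RealRAM

/-! ### The plane: directions of lines through the query point -/

section Plane

/-- The vector `(x, y)` has an angle in the interval `[0, π)`. -/
def Upper (x y : ℝ) : Prop := 0 < y ∨ (y = 0 ∧ 0 < x)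

/-- The cross product of two vectors in the plane. -/
def cross (a b : ℝ × ℝ) : ℝ := a.1 * b.2 - a.2 * b.1

theorem cross_antisymm (a b : ℝ × ℝ) : cross a b = -cross b a := by rw [cross, cross]; ring

/-- Within `[0, π)` the sign of the cross product compares angles, which makes it transitive. The
identity `key` proves this if `b` is off the horizontal axis. -/
theorem cross_trans {a b c : ℝ × ℝ} (ha : Upper a.1 a.2) (hb : Upper b.1 b.2) (hc : Upper c.1 c.2)
    (hab : 0 ≤ cross a b) (hbc : 0 ≤ cross b c) :
    0 ≤ cross a c ∧ (0 < cross a b ∨ 0 < cross b c → 0 < cross a c) := by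
  obtain ⟨a₁, a₂⟩ := a
  obtain ⟨b₁, b₂⟩ := b
  obtain ⟨c₁, c₂⟩ := c
  simp only [Upper, cross] at *
  have key : b₂ * (a₁ * c₂ - a₂ * c₁) = a₂ * (b₁ * c₂ - b₂ * c₁) + c₂ * (a₁ * b₂ - a₂ * b₁) := by
    ring
  rcases hb with hb | ⟨rfl, hb⟩
  · rcases hc with hc | ⟨rfl, hc⟩
    · rcases ha with ha | ⟨rfl, ha⟩
      · constructor
        · refine nonneg_of_mul_nonneg_right ?_ hb
          rw [key]
          positivity
        · intro h
          refine pos_of_mul_pos_right (a := b₂) ?_ hb.le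
          rw [key]
          rcases h with h | h <;> positivity
      · have : 0 < a₁ * c₂ := mul_pos ha hc
        constructor
        · linarith
        · intro; linarith
    · have : 0 < b₂ * c₁ := mul_pos hb hc
      linarith
  · rcases ha with ha | ⟨rfl, ha⟩
    · have : 0 < a₂ * b₁ := mul_pos ha hb
      linarith
    · have hc0 : 0 ≤ c₂ := by
        by_contra h
        have := mul_pos hb (neg_pos.2 (not_le.1 h))
        linarith
      constructor
      · have := mul_nonneg ha.le hc0
        linarith
      · rintro (h | h)
        · simp at h
        · have h' : 0 < b₁ * c₂ := by linarith
          have := mul_pos ha ((mul_pos_iff_of_pos_left hb).1 h')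
          linarith

variable {n : ℕ}

open Classical in
/-- The class of a vector: `1` for the angles in `[0, π)`, `2` for those in `[π, 2 * π)`, `0` for the
zero vector. -/
noncomputable def angleClass (v : Fin n → ℕ → ℝ) (s : Fin n) : ℕ :=
  if Upper (v s 0) (v s 1) then 1 else if Upper (-v s 0) (-v s 1) then 2 else 0

open Classical in
/-- The direction of the line that is spanned by a vector. -/
noncomputable def direction (v : Fin n → ℕ → ℝ) (s : Fin n) : ℝ × ℝ :=
  if Upper (v s 0) (v s 1) then (v s 0, v s 1)
  -- The zero vector receives an arbitrary upper direction, so that the order laws hold for every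
  -- site.
  else if Upper (-v s 0) (-v s 1) then (-v s 0, -v s 1) else (1, 0)

theorem upper_direction (v : Fin n → ℕ → ℝ) (s : Fin n) :
    Upper (direction v s).1 (direction v s).2 := by
  unfold direction
  split_ifs with h₁ h₂
  · exact h₁
  · exact h₂
  · exact .inr ⟨rfl, one_pos⟩

theorem angleClass_cases (v : Fin n → ℕ → ℝ) (s : Fin n) :
    (angleClass v s = 1 ∧ direction v s = (v s 0, v s 1)) ∨
      (angleClass v s = 2 ∧ direction v s = (-v s 0, -v s 1)) ∨
      (angleClass v s = 0 ∧ v s 0 = 0 ∧ v s 1 = 0) := by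
  unfold angleClass direction
  split_ifs with h₁ h₂
  · simp
  · simp
  · refine .inr (.inr ⟨rfl, ?_⟩)
    simp only [Upper, not_or, not_and, not_lt, neg_eq_zero] at h₁ h₂
    have h0 : v s 1 = 0 := le_antisymm h₁.1 (by linarith)
    exact ⟨le_antisymm (h₁.2 h0) (by linarith [h₂.2 h0]), h0⟩

theorem exists_forall_rel {ι : Type*} {r : ι → ι → Prop} (hr : ∀ a b, r a b ∨ r b a)
    (htrans : ∀ a b c, r a b → r b c → r a c) {S : Finset ι} (hS : S.Nonempty) :
    ∃ m ∈ S, ∀ s ∈ S, r m s := by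
  classical
  induction hS using Finset.Nonempty.cons_induction with
  | singleton a => exact ⟨a, by simp, by simpa using hr a a⟩
  | cons a S ha _ ih =>
    obtain ⟨m, hm, h⟩ := ih
    rcases hr a m with h' | h'
    · refine ⟨a, by simp, fun s hs => ?_⟩
      rcases Finset.mem_cons.1 hs with rfl | hs
      · simpa using hr s s
      · exact htrans _ _ _ h' (h s hs)
    · refine ⟨m, by simp [hm], fun s hs => ?_⟩
      rcases Finset.mem_cons.1 hs with rfl | hs
      · exact h'
      · exact h s hs

/-- The expression is the cross product of `(1, -δ)` with the direction: turning slightly below the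
axis gets in front of all of them. -/
theorem exists_direction_before {ι : Type*} (S : Finset ι) {w : ι → ℝ × ℝ}
    (hw : ∀ s, Upper (w s).1 (w s).2) : ∃ δ : ℝ, ∀ s ∈ S, 0 < (w s).2 + δ * (w s).1 := by
  classical
  obtain ⟨δ, hδ, h⟩ := exists_pos_forall_pos (B := S.filter fun s => 0 < (w s).2)
    (f := fun s => (w s).2) (g := fun s => (w s).1) fun s hs => (Finset.mem_filter.1 hs).2
  refine ⟨δ, fun s hs => ?_⟩
  rcases hw s with h' | ⟨h₁, h₂⟩
  · exact h s (Finset.mem_filter.2 ⟨hs, h'⟩)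
  · rw [h₁, zero_add]
    exact mul_pos hδ h₂

theorem exists_separating_direction {ι : Type*} (S T : Finset ι) {w : ι → ℝ × ℝ}
    (hw : ∀ s, Upper (w s).1 (w s).2) (h : ∀ s ∈ S, ∀ t ∈ T, 0 < cross (w s) (w t)) :
    ∃ p : ℝ × ℝ, (∀ s ∈ S, 0 < cross (w s) p) ∧ ∀ t ∈ T, 0 < cross p (w t) := by
  have htotal : ∀ a b, 0 ≤ cross (w a) (w b) ∨ 0 ≤ cross (w b) (w a) := fun a b => by
    rw [cross_antisymm (w b)]
    rcases le_total 0 (cross (w a) (w b)) with h | h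
    · exact .inl h
    · exact .inr (by linarith)
  have htrans : ∀ a b c, 0 ≤ cross (w a) (w b) → 0 ≤ cross (w b) (w c) → 0 ≤ cross (w a) (w c) :=
    fun a b c h₁ h₂ => (cross_trans (hw a) (hw b) (hw c) h₁ h₂).1
  rcases S.eq_empty_or_nonempty with rfl | hS
  · obtain ⟨δ, hδ⟩ := exists_direction_before T hw
    refine ⟨(1, -δ), by simp, fun t ht => ?_⟩
    have := hδ t ht
    simp only [cross]
    linarith
  rcases T.eq_empty_or_nonempty with rfl | hT
  · obtain ⟨δ, hδ⟩ := exists_direction_before S hw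
    refine ⟨(-1, δ), fun s hs => ?_, by simp⟩
    have := hδ s hs
    simp only [cross]
    linarith
  obtain ⟨a, ha, hmax⟩ := exists_forall_rel (r := fun a b => 0 ≤ cross (w b) (w a))
    (fun a b => htotal b a) (fun a b c h₁ h₂ => htrans c b a h₂ h₁) hS
  obtain ⟨b, hb, hmin⟩ := exists_forall_rel (r := fun a b => 0 ≤ cross (w a) (w b)) htotal htrans hT
  -- The sum lies strictly between the last direction of `S` and the first one of `T`.
  refine ⟨w a + w b, fun s hs => ?_, fun t ht => ?_⟩
  · have h₁ := hmax s hs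
    have h₂ := h s hs b hb
    simp only [cross, Prod.fst_add, Prod.snd_add] at *
    linarith
  · have h₁ := hmin t ht
    have h₂ := h a ha t ht
    simp only [cross, Prod.fst_add, Prod.snd_add] at *
    linarith

/-- The line bounding a half-plane has one upper direction. Vectors on the positive side have,
according to their class, lines before or after that direction; which class comes first depends on
the side. -/
theorem openSide_two_iff (v : Fin n → ℕ → ℝ) (B : Finset (Fin n)) :
    OpenSide v 2 B ↔ (∀ b ∈ B, angleClass v b ≠ 0) ∧
      ((∀ l ∈ B, angleClass v l = 2 → ∀ u ∈ B, angleClass v u = 1 →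
          0 < cross (direction v l) (direction v u)) ∨
        ∀ l ∈ B, angleClass v l = 2 → ∀ u ∈ B, angleClass v u = 1 →
          0 < cross (direction v u) (direction v l)) := by
  classical
  have hcls : ∀ b, angleClass v b = 1 → direction v b = (v b 0, v b 1) := fun b h => by
    rcases angleClass_cases v b with h' | h' | h'
    · exact h'.2
    · omega
    · omega
  have hcls2 : ∀ b, angleClass v b = 2 → direction v b = (-v b 0, -v b 1) := fun b h => by
    rcases angleClass_cases v b with h' | h' | h'
    · omega
    · exact h'.2
    · omega
  have hcase : ∀ b, angleClass v b ≠ 0 → angleClass v b = 1 ∨ angleClass v b = 2 := fun b h => by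
    rcases angleClass_cases v b with h' | h' | h' <;> omega
  constructor
  · rintro ⟨h, hh⟩
    have hh' : ∀ b ∈ B, 0 < h 0 * v b 0 + h 1 * v b 1 := fun b hb => by
      simpa [Finset.sum_range_succ] using hh b hb
    refine ⟨fun b hb h0 => ?_, ?_⟩
    · rcases angleClass_cases v b with h' | h' | h'
      · omega
      · omega
      · have := hh' b hb
        simp [h'.2] at this
    · by_cases hB : B = ∅
      · left; simp [hB]
      obtain ⟨b₀, hb₀⟩ := Finset.nonempty_iff_ne_empty.2 hB
      -- The normal is nonzero because `B` is not empty, so one of the two directions of the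
      -- bounding line is upper.
      have hne : Upper (h 1) (-h 0) ∨ Upper (-h 1) (h 0) := by
        by_contra hcon
        simp only [Upper, not_or, not_and, not_lt, neg_eq_zero] at hcon
        have h0 : h 0 = 0 := le_antisymm hcon.2.1 (by linarith [hcon.1.1])
        have h1 : h 1 = 0 := le_antisymm (hcon.1.2 h0) (by linarith [hcon.2.2 h0])
        have := hh' b₀ hb₀
        simp [h0, h1] at this
      rcases hne with hne | hne
      · left
        intro l hl hl2 u hu hu1
        have h₁ : 0 < cross (direction v l) (h 1, -h 0) := by
          rw [hcls2 l hl2, cross]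
          have := hh' l hl
          simp only
          linarith
        have h₂ : 0 < cross (h 1, -h 0) (direction v u) := by
          rw [hcls u hu1, cross]
          have := hh' u hu
          simp only
          linarith
        exact (cross_trans (upper_direction v l) hne (upper_direction v u) h₁.le h₂.le).2 (.inl h₁)
      · right
        intro l hl hl2 u hu hu1
        have h₁ : 0 < cross (-h 1, h 0) (direction v l) := by
          rw [hcls2 l hl2, cross]
          have := hh' l hl
          simp only
          linarith
        have h₂ : 0 < cross (direction v u) (-h 1, h 0) := by
          rw [hcls u hu1, cross]
          have := hh' u hu
          simp only
          linarith
        exact (cross_trans (upper_direction v u) hne (upper_direction v l) h₂.le h₁.le).2 (.inl h₂)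
  · rintro ⟨hB, hsep⟩
    have hin : ∀ (h : ℕ → ℝ) b, ∑ c ∈ Finset.range 2, h c * v b c = h 0 * v b 0 + h 1 * v b 1 :=
      fun h b => by simp [Finset.sum_range_succ]
    have hmem : ∀ (k : ℕ) b, b ∈ B.filter (fun b => angleClass v b = k) ↔
        b ∈ B ∧ angleClass v b = k := by simp
    rcases hsep with hsep | hsep
    · obtain ⟨p, hp₁, hp₂⟩ := exists_separating_direction (B.filter fun b => angleClass v b = 2)
        (B.filter fun b => angleClass v b = 1) (upper_direction v) (by
          intro l hl u hu
          rw [hmem] at hl hu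
          exact hsep l hl.1 hl.2 u hu.1 hu.2)
      -- The normal is `p` after a quarter turn; its product with a vector is the cross product with
      -- `p`.
      refine ⟨fun c => if c = 0 then -p.2 else p.1, fun b hb => ?_⟩
      rw [hin]
      rcases hcase b (hB b hb) with h | h
      · have := hp₂ b ((hmem 1 b).2 ⟨hb, h⟩)
        rw [hcls b h, cross] at this
        simp only [if_true, one_ne_zero, if_false]
        linarith
      · have := hp₁ b ((hmem 2 b).2 ⟨hb, h⟩)
        rw [hcls2 b h, cross] at this
        simp only [if_true, one_ne_zero, if_false]
        linarith
    · obtain ⟨p, hp₁, hp₂⟩ := exists_separating_direction (B.filter fun b => angleClass v b = 1)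
        (B.filter fun b => angleClass v b = 2) (upper_direction v) (by
          intro u hu l hl
          rw [hmem] at hl hu
          exact hsep l hl.1 hl.2 u hu.1 hu.2)
      refine ⟨fun c => if c = 0 then p.2 else -p.1, fun b hb => ?_⟩
      rw [hin]
      rcases hcase b (hB b hb) with h | h
      · have := hp₁ b ((hmem 1 b).2 ⟨hb, h⟩)
        rw [hcls b h, cross] at this
        simp only [if_true, one_ne_zero, if_false]
        linarith
      · have := hp₂ b ((hmem 2 b).2 ⟨hb, h⟩)
        rw [hcls2 b h, cross] at this
        simp only [if_true, one_ne_zero, if_false]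
        linarith

/-- All points of `B` have the class `i` or `k`, some point has the class `i`, and the lines of the
points of the class `k` have smaller angles than those of the points of the class `i`. -/
def StartsWith (v : Fin n → ℕ → ℝ) (i k : ℕ) (B : Finset (Fin n)) : Prop :=
  (∃ u ∈ B, angleClass v u = i) ∧ (∀ b ∈ B, angleClass v b = i ∨ angleClass v b = k) ∧
    ∀ l ∈ B, angleClass v l = k → ∀ u ∈ B, angleClass v u = i →
      0 < cross (direction v l) (direction v u)

open Classical in
-- The existence clause in `StartsWith` makes the three cases exclusive, also for sets with only one
-- class.
theorem openSide_two_indicator (v : Fin n → ℕ → ℝ) (B : Finset (Fin n)) :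
    (if OpenSide v 2 B then 1 else 0 : ℝ) = (if B = ∅ then 1 else 0) +
      (if StartsWith v 1 2 B then 1 else 0) + if StartsWith v 2 1 B then 1 else 0 := by
  have hcase : ∀ b, angleClass v b ≠ 0 → angleClass v b = 1 ∨ angleClass v b = 2 := fun b h => by
    rcases angleClass_cases v b with h' | h' | h' <;> omega
  rcases B.eq_empty_or_nonempty with rfl | ⟨b₀, hb₀⟩
  · simp [OpenSide, StartsWith]
  have hB : B ≠ ∅ := Finset.ne_empty_of_mem hb₀
  have hor : OpenSide v 2 B ↔ StartsWith v 1 2 B ∨ StartsWith v 2 1 B := by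
    rw [openSide_two_iff]
    constructor
    · rintro ⟨h0, h⟩
      by_cases hu : ∃ u ∈ B, angleClass v u = 1
      · by_cases hl : ∃ l ∈ B, angleClass v l = 2
        · rcases h with h | h
          · exact .inl ⟨hu, fun b hb => hcase b (h0 b hb), h⟩
          · exact .inr ⟨hl, fun b hb => (hcase b (h0 b hb)).symm,
              fun u hu hu1 l hl hl2 => h l hl hl2 u hu hu1⟩
        · exact .inl ⟨hu, fun b hb => hcase b (h0 b hb), fun l hl' hl2 => (hl ⟨l, hl', hl2⟩).elim⟩
      · refine .inr ⟨⟨b₀, hb₀, (hcase b₀ (h0 b₀ hb₀)).resolve_left fun h => hu ⟨b₀, hb₀, h⟩⟩,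
          fun b hb => (hcase b (h0 b hb)).symm, fun u hu' hu1 => (hu ⟨u, hu', hu1⟩).elim⟩
    · rintro (⟨-, h₁, h₂⟩ | ⟨-, h₁, h₂⟩)
      · exact ⟨fun b hb => by have := h₁ b hb; omega, .inl h₂⟩
      · exact ⟨fun b hb => by have := h₁ b hb; omega,
          .inr fun l hl hl2 u hu hu1 => h₂ u hu hu1 l hl hl2⟩
  have hand : ¬ (StartsWith v 1 2 B ∧ StartsWith v 2 1 B) := by
    rintro ⟨⟨⟨u, hu, hu1⟩, -, h₁⟩, ⟨⟨l, hl, hl2⟩, -, h₂⟩⟩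
    have h₃ := h₁ l hl hl2 u hu hu1
    have h₄ := h₂ u hu hu1 l hl hl2
    rw [cross_antisymm] at h₄
    linarith
  rw [if_neg hB, if_congr hor rfl rfl, zero_add]
  by_cases h₁ : StartsWith v 1 2 B
  · have h₂ : ¬ StartsWith v 2 1 B := fun h₂ => hand ⟨h₁, h₂⟩
    simp [h₁, h₂]
  · simp [h₁]

/-- The point `s` precedes the point `t` in the order of the angles of their lines, where points of
the class `i` come first among those with equal lines. -/
def Precedes (w : ℕ → ℝ × ℝ) (cl : ℕ → ℕ) (i s t : ℕ) : Prop :=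
  0 < cross (w s) (w t) ∨ (¬ 0 < cross (w t) (w s) ∧ cl s = i ∧ cl t ≠ i)

/-- For upper directions this is the lexicographic order by angle and then by class, which makes
transitivity and totality accessible. -/
theorem not_precedes_iff {w : ℕ → ℝ × ℝ} {cl : ℕ → ℕ} {i s t : ℕ} : ¬ Precedes w cl i t s ↔
    0 ≤ cross (w s) (w t) ∧ (0 < cross (w s) (w t) ∨ (cl t = i → cl s = i)) := by
  have := cross_antisymm (w s) (w t)
  rw [Precedes, not_or, not_lt]
  constructor
  · rintro ⟨h₁, h₂⟩
    refine ⟨by linarith, ?_⟩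
    by_contra hcon
    push Not at hcon
    exact h₂ ⟨by linarith, hcon.2⟩
  · rintro ⟨h₁, h₂⟩
    refine ⟨by linarith, ?_⟩
    rintro ⟨h₃, h₄, h₅⟩
    rcases h₂ with h₂ | h₂
    · exact h₃ h₂
    · exact h₅ (h₂ h₄)

theorem not_precedes_trans {w : ℕ → ℝ × ℝ} (hw : ∀ s, Upper (w s).1 (w s).2) {cl : ℕ → ℕ} {i : ℕ}
    {s t u : ℕ} (h₁ : ¬ Precedes w cl i t s) (h₂ : ¬ Precedes w cl i u t) :
    ¬ Precedes w cl i u s := by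
  rw [not_precedes_iff] at *
  obtain ⟨h₃, h₄⟩ := cross_trans (hw s) (hw t) (hw u) h₁.1 h₂.1
  refine ⟨h₃, ?_⟩
  rcases h₁.2 with h | h
  · exact .inl (h₄ (.inl h))
  · rcases h₂.2 with h' | h'
    · exact .inl (h₄ (.inr h'))
    · exact .inr fun hu => h (h' hu)

theorem not_precedes_total {w : ℕ → ℝ × ℝ} {cl : ℕ → ℕ} {i s t : ℕ} :
    ¬ Precedes w cl i t s ∨ ¬ Precedes w cl i s t := by
  rw [not_precedes_iff, not_precedes_iff, cross_antisymm (w t) (w s)]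
  rcases lt_trichotomy (cross (w s) (w t)) 0 with h | h | h
  · right
    exact ⟨by linarith, .inl (by linarith)⟩
  · rw [h]
    by_cases hs : cl s = i
    · exact .inl ⟨le_rfl, .inr fun _ => hs⟩
    · exact .inr ⟨by simp, .inr fun h => (hs h).elim⟩
  · left
    exact ⟨h.le, .inl h⟩

/-- The sites that must not be occupied when the sweep has reached the position `p`. -/
def SweepForbidden (cl : Fin n → ℕ) (i k : ℕ) (o : ℕ → ℕ) (p : ℕ) (s : Fin n) : Prop :=
  (cl s = i ∧ ∃ a < p, o a = s) ∨ (cl s ≠ i ∧ ¬ (cl s = k ∧ ∃ a < p, o a = s))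

open Classical MultipointSet in
-- The nonzero term belongs to the first occupied site of class `i` in the sorted order. On equal
-- lines class `i` is sorted first, so sites of class `k` on the line of that site come later and
-- are forbidden, as the strict inequality in `StartsWith` demands.
theorem sum_sweep (v : Fin n → ℕ → ℝ) {w : ℕ → ℝ × ℝ} (hw : ∀ s : Fin n, w s = direction v s)
    {cl : ℕ → ℕ} (hcl : ∀ s : Fin n, cl s = angleClass v s) {i k : ℕ} (hik : i ≠ k) {o : Fin n → Fin n}
    {o' : ℕ → ℕ} (ho' : ∀ a : Fin n, o' a = o a)
    (ho : Function.Bijective o) (hsort : ∀ a b : Fin n, a < b → ¬ Precedes w cl i (o b) (o a))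
    (B : Finset (Fin n)) : ∑ a, (if angleClass v (o a) = i then
      tupleEvent (fun _ : Fin 1 => o a) (SweepForbidden (angleClass v) i k o' a) B else 0) =
        if StartsWith v i k B then 1 else 0 := by
  obtain ⟨pos, hpos₁, hpos₂⟩ := Function.bijective_iff_has_inverse.1 ho
  have hex : ∀ a s : Fin n, (∃ b < (a : ℕ), o' b = (s : ℕ)) ↔ pos s < a := by
    intro a s
    constructor
    · rintro ⟨b, hb, h⟩
      have h' := ho' ⟨b, hb.trans a.2⟩
      simp only at h'
      rw [h', Fin.val_inj] at h
      rw [← h, hpos₁]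
      exact hb
    · intro h
      exact ⟨pos s, h, by rw [ho', hpos₂]⟩
  have hforb : ∀ (a : Fin n) s, ¬ SweepForbidden (angleClass v) i k o' a s ↔
      (angleClass v s = i → a ≤ pos s) ∧ (angleClass v s ≠ i → angleClass v s = k ∧ pos s < a) := by
    intro a s
    rw [SweepForbidden, hex, ← not_lt]
    tauto
  have hterm : ∀ a, (if angleClass v (o a) = i then
      tupleEvent (fun _ : Fin 1 => o a) (SweepForbidden (angleClass v) i k o' a) B else 0) ≠ 0 →
        angleClass v (o a) = i ∧ o a ∈ B ∧
          ∀ s ∈ B, ¬ SweepForbidden (angleClass v) i k o' a s := by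
    intro a h
    split_ifs at h with h₁
    · rw [tupleEvent] at h
      split_ifs at h with h₂
      · exact ⟨h₁, h₂.1 0, h₂.2⟩
      · exact (h rfl).elim
    · exact (h rfl).elim
  have hstart : ∀ a, (angleClass v (o a) = i ∧ o a ∈ B ∧
      ∀ s ∈ B, ¬ SweepForbidden (angleClass v) i k o' a s) → StartsWith v i k B := by
    rintro a ⟨h₁, h₂, h₃⟩
    simp only [hforb] at h₃
    refine ⟨⟨o a, h₂, h₁⟩, fun b hb => ?_, fun l hl hlk u hu hui => ?_⟩
    · by_cases hb' : angleClass v b = i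
      · exact .inl hb'
      · exact .inr ((h₃ b hb).2 hb').1
    · have h₄ := ((h₃ l hl).2 (by rw [hlk]; exact hik.symm)).2
      have h₅ := (h₃ u hu).1 hui
      have h₆ := hsort (pos l) (pos u) (h₄.trans_le h₅)
      rw [hpos₂, hpos₂, not_precedes_iff, hw, hw, hcl, hcl] at h₆
      rcases h₆.2 with h | h
      · exact h
      · exact (hik ((h hui).symm.trans hlk)).elim
  split_ifs with hS
  · obtain ⟨⟨u, hu, hui⟩, h₁, h₂⟩ := hS
    obtain ⟨m, hm, hmin⟩ := Finset.exists_min_image (B.filter fun b => angleClass v b = i) pos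
      ⟨u, Finset.mem_filter.2 ⟨hu, hui⟩⟩
    rw [Finset.mem_filter] at hm
    -- An occupied site of class `k` sorted after `m` would have a line that is not strictly before
    -- that of `m`.
    have hgood : ∀ s ∈ B, ¬ SweepForbidden (angleClass v) i k o' (pos m) s := by
      intro s hs
      rw [hforb]
      refine ⟨fun hsi => hmin s (Finset.mem_filter.2 ⟨hs, hsi⟩), fun hsi => ?_⟩
      have hsk := (h₁ s hs).resolve_left hsi
      refine ⟨hsk, ?_⟩
      by_contra hcon
      have hne : pos m ≠ pos s := by
        intro h
        have := congrArg o h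
        rw [hpos₂, hpos₂] at this
        rw [← this] at hsi
        exact hsi hm.2
      have h₆ := hsort (pos m) (pos s) (lt_of_le_of_ne (not_lt.1 hcon) hne)
      rw [hpos₂, hpos₂, not_precedes_iff, hw, hw] at h₆
      have h₇ := h₂ s hs hsk m hm.1 hm.2
      rw [cross_antisymm] at h₇
      linarith [h₆.1]
    rw [Finset.sum_eq_single (pos m)]
    · rw [hpos₂, if_pos hm.2, tupleEvent, if_pos ⟨fun _ => hm.1, hgood⟩]
    · intro a _ ha
      by_contra h0
      obtain ⟨h₃, h₄, h₅⟩ := hterm a h0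
      apply ha
      apply le_antisymm
      · exact ((hforb a m).1 (h₅ m hm.1)).1 hm.2
      · have := hmin (o a) (Finset.mem_filter.2 ⟨h₄, h₃⟩)
        rwa [hpos₁] at this
    · simp
  · refine Finset.sum_eq_zero fun a _ => ?_
    by_contra h0
    exact hS (hstart a (hterm a h0))

end Plane

namespace RealRAM

/-! ### The product of the factors of the groups -/

variable {d : ℕ}

open Classical in
/-- The probability of the sites of the `i`-th uncertain point that satisfy `F`. -/
noncomputable def groupSum (P : MultipointSet d) (F : Fin P.n → Prop) (i : ℕ) : ℝ :=
  ∑ s with F s ∧ (P.group s : ℕ) = i, P.prob s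

theorem groupSum_insert {P : MultipointSet d} {F F' : Fin P.n → Prop} {s : Fin P.n} (hs : ¬ F s)
    (hs' : F' s) (h : ∀ x, x ≠ s → (F' x ↔ F x)) (i : ℕ) :
    groupSum P F' i = groupSum P F i + if (P.group s : ℕ) = i then P.prob s else 0 := by
  classical
  have hF : ∀ x, F' x ↔ F x ∨ x = s := by
    intro x
    by_cases hx : x = s
    · subst hx; simp [hs']
    · simp [h x hx, hx]
  rw [groupSum, groupSum, Finset.sum_filter, Finset.sum_filter,
    ← Finset.sum_erase_add _ _ (Finset.mem_univ s),
    ← Finset.sum_erase_add (a := s) (s := Finset.univ) (f := fun x =>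
      if F x ∧ (P.group x : ℕ) = i then P.prob x else 0) (Finset.mem_univ s)]
  simp only [hs, false_and, if_false, add_zero, hs', true_and]
  congr 1
  refine Finset.sum_congr rfl fun x hx => ?_
  rw [h x (Finset.ne_of_mem_erase hx)]

open Classical in
/-- The number of the factors that vanish. -/
noncomputable def zerosOn {m : ℕ} (S : Finset (Fin m)) (f : ℕ → ℝ) : ℕ :=
  (S.filter fun i : Fin m => 1 - f i.val = 0).card

open Classical in
/-- The product of the factors that do not vanish. -/
noncomputable def prodOn {m : ℕ} (S : Finset (Fin m)) (f : ℕ → ℝ) : ℝ :=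
  ∏ i ∈ S.filter (fun i : Fin m => 1 - f i.val ≠ 0), (1 - f i.val)

open Classical in
theorem zerosOn_univ {m : ℕ} (g : Fin m) (f : ℕ → ℝ) : zerosOn (Finset.univ : Finset (Fin m)) f =
    zerosOn (Finset.univ.erase g) f + if 1 - f g = 0 then 1 else 0 := by
  rw [zerosOn, zerosOn, Finset.filter_erase]
  split_ifs with h
  · rw [Finset.card_erase_add_one]
    simpa using h
  · rw [Finset.erase_eq_of_notMem, add_zero]
    simpa using h

open Classical in
theorem prodOn_univ {m : ℕ} (g : Fin m) (f : ℕ → ℝ) : prodOn (Finset.univ : Finset (Fin m)) f =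
    prodOn (Finset.univ.erase g) f * if 1 - f g = 0 then 1 else 1 - f g := by
  rw [prodOn, prodOn, Finset.filter_erase]
  split_ifs with h
  · rw [Finset.erase_eq_of_notMem, mul_one]
    simpa using h
  · rw [Finset.prod_erase_mul]
    simpa using h

/-- A factor vanishes when the forbidden sites of a group have total probability one. Counting the
zeros apart keeps the stored product invertible. -/
theorem prod_eq_of_zerosOn {m : ℕ} (S : Finset (Fin m)) (f : ℕ → ℝ) :
    ∏ i ∈ S, (1 - f i) = if zerosOn S f = 0 then prodOn S f else 0 := by
  classical
  split_ifs with h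
  · rw [zerosOn, Finset.card_eq_zero, Finset.filter_eq_empty_iff] at h
    rw [prodOn, Finset.filter_true_of_mem fun i hi => h hi]
  · rw [zerosOn, ← ne_eq, Finset.card_ne_zero] at h
    obtain ⟨i, hi⟩ := h
    rw [Finset.mem_filter] at hi
    exact Finset.prod_eq_zero hi.1 hi.2

theorem zerosOn_congr {m : ℕ} {S : Finset (Fin m)} {f g : ℕ → ℝ} (h : ∀ i ∈ S, f i = g i) :
    zerosOn S f = zerosOn S g := by
  classical
  rw [zerosOn, zerosOn, Finset.filter_congr fun i hi => by rw [h i hi]]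

theorem prodOn_congr {m : ℕ} {S : Finset (Fin m)} {f g : ℕ → ℝ} (h : ∀ i ∈ S, f i = g i) :
    prodOn S f = prodOn S g := by
  classical
  rw [prodOn, prodOn, Finset.filter_congr (q := fun i : Fin m => 1 - g i ≠ 0)
    fun i hi => by rw [h i hi]]
  exact Finset.prod_congr rfl fun i hi => by rw [h i (Finset.mem_filter.1 hi).1]

/-- The registers describe the product of the factors of the groups in `S`. -/
def FactorsOn {m : ℕ} (S : Finset (Fin m)) (M : Memory) : Prop :=
  M.nat 20 0 = zerosOn S (M.real 4) ∧ M.real 5 0 = prodOn S (M.real 4)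

/-- The group of the current site. -/
abbrev groupExpr : NatExpr := .get 1 (.reg 21)

/-- The factor of the group of the current site. -/
abbrev factorExpr : RealExpr := .sub (.lit 1) (.get 4 groupExpr)

/-- Removes the factor of the current group from the product. -/
def removeFactor : Program :=
  .ite (.realEq factorExpr (.lit 0)) (.setNat 20 (.lit 0) (.sub (.reg 20) (.lit 1)))
    (.setReal 5 (.lit 0) (.div (.reg 5) factorExpr))

/-- Includes the factor of the current group in the product. -/
def insertFactor : Program :=
  .ite (.realEq factorExpr (.lit 0)) (.setNat 20 (.lit 0) (.add (.reg 20) (.lit 1)))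
    (.setReal 5 (.lit 0) (.mul (.reg 5) factorExpr))

theorem ends_removeFactor {m : ℕ} {g : Fin m} {M : Memory} (hg : M.nat 1 (M.nat 21 0) = g)
    (h : FactorsOn (Finset.univ : Finset (Fin m)) M) :
    Ends removeFactor M removeFactor.cost fun M' => FactorsOn (Finset.univ.erase g) M' := by
  refine Ends.of_loopFree (by simp [removeFactor, Program.LoopFree]) ?_
  obtain ⟨h₁, h₂⟩ := h
  rw [zerosOn_univ g] at h₁
  rw [prodOn_univ g] at h₂
  simp only [removeFactor, Program.exec, Test.holds_realEq, RealExpr.eval, NatExpr.eval, hg,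
    Int.cast_one, Int.cast_zero]
  split_ifs with h0
  · rw [if_pos h0] at h₁ h₂
    refine ⟨?_, ?_⟩
    · simp [Memory.storeNat_nat, h₁]
    · simp [h₂]
  · rw [if_neg h0] at h₁ h₂
    refine ⟨?_, ?_⟩
    · simp [Memory.storeReal_real, h₁]
    · simp [Memory.storeReal_real, h₂, h0]

theorem ends_insertFactor {m : ℕ} {g : Fin m} {M : Memory} (hg : M.nat 1 (M.nat 21 0) = g)
    (h : FactorsOn ((Finset.univ : Finset (Fin m)).erase g) M) :
    Ends insertFactor M insertFactor.cost fun M' =>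
      FactorsOn (Finset.univ : Finset (Fin m)) M' := by
  refine Ends.of_loopFree (by simp [insertFactor, Program.LoopFree]) ?_
  obtain ⟨h₁, h₂⟩ := h
  simp only [insertFactor, Program.exec, Test.holds_realEq, RealExpr.eval, NatExpr.eval, hg,
    Int.cast_one, Int.cast_zero]
  split_ifs with h0
  · refine ⟨?_, ?_⟩
    · simp [Memory.storeNat_nat, h₁, zerosOn_univ g, h0]
    · simp [h₂, prodOn_univ g, h0]
  · refine ⟨?_, ?_⟩
    · simp [Memory.storeReal_real, h₁, zerosOn_univ g, h0]
    · simp [Memory.storeReal_real, h₂, prodOn_univ g, h0]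

/-- The memory describes the probability that no site of `F` is occupied. -/
def FactorState (P : MultipointSet d) (F : Fin P.n → Prop) (M : Memory) : Prop :=
  (∀ i, M.real 4 i = groupSum P F i) ∧ FactorsOn (Finset.univ : Finset (Fin P.m)) M

/-- Executes `p`, which may change the cell of the current group. -/
def update (p : Program) : Program := .seq removeFactor (.seq p insertFactor)

/-- Only the factor of the current group may change, so it is taken out before `p` and put back
afterwards. While `p` runs, the registers describe the product over the other groups, which is the
one in `tupleProb_one`. -/
theorem ends_update {P : MultipointSet d} {q : Fin d → ℝ} {p : Program} {c : ℕ} {x : ℝ}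
    {M : Memory} {F F' : Fin P.n → Prop} {s : Fin P.n} (hM : HoldsInput P q M)
    (hs : M.nat 21 0 = s) (hF : FactorState P F M)
    (hpn : ∀ a, ¬ p.WritesNat a) (hpr : ¬ p.WritesReal 5)
    (hFF' : ∀ i, i ≠ (P.group s : ℕ) → groupSum P F' i = groupSum P F i)
    (hp : ∀ M₁, Frame removeFactor M M₁ → FactorsOn (Finset.univ.erase (P.group s)) M₁ →
      Ends p M₁ c fun M₂ => (∀ i, M₂.real 4 i = groupSum P F' i) ∧
        M₂.real 6 0 = M₁.real 6 0 + x) :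
    Ends (update p) M (removeFactor.cost + (c + insertFactor.cost)) fun M' =>
      FactorState P F' M' ∧ M'.real 6 0 = M.real 6 0 + x := by
  refine (ends_removeFactor (g := P.group s) (by rw [hs, hM.group_eq]) hF.2).seq
    fun M₁ hf₁ h₁ => (hp M₁ hf₁ h₁).seq fun M₂ hf₂ h₂ => ?_
  have hr4 : M₁.real 4 = M.real 4 := hf₁.2 4 (by simp [removeFactor, Program.WritesReal])
  have hr6 : M₁.real 6 = M.real 6 := hf₁.2 6 (by simp [removeFactor, Program.WritesReal])
  have hg : M₂.nat 1 (M₂.nat 21 0) = P.group s := by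
    rw [hf₂.1 _ (hpn _), hf₂.1 _ (hpn _), hf₁.1 1 (by simp [removeFactor, Program.WritesNat]),
      hf₁.1 21 (by simp [removeFactor, Program.WritesNat]), hs, hM.group_eq]
  have hcell : ∀ i ∈ Finset.univ.erase (P.group s), M₂.real 4 i = M₁.real 4 i := by
    intro i hi
    rw [h₂.1, hr4, hF.1, hFF']
    exact fun h => Finset.ne_of_mem_erase hi (Fin.ext h)
  refine (ends_insertFactor hg ⟨?_, ?_⟩).imp fun M₃ hf₃ h₃ => ⟨⟨fun i => ?_, h₃⟩, ?_⟩
  · rw [hf₂.1 _ (hpn _), zerosOn_congr hcell, h₁.1]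
  · rw [hf₂.2 _ hpr, prodOn_congr hcell, h₁.2]
  · rw [hf₃.2 4 (by simp [insertFactor, Program.WritesReal]), h₂.1]
  · rw [hf₃.2 6 (by simp [insertFactor, Program.WritesReal]), h₂.2, hr6]

theorem tupleProb_one (P : MultipointSet d) (s : Fin P.n) (F : Fin P.n → Prop) :
    P.tupleProb (fun _ : Fin 1 => s) F =
      P.prob s * ∏ i ∈ Finset.univ.erase (P.group s), (1 - groupSum P F i) := by
  classical
  rw [MultipointSet.tupleProb, ← Finset.mul_prod_erase _ _ (Finset.mem_univ (P.group s))]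
  simp only [Finset.univ_unique, Finset.prod_const, Finset.card_singleton, pow_one,
    exists_const, if_true, one_mul]
  congr 1
  refine Finset.prod_congr rfl fun i hi => ?_
  rw [if_neg (Finset.ne_of_mem_erase hi).symm, groupSum]
  simp only [Fin.val_inj]

/-! ### The rotational sweep -/

/-- Determines the classes and directions of all sites. -/
def prepProgram : Program :=
  forSites 2 (.ite (.not (.and (.not (.realLt (.lit 0) (coordExpr (.reg 2) 1)))
      (.not (.and (.realEq (coordExpr (.reg 2) 1) (.lit 0))
        (.realLt (.lit 0) (coordExpr (.reg 2) 0))))))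
    (.seq (.setNat 19 (.reg 2) (.lit 1)) (.seq (.setReal 7 (.reg 2) (coordExpr (.reg 2) 0))
      (.setReal 8 (.reg 2) (coordExpr (.reg 2) 1))))
    (.ite (.not (.and (.not (.realLt (coordExpr (.reg 2) 1) (.lit 0)))
        (.not (.and (.realEq (coordExpr (.reg 2) 1) (.lit 0))
          (.realLt (coordExpr (.reg 2) 0) (.lit 0))))))
      (.seq (.setNat 19 (.reg 2) (.lit 2)) (.seq
        (.setReal 7 (.reg 2) (.sub (.lit 0) (coordExpr (.reg 2) 0)))
        (.setReal 8 (.reg 2) (.sub (.lit 0) (coordExpr (.reg 2) 1)))))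
      (.seq (.setNat 19 (.reg 2) (.lit 0)) (.seq (.setReal 7 (.reg 2) (.lit 1))
        (.setReal 8 (.reg 2) (.lit 0))))))

/-- The memory holds the input and the classes and directions of the sites. -/
structure Prepared (P : MultipointSet 2) (q : Fin 2 → ℝ) (M : Memory) : Prop where
  input : HoldsInput P q M
  class_eq : ∀ s : Fin P.n, M.nat 19 s = angleClass (P.offset q) s
  direction_eq : ∀ s : Fin P.n, (M.real 7 s, M.real 8 s) = direction (P.offset q) s

theorem Prepared.frame {P : MultipointSet 2} {q : Fin 2 → ℝ} {M M' : Memory} {p : Program}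
    (h : Prepared P q M) (hf : Frame p M M') (h0 : ¬ p.WritesNat 0) (h1 : ¬ p.WritesNat 1)
    (h19 : ¬ p.WritesNat 19) (hr : ∀ a < 4, ¬ p.WritesReal a) (h7 : ¬ p.WritesReal 7)
    (h8 : ¬ p.WritesReal 8) : Prepared P q M' := by
  refine ⟨h.input.frame hf h0 h1 hr, fun s => ?_, fun s => ?_⟩
  · rw [hf.1 19 h19, h.class_eq]
  · rw [hf.2 7 h7, hf.2 8 h8, h.direction_eq]

theorem ends_prepProgram {P : MultipointSet 2} {q : Fin 2 → ℝ} {M : Memory}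
    (hM : HoldsInput P q M) : Ends prepProgram M (P.n * 400 + 9) (Prepared P q) := by
  refine (Ends.forSites (n := P.n) (c := 388) (I := fun k M' => ∀ s : Fin P.n, s.val < k →
    M'.nat 19 s = angleClass (P.offset q) s ∧
      (M'.real 7 s, M'.real 8 s) = direction (P.offset q) s) (by simp)
    (by simp [Program.WritesNat]) (by simp [Program.WritesNat]) hM.n_eq
    ?_ (by simp) ?_).mono le_rfl ?_
  · intro k M' v h
    simpa [Memory.storeNat_nat] using h
  · intro k hk M' hf hx hI
    have hT : HoldsInput P q M' := hM.frame hf (by simp [Program.WritesNat])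
      (by simp [Program.WritesNat])
      (fun a ha h => by simp [Program.WritesReal] at h; omega)
    have h₀ := hT.eval_coordExpr (x := .reg 2) (s := ⟨k, hk⟩) hx (c := 0) (by omega)
    have h₁ := hT.eval_coordExpr (x := .reg 2) (s := ⟨k, hk⟩) hx (c := 1) (by omega)
    have hne : ∀ s : Fin P.n, s.val < k + 1 → s ≠ ⟨k, hk⟩ → s.val < k ∧ s.val ≠ k := by
      intro s hs hsk
      have : s.val ≠ k := fun h => hsk (Fin.ext h)
      omega
    refine (Ends.of_loopFree (by simp [Program.LoopFree]) ?_).mono (t := _)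
      (by simp [Program.cost, NatExpr.cost, RealExpr.cost, Test.cost, coordExpr, Test.realEq])
      (fun _ _ h => h)
    have hdone : ∀ (c : ℕ) (x y : ℝ), angleClass (P.offset q) ⟨k, hk⟩ = c →
        direction (P.offset q) ⟨k, hk⟩ = (x, y) → ∀ s : Fin P.n, s.val < k + 1 →
        (((M'.storeNat 19 k c).storeReal 7 k x).storeReal 8 k y).nat 19 s =
          angleClass (P.offset q) s ∧
        ((((M'.storeNat 19 k c).storeReal 7 k x).storeReal 8 k y).real 7 s,
          (((M'.storeNat 19 k c).storeReal 7 k x).storeReal 8 k y).real 8 s) =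
          direction (P.offset q) s := by
      intro c x y h₁ h₂ s hs
      by_cases hsk : s = ⟨k, hk⟩
      · subst hsk
        simp [Memory.storeNat_nat, Memory.storeReal_real, h₁, h₂]
      · obtain ⟨hs, hne⟩ := hne s hs hsk
        simpa [Memory.storeNat_nat, Memory.storeReal_real, Function.update_of_ne hne] using hI s hs
    simp only [coordExpr, RealExpr.eval, NatExpr.eval, hx] at h₀ h₁
    simp only [Program.exec, Test.Holds, Test.holds_realEq, coordExpr, RealExpr.eval, NatExpr.eval,
      Memory.storeReal_nat, Memory.storeNat_real, Memory.storeNat_nat, Memory.storeReal_real,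
      hx, Nat.reduceAdd, Nat.reduceEqDiff, OfNat.zero_ne_ofNat, if_false,
      Int.cast_zero, Int.cast_one] at h₀ h₁ ⊢
    simp only [h₀, h₁]
    -- Tests have no disjunction, so the program expresses it by negations.
    have hU : Upper (P.offset q ⟨k, hk⟩ 0) (P.offset q ⟨k, hk⟩ 1) ↔
      ¬ (¬ 0 < P.offset q ⟨k, hk⟩ 1 ∧ ¬ (P.offset q ⟨k, hk⟩ 1 = 0 ∧ 0 < P.offset q ⟨k, hk⟩ 0)) := by
      rw [Upper]; tauto
    have hL : Upper (-P.offset q ⟨k, hk⟩ 0) (-P.offset q ⟨k, hk⟩ 1) ↔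
      ¬ (¬ P.offset q ⟨k, hk⟩ 1 < 0 ∧ ¬ (P.offset q ⟨k, hk⟩ 1 = 0 ∧ P.offset q ⟨k, hk⟩ 0 < 0)) := by
      rw [Upper, neg_pos, neg_pos, neg_eq_zero]; tauto
    by_cases h : Upper (P.offset q ⟨k, hk⟩ 0) (P.offset q ⟨k, hk⟩ 1)
    · rw [if_pos (hU.1 h)]
      exact hdone 1 _ _ (by simp [angleClass, h]) (by simp [direction, h])
    rw [if_neg (mt hU.2 h)]
    by_cases h' : Upper (-P.offset q ⟨k, hk⟩ 0) (-P.offset q ⟨k, hk⟩ 1)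
    · rw [if_pos (hL.1 h')]
      exact hdone 2 _ _ (by simp [angleClass, h, h']) (by simp [direction, h, h'])
    · rw [if_neg (mt hL.2 h')]
      exact hdone 0 _ _ (by simp [angleClass, h, h']) (by simp [direction, h, h'])
  · intro M' hf h
    exact ⟨hM.frame hf (by simp [Program.WritesNat]) (by simp [Program.WritesNat])
      (fun a ha h => by simp [Program.WritesReal] at h; omega),
      fun s => (h s s.2).1, fun s => (h s s.2).2⟩

end RealRAM

/-! ### The angular order and the sweep over the sites. -/

namespace RealRAM

/-- The direction of the line through a site, by the number of the site. -/
noncomputable def directionAt (P : MultipointSet 2) (q : Fin 2 → ℝ) (s : ℕ) : ℝ × ℝ :=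
  -- Numbers beyond the sites also need an upper direction, because sorting asks for a total
  -- preorder on all natural numbers.
  if h : s < P.n then direction (P.offset q) ⟨s, h⟩ else (1, 0)

/-- The class of a site, by the number of the site. -/
noncomputable def classAt (P : MultipointSet 2) (q : Fin 2 → ℝ) (s : ℕ) : ℕ :=
  if h : s < P.n then angleClass (P.offset q) ⟨s, h⟩ else 0

theorem upper_directionAt (P : MultipointSet 2) (q : Fin 2 → ℝ) (s : ℕ) :
    Upper (directionAt P q s).1 (directionAt P q s).2 := by
  unfold directionAt
  split_ifs
  · exact upper_direction _ _
  · exact .inr ⟨rfl, one_pos⟩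

/-- The cross product of the directions of two sites. -/
def crossExpr (e f : NatExpr) : RealExpr :=
  .sub (.mul (.get 7 e) (.get 8 f)) (.mul (.get 8 e) (.get 7 f))

/-- The comparison of two sites in the angular order. -/
def lessTest (i : ℕ) : Test :=
  .not (.and (.not (.realLt (.lit 0) (crossExpr (.get 10 (.reg 16)) (.get 10 (.reg 14)))))
    (.not (.and (.not (.realLt (.lit 0) (crossExpr (.get 10 (.reg 14)) (.get 10 (.reg 16)))))
      (.and (.natEq (.get 19 (.get 10 (.reg 16))) (.lit i))
        (.not (.natEq (.get 19 (.get 10 (.reg 14))) (.lit i)))))))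

theorem Prepared.compares {P : MultipointSet 2} {q : Fin 2 → ℝ} {M : Memory} (h : Prepared P q M)
    (i : ℕ) : Compares P.n (Precedes (directionAt P q) (classAt P q) i) (lessTest i) M := by
  intro M' hr hn ha hb
  have hd : ∀ s, s < P.n → directionAt P q s = (M'.real 7 s, M'.real 8 s) := fun s hs => by
    rw [directionAt, dif_pos hs, hr]
    exact (h.direction_eq ⟨s, hs⟩).symm
  have hc : ∀ s, s < P.n → classAt P q s = M'.nat 19 s := fun s hs => by
    rw [classAt, dif_pos hs, hn 19 (by omega) (by omega)]
    exact (h.class_eq ⟨s, hs⟩).symm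
  simp only [lessTest, crossExpr, Test.Holds, Test.holds_natEq, RealExpr.eval, NatExpr.eval,
    Int.cast_zero, Precedes, cross, hd _ ha, hd _ hb, hc _ ha, hc _ hb]
  tauto

/-- Adds the probability of the current site to the cell of its group. -/
def addCell : Program := .setReal 4 groupExpr (.add (.get 4 groupExpr) (.get 1 (.reg 21)))

/-- Subtracts the probability of the current site from the cell of its group. -/
def subCell : Program := .setReal 4 groupExpr (.sub (.get 4 groupExpr) (.get 1 (.reg 21)))

variable {d : ℕ}

theorem addCell_cells {P : MultipointSet d} {M : Memory} {F F' : Fin P.n → Prop} {s : Fin P.n}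
    (hs : ¬ F s) (hs' : F' s) (h : ∀ x, x ≠ s → (F' x ↔ F x)) (h21 : M.nat 21 0 = s)
    (hg : M.nat 1 s = P.group s) (hp : M.real 1 s = P.prob s)
    (hF : ∀ i, M.real 4 i = groupSum P F i) (i : ℕ) :
    (addCell.exec M).real 4 i = groupSum P F' i := by
  simp only [addCell, Program.exec, RealExpr.eval, NatExpr.eval, h21, hg, hp,
    Memory.storeReal_real, if_true, Function.update_apply, groupSum_insert hs hs' h]
  split_ifs with h₁ h₂ h₂
  · rw [h₁, hF]
  · exact (h₂ h₁.symm).elim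
  · exact (h₁ h₂.symm).elim
  · rw [hF, add_zero]

theorem subCell_cells {P : MultipointSet d} {M : Memory} {F F' : Fin P.n → Prop} {s : Fin P.n}
    (hs : F s) (hs' : ¬ F' s) (h : ∀ x, x ≠ s → (F' x ↔ F x)) (h21 : M.nat 21 0 = s)
    (hg : M.nat 1 s = P.group s) (hp : M.real 1 s = P.prob s)
    (hF : ∀ i, M.real 4 i = groupSum P F i) (i : ℕ) :
    (subCell.exec M).real 4 i = groupSum P F' i := by
  have hins := groupSum_insert hs' hs fun x hx => (h x hx).symm
  simp only [subCell, Program.exec, RealExpr.eval, NatExpr.eval, h21, hg, hp,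
    Memory.storeReal_real, if_true, Function.update_apply]
  split_ifs with h₁
  · rw [hF, hins, if_pos rfl, h₁]
    ring
  · rw [hF, hins, if_neg (Ne.symm h₁), add_zero]

theorem groupSum_eq {P : MultipointSet d} {F F' : Fin P.n → Prop} {s : Fin P.n}
    (h : ∀ x, x ≠ s → (F' x ↔ F x)) {i : ℕ} (hi : i ≠ P.group s) :
    groupSum P F' i = groupSum P F i := by
  classical
  rw [groupSum, groupSum]
  congr 1
  ext x
  simp only [Finset.mem_filter, Finset.mem_univ, true_and]
  constructor <;> rintro ⟨h₁, rfl⟩ <;> refine ⟨?_, rfl⟩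
  · exact (h x fun hx => hi (by rw [hx])).1 h₁
  · exact (h x fun hx => hi (by rw [hx])).2 h₁

/-- Initially all sites that are not of class `i` are forbidden. -/
def initSweep (i : ℕ) : Program :=
  forSites 21 (.ite (.natEq (.get 19 (.reg 21)) (.lit i)) .skip (update addCell))

theorem ends_initSweep {P : MultipointSet 2} {q : Fin 2 → ℝ} {M : Memory} (i : ℕ)
    (hM : Prepared P q M) (hF : FactorState P (fun _ => False) M) :
    Ends (initSweep i) M (P.n * 182 + 9)
      (FactorState P fun s => angleClass (P.offset q) s ≠ i) := by
  refine (Ends.forSites (n := P.n) (c := 170) (I := fun k M' => FactorState P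
    (fun s => s.val < k ∧ angleClass (P.offset q) s ≠ i) M') (by simp)
    (by simp [update, removeFactor, insertFactor, addCell, Program.WritesNat])
    (by simp [update, removeFactor, insertFactor, addCell, Program.WritesNat]) hM.input.n_eq
    ?_ (by simpa using hF) ?_).mono le_rfl ?_
  · intro k M' v h
    simpa [FactorState, FactorsOn, Memory.storeNat_nat] using h
  · intro k hk M' hf hx hI
    have hT : Prepared P q M' := by
      refine hM.frame hf ?_ ?_ ?_ ?_ ?_ ?_ <;>
      simp [update, removeFactor, insertFactor, addCell, Program.WritesNat, Program.WritesReal]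
      omega
    have hclass : M'.nat 19 k = angleClass (P.offset q) ⟨k, hk⟩ := hT.class_eq ⟨k, hk⟩
    have hother : ∀ x : Fin P.n, x ≠ ⟨k, hk⟩ →
        ((x.val < k + 1 ∧ angleClass (P.offset q) x ≠ i) ↔
          (x.val < k ∧ angleClass (P.offset q) x ≠ i)) := by
      intro x hxk
      have : x.val ≠ k := fun h => hxk (Fin.ext h)
      constructor <;> rintro ⟨h₁, h₂⟩ <;> refine ⟨by omega, h₂⟩
    refine (Ends.ite (t := 150) (fun hb => ?_) (fun hb => ?_)).mono (t := _)
      (by simp [Test.natEq, Test.cost, NatExpr.cost]) (fun _ _ h => h)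
    · simp only [Test.holds_natEq, NatExpr.eval, hx, hclass] at hb
      refine (Ends.of_loopFree (p := .skip) trivial (Q := _) ?_).mono (by simp [Program.cost])
        (fun _ _ h => h)
      suffices h : (fun s : Fin P.n => s.val < k + 1 ∧ angleClass (P.offset q) s ≠ i) =
          fun s => s.val < k ∧ angleClass (P.offset q) s ≠ i by
        rw [h]
        exact hI
      ext x
      by_cases hxk : x = ⟨k, hk⟩
      · subst hxk; simp [hb]
      · exact hother x hxk
    · simp only [Test.holds_natEq, NatExpr.eval, hx, hclass] at hb
      refine (ends_update (c := addCell.cost) (x := 0) hT.input (s := ⟨k, hk⟩) hx hI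
        (by simp [addCell, Program.WritesNat]) (by simp [addCell, Program.WritesReal])
        (fun j hj => groupSum_eq hother hj) fun M₁ hf₁ h₁ => ?_).mono
        (by simp [removeFactor, insertFactor, addCell, Program.cost, Test.realEq, Test.cost,
          NatExpr.cost, RealExpr.cost]) (fun _ _ h => h.1)
      have hn : ∀ a, a ≠ 20 → M₁.nat a = M'.nat a := fun a ha =>
        hf₁.1 a (by simp [removeFactor, Program.WritesNat, ha])
      have hr : ∀ a, a ≠ 5 → M₁.real a = M'.real a := fun a ha =>
        hf₁.2 a (by simp [removeFactor, Program.WritesReal, ha])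
      refine Ends.of_loopFree (by simp [addCell, Program.LoopFree]) ⟨?_, ?_⟩
      · refine addCell_cells (s := ⟨k, hk⟩) (by simp) (by simpa using hb) hother ?_ ?_ ?_ ?_
        · rw [hn 21 (by omega), hx]
        · rw [hn 1 (by omega), hT.input.group_eq]
        · rw [hr 1 (by omega), hT.input.prob_eq]
        · rw [hr 4 (by omega)]; exact hI.1
      · simp [addCell, Program.exec, Memory.storeReal_real]
  · intro M' _ h
    simpa using h

/-- Handles the current site in the sweep. -/
def sweepSite (i k : ℕ) : Program :=
  .ite (.natEq (.get 19 (.reg 21)) (.lit i))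
    (.seq (.ite (.natEq (.reg 20) (.lit 0))
      (.setReal 6 (.lit 0) (.add (.reg 6) (.mul (.get 1 (.reg 21)) (.reg 5)))) .skip) addCell)
    (.ite (.natEq (.get 19 (.reg 21)) (.lit k)) subCell .skip)

open Classical in
-- A site of class `i` contributes the event that it is the first of its class and is forbidden from
-- then on; a site of class `k` becomes allowed.
theorem ends_sweepSite {P : MultipointSet 2} {q : Fin 2 → ℝ} {M : Memory} {F F' : Fin P.n → Prop}
    {i k : ℕ} {s : Fin P.n} (hM : Prepared P q M) (h21 : M.nat 21 0 = s) (hF : FactorState P F M)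
    (hi : angleClass (P.offset q) s = i → ¬ F s ∧ F' s)
    (hk : angleClass (P.offset q) s ≠ i → angleClass (P.offset q) s = k → F s ∧ ¬ F' s)
    (hne : angleClass (P.offset q) s ≠ i → angleClass (P.offset q) s ≠ k → (F' s ↔ F s))
    (hother : ∀ x, x ≠ s → (F' x ↔ F x)) :
    Ends (update (sweepSite i k)) M 200 fun M' => FactorState P F' M' ∧
      M'.real 6 0 = M.real 6 0 + if angleClass (P.offset q) s = i then
        P.tupleProb (fun _ : Fin 1 => s) F else 0 := by
  refine (ends_update (c := (sweepSite i k).cost) hM.input h21 hF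
    (by simp [sweepSite, addCell, subCell, Program.WritesNat])
    (by simp [sweepSite, addCell, subCell, Program.WritesReal])
    (fun j hj => groupSum_eq hother hj) fun M₁ hf₁ h₁ => ?_).mono
    (by simp [removeFactor, insertFactor, sweepSite, addCell, subCell, Program.cost, Test.realEq,
      Test.natEq, Test.cost, NatExpr.cost, RealExpr.cost]) (fun _ _ h => h)
  have hn : ∀ a, a ≠ 20 → M₁.nat a = M.nat a := fun a ha =>
    hf₁.1 a (by simp [removeFactor, Program.WritesNat, ha])
  have hr : ∀ a, a ≠ 5 → M₁.real a = M.real a := fun a ha =>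
    hf₁.2 a (by simp [removeFactor, Program.WritesReal, ha])
  have h21' : M₁.nat 21 0 = s := by rw [hn 21 (by omega), h21]
  have hg : M₁.nat 1 s = P.group s := by rw [hn 1 (by omega), hM.input.group_eq]
  have hp : M₁.real 1 s = P.prob s := by rw [hr 1 (by omega), hM.input.prob_eq]
  have h4 : ∀ j, M₁.real 4 j = groupSum P F j := by rw [hr 4 (by omega)]; exact hF.1
  have hc : M₁.nat 19 s = angleClass (P.offset q) s := by rw [hn 19 (by omega), hM.class_eq]
  -- The factor of the group of `s` is out at this moment, and the zero counter tells whether the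
  -- rest vanishes.
  have hprob : P.tupleProb (fun _ : Fin 1 => s) F =
      if M₁.nat 20 0 = 0 then P.prob s * M₁.real 5 0 else 0 := by
    rw [tupleProb_one, h₁.1, h₁.2, ← mul_ite_zero, ← prod_eq_of_zerosOn]
    simp only [h4]
  refine Ends.of_loopFree (by simp [sweepSite, addCell, subCell, Program.LoopFree]) ?_
  simp only [sweepSite, Program.exec, Test.holds_natEq, NatExpr.eval, RealExpr.eval, h21', hc]
  split_ifs with h h0 h'
  · refine ⟨addCell_cells (hi h).1 (hi h).2 hother h21' hg ?_ ?_, ?_⟩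
    · simpa [Memory.storeReal_real] using hp
    · simpa [Memory.storeReal_real] using h4
    · simp [addCell, Program.exec, Memory.storeReal_real, hprob, h0, hp]
  · refine ⟨addCell_cells (hi h).1 (hi h).2 hother h21' hg hp h4, ?_⟩
    simp [addCell, Program.exec, Memory.storeReal_real, hprob, h0]
  · refine ⟨subCell_cells (hk h h').1 (hk h h').2 hother h21' hg hp h4, ?_⟩
    simp [subCell, Program.exec, Memory.storeReal_real]
  · refine ⟨fun j => ?_, by simp⟩
    rw [h4, show F' = F from funext fun x => propext ?_]
    by_cases hx : x = s
    · rw [hx, hne h h']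
    · exact hother x hx

/-- Handles all sites in the angular order. -/
def sweep (i k : ℕ) : Program :=
  forSites 3 (.seq (.setNat 21 (.lit 0) (.get 10 (.add (.get 11 (.lit 1)) (.reg 3))))
    (update (sweepSite i k)))

open Classical in
-- Passing a position can change the status only of the site found there; by injectivity of `o` this
-- site has not been met before.
theorem ends_sweep {P : MultipointSet 2} {q : Fin 2 → ℝ} {M : Memory} {i k : ℕ} (hik : i ≠ k)
    {o : Fin P.n → Fin P.n} (ho : Function.Injective o) (hM : Prepared P q M)
    (hsite : ∀ a : Fin P.n, sortedSite M a = o a)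
    (hF : FactorState P (fun s => angleClass (P.offset q) s ≠ i) M) :
    Ends (sweep i k) M (P.n * 222 + 9) fun M' => (∃ F, FactorState P F M') ∧
      M'.real 6 0 = M.real 6 0 + ∑ a, if angleClass (P.offset q) (o a) = i then
        P.tupleProb (fun _ : Fin 1 => o a)
          (SweepForbidden (angleClass (P.offset q)) i k (sortedSite M) a) else 0 := by
  refine (Ends.forSites (n := P.n) (c := 210) (I := fun p M' => FactorState P
    (SweepForbidden (angleClass (P.offset q)) i k (sortedSite M) p) M' ∧
      M'.real 6 0 = M.real 6 0 + ∑ a : Fin P.n with a.val < p ∧ angleClass (P.offset q) (o a) = i,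
        P.tupleProb (fun _ : Fin 1 => o a)
          (SweepForbidden (angleClass (P.offset q)) i k (sortedSite M) a)) (by simp)
    (by simp [update, removeFactor, insertFactor, sweepSite, addCell, subCell, Program.WritesNat])
    (by simp [update, removeFactor, insertFactor, sweepSite, addCell, subCell, Program.WritesNat])
    hM.input.n_eq ?_ ?_ ?_).mono le_rfl ?_
  · intro p M' v h
    simpa [FactorState, FactorsOn, Memory.storeNat_nat] using h
  · suffices h : SweepForbidden (angleClass (P.offset q)) i k (sortedSite M) 0 =
        fun s => angleClass (P.offset q) s ≠ i by
      rw [h]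
      simpa using hF
    ext s
    simp [SweepForbidden]
  · rintro p hp M' hf hx ⟨hI, hacc⟩
    have hT : Prepared P q M' := by
      refine hM.frame hf ?_ ?_ ?_ ?_ ?_ ?_ <;>
      simp [update, removeFactor, insertFactor, sweepSite, addCell, subCell, Program.WritesNat,
        Program.WritesReal]
      omega
    have hn : ∀ a, a ≠ 3 → a ≠ 20 → a ≠ 21 → M'.nat a = M.nat a := fun a h₁ h₂ h₃ =>
      hf.1 a (by simp [update, removeFactor, insertFactor, sweepSite, addCell, subCell,
        Program.WritesNat, h₁, h₂, h₃])
    have hs : sortedSite M p = o ⟨p, hp⟩ := hsite ⟨p, hp⟩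
    have hex : ∀ (r : ℕ) (x : Fin P.n), r ≤ P.n → ((∃ a < r, sortedSite M a = x) ↔
        ∃ a : Fin P.n, a.val < r ∧ o a = x) := by
      intro r x hr
      constructor
      · rintro ⟨a, ha, hax⟩
        exact ⟨⟨a, by omega⟩, ha, Fin.ext (by rw [← hsite, hax])⟩
      · rintro ⟨a, ha, hax⟩
        exact ⟨a, ha, by rw [hsite, hax]⟩
    have hfresh : ¬ ∃ a < p, sortedSite M a = o ⟨p, hp⟩ := by
      rw [hex p _ hp.le]
      rintro ⟨a, ha, hax⟩
      rw [ho hax] at ha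
      exact lt_irrefl _ ha
    have hnow : ∃ a < p + 1, sortedSite M a = o ⟨p, hp⟩ := ⟨p, by omega, hs⟩
    have hold : ∀ x, x ≠ o ⟨p, hp⟩ →
        ((∃ a < p + 1, sortedSite M a = x.val) ↔ ∃ a < p, sortedSite M a = x.val) := by
      intro x hx
      constructor
      · rintro ⟨a, ha, hax⟩
        refine ⟨a, lt_of_le_of_ne (by omega) ?_, hax⟩
        rintro rfl
        exact hx (Fin.ext (by rw [← hs, hax]))
      · rintro ⟨a, ha, hax⟩
        exact ⟨a, by omega, hax⟩
    refine (Ends.seq (t := 10) (R := fun M₁ => M₁ = M'.storeNat 21 0 (o ⟨p, hp⟩)) (u := 200)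
      ?_ ?_).mono le_rfl (fun _ _ h => h)
    · refine (Ends.of_loopFree (by simp [Program.LoopFree]) ?_).mono (t := _) (by simp [Program.cost, NatExpr.cost])
        (fun _ _ h => h)
      simp only [Program.exec, NatExpr.eval]
      rw [hx, hn 10 (by omega) (by omega) (by omega), hn 11 (by omega) (by omega) (by omega), ← hs,
        sortedSite]
    · rintro M₁ hf₁ rfl
      refine (ends_sweepSite (F := SweepForbidden (angleClass (P.offset q)) i k (sortedSite M) p)
        (F' := SweepForbidden (angleClass (P.offset q)) i k (sortedSite M) (p + 1))
        (s := o ⟨p, hp⟩) (q := q) ?_ ?_ ?_ ?_ ?_ ?_ ?_).imp ?_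
      · refine hT.frame hf₁ ?_ ?_ ?_ ?_ ?_ ?_ <;> simp [Program.WritesNat, Program.WritesReal]
      · simp [Memory.storeNat_nat]
      · simpa [FactorState, FactorsOn, Memory.storeNat_nat] using hI
      · intro h
        simp only [SweepForbidden, h, hfresh, hnow]
        tauto
      · intro h h'
        simp only [SweepForbidden, h', hik.symm, hfresh, hnow]
        tauto
      · intro h h'
        simp [SweepForbidden, h, h']
      · intro x hx
        simp only [SweepForbidden, hold x hx]
      · rintro M₂ _ ⟨h₁, h₂⟩
        refine ⟨h₁, ?_⟩
        rw [h₂, sum_filter_lt_succ _ _ hp, Memory.storeNat_real, hacc, add_assoc]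
  · rintro M' _ ⟨h₁, h₂⟩
    refine ⟨⟨_, h₁⟩, ?_⟩
    rw [h₂, Finset.sum_filter]
    simp

/-- Clears the cells of all groups. -/
def clearCells : Program := forSites 2 (.setReal 4 (.get 1 (.reg 2)) (.lit 0))

theorem ends_clearCells {P : MultipointSet d} {q : Fin d → ℝ} {M : Memory} (hd : d ≤ 2)
    (hM : HoldsInput P q M) {F : Fin P.n → Prop} (hF : FactorState P F M) :
    Ends clearCells M (P.n * 18 + 9) fun M' => ∀ j, M'.real 4 j = 0 := by
  classical
  -- A cell must be clear as soon as no remaining site belongs to its group.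
  refine (Ends.forSites (n := P.n) (c := 6) (I := fun p M' => ∀ j,
    (∀ s : Fin P.n, p ≤ s.val → (P.group s : ℕ) ≠ j) → M'.real 4 j = 0) (by simp)
    (by simp [Program.WritesNat]) (by simp [Program.WritesNat]) hM.n_eq (fun _ _ _ h => h)
    ?_ ?_).mono le_rfl ?_
  · intro j hj
    rw [hF.1, groupSum]
    refine Finset.sum_eq_zero fun s hs => ?_
    rw [Finset.mem_filter] at hs
    exact (hj s (by omega) hs.2.2).elim
  · intro k hk M' hf hx hI
    have hT : HoldsInput P q M' := hM.frame hf (by simp [Program.WritesNat])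
      (by simp [Program.WritesNat]) (by simp [Program.WritesReal]; omega)
    have hg : M'.nat 1 k = P.group ⟨k, hk⟩ := hT.group_eq ⟨k, hk⟩
    refine (Ends.of_loopFree (by simp [Program.LoopFree]) ?_).mono (t := _)
      (by simp [Program.cost, NatExpr.cost, RealExpr.cost]) (fun _ _ h => h)
    intro j hj
    simp only [Program.exec, NatExpr.eval, RealExpr.eval, hx, hg, Memory.storeReal_real, if_true,
      Function.update_apply, Int.cast_zero]
    split_ifs with h
    · rfl
    · refine hI j fun s hs => ?_
      rcases hs.eq_or_lt with h' | h'
      · rw [show s = ⟨k, hk⟩ from Fin.ext h'.symm]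
        exact fun h'' => h h''.symm
      · exact hj s h'
  · intro M' _ h j
    exact h j fun s hs => by omega

end RealRAM

/-! ### The two phases of the sweep and the planar program. -/

namespace RealRAM

/-- The memory is prepared, and the cells of all groups are clear. -/
def SweepReady (P : MultipointSet 2) (q : Fin 2 → ℝ) (M : Memory) : Prop :=
  Prepared P q M ∧ ∀ j, M.real 4 j = 0

/-- Adds the probability of the outcomes whose sites of class `k` precede those of class `i`. -/
def sweepPhase (i k : ℕ) : Program :=
  .seq (.seq (.setReal 5 (.lit 0) (.lit 1)) (.setNat 20 (.lit 0) (.lit 0)))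
    (.seq (initSweep i) (.seq (sortProgram (lessTest i)) (.seq (sweep i k) clearCells)))

theorem factorState_false {P : MultipointSet 2} {M : Memory} (h4 : ∀ j, M.real 4 j = 0)
    (h5 : M.real 5 0 = 1) (h20 : M.nat 20 0 = 0) : FactorState P (fun _ => False) M := by
  refine ⟨fun j => ?_, ?_, ?_⟩
  · simp [h4, groupSum]
  · simp [h20, zerosOn, h4]
  · simp [h5, prodOn, h4]

theorem exists_bijective_of_perm {n : ℕ} {f : ℕ → ℕ}
    (h : ((List.range n).map f).Perm (List.range n)) :
    ∃ o : Fin n → Fin n, Function.Bijective o ∧ ∀ a : Fin n, f a = o a := by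
  have hlt : ∀ a : Fin n, f a < n := fun a =>
    List.mem_range.1 (h.mem_iff.1 (List.mem_map_of_mem (List.mem_range.2 a.2)))
  refine ⟨fun a => ⟨f a, hlt a⟩, Finite.injective_iff_bijective.1 fun a b hab => ?_, fun _ => rfl⟩
  have hnd := h.nodup_iff.2 List.nodup_range
  exact Fin.ext (List.inj_on_of_nodup_map hnd (List.mem_range.2 a.2) (List.mem_range.2 b.2)
    (Fin.mk.inj hab))

/-- The running time of a phase of the sweep. -/
def phaseTime (i n : ℕ) : ℕ :=
  6 + (n * 182 + 9 + (sortTime (lessTest i) n + (n * 222 + 9 + (n * 18 + 9))))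

open Classical in
theorem ends_sweepPhase {P : MultipointSet 2} {q : Fin 2 → ℝ} {M : Memory} {i k : ℕ} (hik : i ≠ k)
    (hM : SweepReady P q M) : Ends (sweepPhase i k) M (phaseTime i P.n) fun M' =>
      SweepReady P q M' ∧ M'.real 6 0 = M.real 6 0 +
        P.expect fun B => if StartsWith (P.offset q) i k B then 1 else 0 := by
  refine Ends.seq (R := FactorState P fun _ => False) ?_ fun M₁ hf₁ h₁ => ?_
  · refine (Ends.of_loopFree (by simp [Program.LoopFree]) ?_).mono (t := _)
      (by simp [Program.cost, NatExpr.cost, RealExpr.cost]) (fun _ _ h => h)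
    apply factorState_false <;>
      simp [Program.exec, Memory.storeNat_nat, Memory.storeReal_real, NatExpr.eval, RealExpr.eval,
        hM.2]
  have hP₁ : Prepared P q M₁ := by
    refine hM.1.frame hf₁ ?_ ?_ ?_ ?_ ?_ ?_ <;> simp [Program.WritesNat, Program.WritesReal]
    omega
  have h6₁ : M₁.real 6 = M.real 6 := hf₁.2 6 (by simp [Program.WritesReal])
  refine Ends.seq (ends_initSweep i hP₁ h₁) fun M₂ hf₂ h₂ => ?_
  have hP₂ : Prepared P q M₂ := by
    refine hP₁.frame hf₂ ?_ ?_ ?_ ?_ ?_ ?_ <;> simp [initSweep, update, removeFactor,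
      insertFactor, addCell, Program.WritesNat, Program.WritesReal]
    omega
  have h6₂ : M₂.real 6 = M₁.real 6 := hf₂.2 6 (by simp [initSweep, update, removeFactor,
    insertFactor, addCell, Program.WritesReal])
  have hU := upper_directionAt P q
  refine Ends.seq (ends_sortProgram (R := Precedes (directionAt P q) (classAt P q) i) ?_ ?_
    (hP₂.compares i) hP₂.input.n_eq) ?_
  · intro a b c
    simpa [notAfter] using not_precedes_trans hU
  · intro a b
    simpa [notAfter] using not_precedes_total
  rintro M₃ hf₃ ⟨hperm, hsort⟩
  have hP₃ : Prepared P q M₃ := by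
    refine hP₂.frame hf₃ ?_ ?_ ?_ ?_ ?_ ?_
    · exact fun h => by have := sortProgram_writesNat h; omega
    · exact fun h => by have := sortProgram_writesNat h; omega
    · exact fun h => by have := sortProgram_writesNat h; omega
    all_goals simp [sortProgram_writesReal]
  have h₃ : FactorState P (fun s => angleClass (P.offset q) s ≠ i) M₃ := by
    have h20 : M₃.nat 20 = M₂.nat 20 := hf₃.1 20 fun h => by
      have := sortProgram_writesNat h; omega
    simpa [FactorState, FactorsOn, h20, hf₃.2 _ sortProgram_writesReal] using h₂
  obtain ⟨o, ho, hso⟩ := exists_bijective_of_perm hperm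
  refine Ends.seq (ends_sweep hik ho.injective hP₃ hso h₃) ?_
  rintro M₄ hf₄ ⟨⟨F, h₄⟩, hacc⟩
  have hP₄ : Prepared P q M₄ := by
    refine hP₃.frame hf₄ ?_ ?_ ?_ ?_ ?_ ?_ <;> simp [sweep, sweepSite, update, removeFactor,
      insertFactor, addCell, subCell, Program.WritesNat, Program.WritesReal]
    omega
  refine (ends_clearCells le_rfl hP₄.input h₄).imp fun M₅ hf₅ h₅ => ⟨⟨?_, h₅⟩, ?_⟩
  · refine hP₄.frame hf₅ ?_ ?_ ?_ ?_ ?_ ?_ <;>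
      simp [clearCells, Program.WritesNat, Program.WritesReal]
    omega
  rw [hf₅.2 6 (by simp [clearCells, Program.WritesReal]), hacc, hf₃.2 6 sortProgram_writesReal,
    h6₂, h6₁]
  congr 1
  -- The accumulated terms are the expected values of the summands of `sum_sweep`.
  simp only [← sum_sweep (P.offset q) (w := directionAt P q) (cl := classAt P q)
    (fun s => by simp [directionAt]) (fun s => by simp [classAt]) hik hso ho
    (fun a b hab => by rw [← hso, ← hso]; exact hsort a b hab b.2)]
  rw [MultipointSet.expect_sum]
  refine Finset.sum_congr rfl fun a _ => ?_
  split_ifs with h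
  · rw [MultipointSet.expect_tupleEvent]
    · exact Function.injective_of_subsingleton _
    · intro _
      simp only [SweepForbidden, h, true_and, ne_eq, not_true_eq_false, false_and, or_false]
      rintro ⟨b, hb, hba⟩
      rw [hso ⟨b, by omega⟩] at hba
      have := ho.injective (Fin.ext hba)
      rw [← this] at hb
      exact lt_irrefl _ hb
  · simp [MultipointSet.expect]

/-- The program for the plane. -/
def planarProgram : Program :=
  .seq prepProgram (.seq (addTupleProb 2 0 1 .true) (.seq (sweepPhase 1 2)
    (.seq (sweepPhase 2 1) (.setReal 0 (.lit 0) (.sub (.lit 1) (.reg 6))))))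

/-- The running time of the program for the plane. -/
def planarTime (n : ℕ) : ℕ :=
  n * 400 + 9 + ((n + 1) * (Test.true.cost + 61) + (phaseTime 1 n + (phaseTime 2 n + 6)))

theorem planarProgram_computes (P : MultipointSet 2) (q : Fin 2 → ℝ) :
    ComputesMembershipWithin planarProgram P q (planarTime P.n) := by
  classical
  have hin := holdsInput_inputMemory P q
  suffices h : Ends planarProgram (inputMemory P q) (planarTime P.n)
      fun M => M.real 0 0 = P.membershipProb q by
    exact h
  refine Ends.seq (ends_prepProgram hin) fun M₁ hf₁ h₁ => ?_
  have h4 : ∀ a, 4 ≤ a → a ≤ 6 → ∀ j, M₁.real a j = 0 := by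
    intro a ha ha' j
    rw [hf₁.2 a (by simp [prepProgram, Program.WritesReal]; omega)]
    simp only [inputMemory]
    rw [dif_neg (by omega), dif_neg (by omega), dif_neg (by omega)]
  -- Everything is forbidden here, which gives the probability of the empty outcome. For `d = 2` the
  -- arrays `d + 2`, `d + 3` and `d + 4` are the arrays 4, 5 and 6 of the sweep, so the value lands
  -- in the same accumulator.
  have hadd := adds_addTupleProb (P := P) (q := q) 1 (F := Test.true) (p := fun _ => True)
    fun s M _ _ => by simp [Test.holds_true]
  refine Ends.seq (hadd M₁ ⟨h₁.input, h4 4 le_rfl (by omega)⟩) ?_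
  rintro M₂ hf₂ ⟨h₂, hacc₂⟩
  have hP₂ : Prepared P q M₂ := by
    refine h₁.frame hf₂ ?_ ?_ ?_ ?_ ?_ ?_
    iterate 3 exact fun h => by have := addTupleProb_writesNat h; omega
    · exact fun a ha h => by have := addTupleProb_writesReal h; omega
    iterate 2 exact fun h => by have := addTupleProb_writesReal h; omega
  refine Ends.seq (ends_sweepPhase (i := 1) (k := 2) (by omega) ⟨hP₂, h₂.2⟩) ?_
  rintro M₃ - ⟨h₃, hacc₃⟩
  refine Ends.seq (ends_sweepPhase (i := 2) (k := 1) (by omega) h₃) ?_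
  rintro M₄ - ⟨h₄, hacc₄⟩
  refine (Ends.of_loopFree (by simp [Program.LoopFree]) ?_).mono (t := _)
    (by simp [Program.cost, NatExpr.cost, RealExpr.cost]) (fun _ _ h => h)
  have hempty : P.expect (MultipointSet.tupleEvent (j := 0) Fin.elim0 fun _ => True) =
      P.expect fun B => if B = ∅ then 1 else 0 := by
    congr 1
    funext B
    simp [MultipointSet.tupleEvent, Finset.eq_empty_iff_forall_notMem]
  rw [P.membershipProb_eq q]
  simp only [P.notMem_convexHull_iff, openSide_two_indicator, P.expect_add, ← hempty]
  simp only [Program.exec, RealExpr.eval, NatExpr.eval, Memory.storeReal_real, if_true,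
    Function.update_self, hacc₄, hacc₃, hacc₂, Nat.reduceAdd, h4 6 (by omega) le_rfl, Int.cast_one]
  ring

theorem exists_planarTime_le : ∃ C : ℕ, ∀ n,
    planarTime n ≤ C * ((n + 1) * (Nat.log 2 (2 * n) + 1)) := by
  refine ⟨9 + 400 + (Test.true.cost + 61) + 6 + 2 * (6 + 182 + 9 + 222 + 9 + 18 + 9 + 30) +
    (mergeCost (lessTest 1) + mergeTest.cost + 130) +
    (mergeCost (lessTest 2) + mergeTest.cost + 130), fun n => ?_⟩
  simp only [planarTime, phaseTime, sortTime]
  generalize Nat.log 2 (2 * n) = l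
  generalize mergeCost (lessTest 1) = a
  generalize mergeCost (lessTest 2) = b
  generalize Test.true.cost = c
  generalize mergeTest.cost = e
  ring_nf
  nlinarith [Nat.zero_le (n * l), Nat.zero_le (n * l * e), Nat.zero_le (n * l * a),
    Nat.zero_le (n * l * b), Nat.zero_le (n * l * c), Nat.zero_le (l * e), Nat.zero_le (l * a),
    Nat.zero_le (l * b), Nat.zero_le (l * c), Nat.zero_le (n * a), Nat.zero_le (n * b)]

end RealRAM

/-! ### Growth of the running times and the theorem. -/

open Asymptotics Filter in
theorem isBigO_planar (C : ℕ) :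
    (fun n : ℕ => ((C * ((n + 1) * (Nat.log 2 (2 * n) + 1)) : ℕ) : ℝ)) =O[atTop]
      fun n : ℕ => (n : ℝ) * Real.log n := by
  refine IsBigO.of_bound (C * 12) (eventually_atTop.2 ⟨3, fun n hn => ?_⟩)
  have hn' : (3 : ℝ) ≤ n := by exact_mod_cast hn
  -- This absorbs the additive constants and is the reason for `n ≥ 3`.
  have hlog : 1 ≤ Real.log n := by
    rw [Real.le_log_iff_exp_le (by linarith)]
    linarith [Real.exp_one_lt_d9]
  have hl : (Nat.log 2 (2 * n) : ℝ) ≤ 1 + Real.log n / Real.log 2 := by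
    have h := Real.natLog_le_logb (2 * n) 2
    rw [Real.logb] at h
    push_cast at h
    rw [Real.log_mul (by norm_num) (by linarith), add_div,
      div_self (Real.log_pos (by norm_num)).ne'] at h
    exact h
  have h2 : Real.log n / Real.log 2 ≤ 2 * Real.log n := by
    rw [div_le_iff₀ (Real.log_pos (by norm_num))]
    nlinarith [Real.log_two_gt_d9]
  have hpos : 0 ≤ (n : ℝ) * Real.log n := by positivity
  rw [Real.norm_of_nonneg (by positivity), Real.norm_of_nonneg hpos, mul_assoc]
  push_cast
  refine mul_le_mul_of_nonneg_left ?_ (Nat.cast_nonneg C)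
  calc ((n : ℝ) + 1) * (Nat.log 2 (2 * n) + 1) ≤ (2 * n) * (6 * Real.log n) := by
        refine mul_le_mul ?_ ?_ (by positivity) (by positivity) <;> linarith
    _ = 12 * (n * Real.log n) := by ring

open Asymptotics Filter in
theorem isBigO_succ_pow (C d : ℕ) :
    (fun n : ℕ => ((C * (n + 1) ^ d : ℕ) : ℝ)) =O[atTop] fun n : ℕ => (n : ℝ) ^ d := by
  refine IsBigO.of_bound (C * 2 ^ d) (eventually_atTop.2 ⟨1, fun n hn => ?_⟩)
  have hn' : (1 : ℝ) ≤ n := by exact_mod_cast hn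
  rw [Real.norm_of_nonneg (by positivity), Real.norm_of_nonneg (by positivity), mul_assoc,
    ← mul_pow]
  push_cast
  gcongr
  linarith

theorem mainTheorem3 :
    (∃ (prog : RealRAM.Program) (T : ℕ → ℕ),
      ((fun n : ℕ => (T n : ℝ)) =O[Filter.atTop] fun n : ℕ => (n : ℝ) * Real.log n) ∧
      ∀ (P : MultipointSet 2) (q : Fin 2 → ℝ),
        RealRAM.ComputesMembershipWithin prog P q (T P.n)) ∧
    (∀ d : ℕ, 3 ≤ d →
      ∃ (prog : RealRAM.Program) (T : ℕ → ℕ),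
        ((fun n : ℕ => (T n : ℝ)) =O[Filter.atTop] fun n : ℕ => (n : ℝ) ^ d) ∧
        ∀ (P : MultipointSet d) (q : Fin d → ℝ), P.GeneralPosition q →
          RealRAM.ComputesMembershipWithin prog P q (T P.n)) := by
  refine ⟨?_, fun d hd => ?_⟩
  · obtain ⟨C, hC⟩ := RealRAM.exists_planarTime_le
    refine ⟨RealRAM.planarProgram, _, isBigO_planar C, fun P q => ?_⟩
    obtain ⟨u, M, hr, hu, hM⟩ := RealRAM.planarProgram_computes P q
    exact ⟨u, M, hr, hu.trans (hC P.n), hM⟩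
  · obtain ⟨C, hC⟩ := RealRAM.exists_computes_of_generalPosition hd
    exact ⟨RealRAM.genericProgram d, _, isBigO_succ_pow C d, hC⟩
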